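/- Let $d\ge 1$ be an integer and $\gamma>d$ a real number. Put $d_1=2-\frac d\gamma\in(1,2)$, and let $\omega_{d-1}$ be the surface measure of the unit sphere of $\mathbb R^d$. Let $0<R_1<R_2<\dots$ be the distances from the origin, in increasing order, of the points of a homogeneous Poisson point process in $\mathbb R^d$ of intensity $\lambda=(2\gamma-d)/\omega_{d-1}$. For $r\ge 1$ put $\rho=r^{d/2}$ and $$\overline S^{(r)}=\sum_{k:\,R_k>r}R_k^{-\gamma},\qquad \mu(r)=\mathbb E[\overline S^{(r)}],\qquad \sigma^2(r)=\mathrm{Var}(\overline S^{(r)}),\qquad Y^{(r)}=\frac{\overline S^{(r)}-\mu(r)}{\sigma(r)},\qquad \phi_{Y^{(r)}}(t)=\mathbb E[e^{-tY^{(r)}}].$$ The sum converges almost surely, $\overline S^{(r)}$ has finite mean and finite positive variance, $\phi_{Y^{(r)}}(t)$ is finite for all real $t$, and $Y^{(r)}$ has a (unique) continuous density $f_{Y^{(r)}}$ on $\mathbb R$. For $y>-\mu(r)/\sigma(r)$ the function $\xi'\mapsto e^{-\xi' y}\phi_{Y^{(r)}}(-\xi')$ has a unique minimiser $\xi=\xi(y,r)$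 over $\mathbb R$. Let $\widetilde Y^{(r)}$ be a random variable with density $z\mapsto e^{\xi z}f_{Y^{(r)}}(z)/\phi_{Y^{(r)}}(-\xi)$, and put $$\tilde\kappa_n=d_1\int_0^1 e^{\xi u/\rho}\,u^{n-1-d/\gamma}\,du,\qquad n\ge 2.$$ Then $\widetilde Y^{(r)}$ has mean $y$, variance $\tilde\kappa_2$, and its $n$-th cumulant is $\tilde\kappa_n/\rho^{n-2}$ for all $n\ge 2$. For $k\ge 0$, $1\le j\le k$ and $1\le \ell\le j$ put $$\tilde c_{j,\ell}=\frac1{\ell!}\sum_{\substack{3\le n_1,\dots,n_\ell\le k+2\\ (n_1-2)+\dots+(n_\ell-2)=j}}\frac{\tilde\kappa_{n_1}}{n_1!}\cdots\frac{\tilde\kappa_{n_\ell}}{n_\ell!},\qquad \tilde{\mathfrak n}_k=\frac1{\sqrt{2\pi\tilde\kappa_2}}\left[1+\sum_{j=1}^k\frac{(-1)^j}{\rho^j}\sum_{\ell=1}^j\frac{\tilde c_{j,\ell}}{\tilde\kappa_2^{j/2+\ell}}H_{j+2\ell}(0)\right],$$ where $H_n$ is the $n$-th (probabilists') Hermite polynomial.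 Theorem. There are constants $C_2,C_3,C_4\in(0,\infty)$, depending only on $d$ and $\gamma$, such that for all integers $k\ge 0$, all $r\ge 1$ and all $y>-\mu(r)/\sigma(r)$: (a) if $y\ge 0$ and $r^{d/2}\ge C_4\sqrt k$, then $$f_{Y^{(r)}}(y)=\tilde{\mathfrak n}_k\,e^{-\xi y}\,\phi_{Y^{(r)}}(-\xi)\,[1+\varepsilon_k(r,y)]$$ with $$|\varepsilon_k(r,y)|\le\frac{C_2C_3^k\,k^{k/2}}{(\sqrt{\tilde\kappa_2}\,r^{d/2})^{k+1}}\le\frac{C_2C_3^k\,k^{k/2}}{(r^{d/2})^{k+1}};$$ (b) if $y\le 0$ and $r^{d/2}\ge\max\{C_4\sqrt k,\,k\}$, then the same formula holds with $$|\varepsilon_k(r,y)|\le C_2C_3^k\,k^{k/2}\left(\frac{\tilde\kappa_2^{\frac1{d_1}-\frac12}}{r^{d/2}}\right)^{k+1}\le\frac{C_2C_3^k\,k^{k/2}}{(r^{d/2})^{k+1}}.$$ Here $k^{k/2}=1$ for $k=0$. -/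

import Mathlib

open MeasureTheory ProbabilityTheory Set

namespace ShotNoise

noncomputable section

/-- The number of points of the random set `Φ` that fall in `B`. -/
def count {Ω E : Type*} (Φ : Ω → Set E) (B : Set E) (ω : Ω) : ℕ∞ :=
  (Φ ω ∩ B).encard

/-- The random set of points `Φ` is a homogeneous Poisson point process of intensity `lam`:
the number of points in a Borel set of finite volume is Poisson distributed with mean
`lam` times the volume, and the numbers of points in disjoint Borel sets are independent. -/
structure IsHomogeneousPoisson {Ω : Type*} [MeasurableSpace Ω] (P : Measure Ω) {d : ℕ}
    (Φ : Ω → Set (EuclideanSpace ℝ (Fin d))) (lam : ℝ) : Prop where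
  measurable_count : ∀ B : Set (EuclideanSpace ℝ (Fin d)), MeasurableSet B →
    Measurable (count Φ B)
  law_count : ∀ B : Set (EuclideanSpace ℝ (Fin d)), MeasurableSet B → volume B ≠ ⊤ →
    P.map (count Φ B) =
      (poissonMeasure (lam * volume.real B).toNNReal).map (fun n : ℕ => (n : ℕ∞))
  indep_count : ∀ (n : ℕ) (B : Fin n → Set (EuclideanSpace ℝ (Fin d))),
    (∀ i, MeasurableSet (B i)) → Pairwise (fun i j => Disjoint (B i) (B j)) →
    iIndepFun (fun i => count Φ (B i)) P

/-- The surface measure `ω_{d-1}` of the unit sphere of `ℝ^d`. -/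
def sphereArea (d : ℕ) : ℝ :=
  (volume : Measure (EuclideanSpace ℝ (Fin d))).toSphere.real univ

/-- The normalised intensity `(2γ - d) / ω_{d-1}`. -/
def intensity (d : ℕ) (γ : ℝ) : ℝ :=
  (2 * γ - d) / sphereArea d

/-- `radius Φ k ω` is the distance `R_k` of the `k`-th closest point to the origin
(`k = 1, 2, …`): the least `x ≥ 0` such that at least `k` points are within distance `x`. -/
def radius {Ω : Type*} {d : ℕ} (Φ : Ω → Set (EuclideanSpace ℝ (Fin d))) (k : ℕ) (ω : Ω) : ℝ :=
  sInf {x : ℝ | 0 ≤ x ∧ (k : ℕ∞) ≤ count Φ (Metric.closedBall 0 x) ω}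

/-- The `k`-th summand of the tail shot noise: `R_k ^ (-γ)` if `R_k > r`, and `0` otherwise. -/
def tailTerm {Ω : Type*} {d : ℕ} (Φ : Ω → Set (EuclideanSpace ℝ (Fin d))) (γ r : ℝ) (k : ℕ)
    (ω : Ω) : ℝ :=
  if r < radius Φ k ω then radius Φ k ω ^ (-γ) else 0

/-- The tail shot noise `∑_{k ≥ 1, R_k > r} R_k ^ (-γ)`. -/
def tailNoise {Ω : Type*} {d : ℕ} (Φ : Ω → Set (EuclideanSpace ℝ (Fin d))) (γ r : ℝ)
    (ω : Ω) : ℝ :=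
  ∑' k : ℕ, tailTerm Φ γ r (k + 1) ω

/-- The mean `μ(r)` of the tail shot noise. -/
def noiseMean {Ω : Type*} [MeasurableSpace Ω] (P : Measure Ω) {d : ℕ}
    (Φ : Ω → Set (EuclideanSpace ℝ (Fin d))) (γ r : ℝ) : ℝ :=
  ∫ ω, tailNoise Φ γ r ω ∂P

/-- The standard deviation `σ(r)` of the tail shot noise. -/
def noiseStd {Ω : Type*} [MeasurableSpace Ω] (P : Measure Ω) {d : ℕ}
    (Φ : Ω → Set (EuclideanSpace ℝ (Fin d))) (γ r : ℝ) : ℝ :=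
  Real.sqrt (variance (tailNoise Φ γ r) P)

/-- The normalised tail shot noise `Y^(r)`. -/
def normNoise {Ω : Type*} [MeasurableSpace Ω] (P : Measure Ω) {d : ℕ}
    (Φ : Ω → Set (EuclideanSpace ℝ (Fin d))) (γ r : ℝ) (ω : Ω) : ℝ :=
  (tailNoise Φ γ r ω - noiseMean P Φ γ r) / noiseStd P Φ γ r

/-- The Laplace transform `t ↦ E[exp(-t Y)]` of a random variable `Y`. -/
def laplace {Ω : Type*} [MeasurableSpace Ω] (P : Measure Ω) (Y : Ω → ℝ) (t : ℝ) : ℝ :=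
  ∫ ω, Real.exp (-t * Y ω) ∂P

/-- The Cramér transform with parameter `ξ` of the law of `Y`: the density of the law of `Y` is
multiplied by `exp(ξ z) / E[exp(ξ Y)]`. -/
def tiltedLaw {Ω : Type*} [MeasurableSpace Ω] (P : Measure Ω) (Y : Ω → ℝ) (ξ : ℝ) : Measure ℝ :=
  (P.map Y).tilted (fun z => ξ * z)

/-- `d_1 = 2 - d / γ`. -/
def dOne (d : ℕ) (γ : ℝ) : ℝ :=
  2 - d / γ

/-- `ρ = r ^ (d / 2)`. -/
def rho (d : ℕ) (r : ℝ) : ℝ :=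
  r ^ ((d : ℝ) / 2)

/-- The coefficients `κ̃_n = d_1 ∫_0^1 exp(ξ u / ρ) u ^ (n - 1 - d / γ) du`, `n ≥ 2`. -/
def tkappa (d : ℕ) (γ r ξ : ℝ) (n : ℕ) : ℝ :=
  dOne d γ * ∫ u in (0 : ℝ)..1, Real.exp (ξ * u / rho d r) * u ^ ((n : ℝ) - 1 - d / γ)

/-- The coefficient `c̃_{j,ℓ}` of the Edgeworth expansion of order `k`:
`(1 / ℓ!) ∑ (κ_{n_1} / n_1!) ⋯ (κ_{n_ℓ} / n_ℓ!)` over all `3 ≤ n_1, …, n_ℓ ≤ k + 2` with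
`(n_1 - 2) + ⋯ + (n_ℓ - 2) = j`. -/
def edgeworthCoeff (κ : ℕ → ℝ) (k j l : ℕ) : ℝ :=
  (1 / (l.factorial : ℝ)) *
    ∑ n ∈ (Fintype.piFinset (fun _ : Fin l => Finset.Icc 3 (k + 2))).filter
        (fun n => ∑ i, (n i - 2) = j),
      ∏ i, κ (n i) / ((n i).factorial : ℝ)

/-- The Edgeworth term of order `k` at the mean, as an explicit function of
`κ_2, …, κ_{k+2}` and `ρ`. -/
def edgeworthTerm (κ : ℕ → ℝ) (ρ : ℝ) (k : ℕ) : ℝ :=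
  1 / Real.sqrt (κ 2) * gaussianPDFReal 0 1 0 *
    (1 + ∑ j ∈ Finset.Icc 1 k, (-1) ^ j / ρ ^ j *
      ∑ l ∈ Finset.Icc 1 j, edgeworthCoeff κ k j l / κ 2 ^ ((j : ℝ) / 2 + l) *
        (((Polynomial.hermite (j + 2 * l)).eval 0 : ℤ) : ℝ))

end

end ShotNoise

namespace ShotNoise

/-! Put α = d / γ, so that d₁ = 2 - α, and let the power law be the probability measure (2 - α) u^(1
- α) du on (0, 1]. Campbell's formula in polar coordinates, with u = (‖p‖ / r)^(-γ), gives E exp(z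
S) = exp(ρ² ∫ (exp(z r^(-γ) u) - 1) / u²), the integral being over the power law
(`IsHomogeneousPoisson.integral_exp_tailNoise`). After normalisation only α and ρ matter
(`IsNoiseLaw`). Tilting by ξ inserts the factor exp(b u), b = ξ / ρ, into the Lévy measure, so the
cumulants of the tilted law are moments of the tilted power law divided by powers of ρ. The
parameter ξ solves a mean equation with a strictly increasing left side (`exists_levyMean_eq`), and
convexity makes it the unique minimiser.

At the mean of the tilted law the phase of its characteristic function cancels. Fourier inversion
then expresses the density as ρ / (2π) times the integral of exp(ρ² ψ(t)), with ψ = `centredExponent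
α b` (`IsNoiseLaw.exists_density`). What remains is to expand this integral uniformly in b and ρ.

Substituting t = x / (√κ₂ ρ) turns the exponent into -x²/2 plus terms of order n ≥ 3 with
coefficients at most (A δ)^(n-2), for a small parameter δ. Give the term of order n the weight n -
2, expand the exponential into words, and keep total weight at most k. The Gaussian integral of what
is kept is the Edgeworth term, because Hermite values at 0 are Gaussian moments up to sign. Where 8
A δ |x| ≤ 1 the error is of size (8 A δ |x|)^(k+1) against a Gaussian, and integrating powers of |x|
produces the k^(k/2) (`exists_edgeworth_bound`). Elsewhere the integrand has modulus exp(-ρ²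
`decayRate`), and lower bounds for the decay rate are needed.

The two tails differ in δ. For b ≥ 0 every κ_n is at most κ₂, so δ = 1 / (√κ₂ ρ), and the decay rate
away from 0 exceeds a multiple of √κ₂ (`exists_right_expansion`). For b = -a ≤ 0 the relevant u have
scale 1 / (1 + a), comparable to q = κ₂^(1/d₁). Then κ_n is at most a multiple of n! κ₂ (const
q)^(n-2), so δ = q / (√κ₂ ρ), and decay at rate |t|^α beyond 1 / q yields exp(-c / δ²)
(`exists_left_expansion`). When √k is at most a small multiple of ρ, the normalised Edgeworth term
stays within 1/2 of 1, so absolute errors become relative ones (`exists_relative_error`). -/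

/-! ### Powers against Gaussians, and a Taylor remainder -/

/-- Apply y ≤ exp y to y = 2 Q x² / n and raise to the power n / 2. This is the source of the factor
k^(k/2) in the theorem. -/
theorem pow_le_rpow_mul_exp_sq {Q : ℝ} (hQ : 0 < Q) (n : ℕ) {x : ℝ} (hx : 0 ≤ x) :
    x ^ n ≤ (n / (2 * Q)) ^ ((n : ℝ) / 2) * Real.exp (Q * x ^ 2) := by
  rcases Nat.eq_zero_or_pos n with rfl | hn
  · simp [Real.one_le_exp (by positivity : 0 ≤ Q * x ^ 2)]
  have hn' : (0 : ℝ) < n := by exact_mod_cast hn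
  have h1 : x ^ 2 ≤ (n / (2 * Q)) * Real.exp (2 * Q * x ^ 2 / n) := by
    have := Real.add_one_le_exp (2 * Q * x ^ 2 / n)
    calc x ^ 2 = (n / (2 * Q)) * (2 * Q * x ^ 2 / n) := by field_simp
      _ ≤ _ := by gcongr; linarith
  calc x ^ n = (x ^ 2) ^ ((n : ℝ) / 2) := by
        rw [← Real.rpow_natCast x 2, ← Real.rpow_mul hx, ← Real.rpow_natCast]
        congr 1; push_cast; ring
    _ ≤ ((n / (2 * Q)) * Real.exp (2 * Q * x ^ 2 / n)) ^ ((n : ℝ) / 2) := by gcongr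
    _ = _ := by
        rw [Real.mul_rpow (by positivity) (by positivity), ← Real.exp_mul]
        congr 2; field_simp

/-- Shifting k by two costs only a geometric factor, since k + 2 ≤ 3 k and k ≤ 2^k for k ≥ 1. For k
= 0 the convention 0^0 = 1 applies. -/
theorem halfPow_add_two_le (k : ℕ) :
    ((k + 2 : ℕ) : ℝ) ^ (((k + 2 : ℕ) : ℝ) / 2) ≤ 9 * 6 ^ k * (k : ℝ) ^ ((k : ℝ) / 2) := by
  rcases Nat.eq_zero_or_pos k with rfl | hk
  · norm_num
  have hk' : (1 : ℝ) ≤ k := by exact_mod_cast hk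
  have h2 : (k : ℝ) ≤ 2 ^ k := by exact_mod_cast Nat.lt_two_pow_self.le
  calc ((k + 2 : ℕ) : ℝ) ^ (((k + 2 : ℕ) : ℝ) / 2) ≤ (3 * k) ^ (((k + 2 : ℕ) : ℝ) / 2) := by
        gcongr; push_cast; linarith
    _ = 3 ^ (((k + 2 : ℕ) : ℝ) / 2) * ((k : ℝ) ^ ((k : ℝ) / 2) * k) := by
        rw [Real.mul_rpow (by norm_num) (by linarith)]
        congr 1
        rw [← Real.rpow_add_one (by positivity)]
        congr 1; push_cast; ring
    _ ≤ 3 ^ (((k + 2 : ℕ) : ℝ)) * ((k : ℝ) ^ ((k : ℝ) / 2) * 2 ^ k) := by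
        gcongr
        · norm_num
        · linarith [show (0 : ℝ) ≤ ((k + 2 : ℕ) : ℝ) by positivity]
    _ = _ := by
        rw [Real.rpow_natCast, pow_add, show (6 : ℝ) = 3 * 2 by norm_num, mul_pow]; ring

theorem halfPow_add_one_le (k : ℕ) :
    ((k + 1 : ℕ) : ℝ) ^ (((k + 1 : ℕ) : ℝ) / 2) ≤ 9 * 6 ^ k * (k : ℝ) ^ ((k : ℝ) / 2) := by
  refine le_trans ?_ (halfPow_add_two_le k)
  calc ((k + 1 : ℕ) : ℝ) ^ (((k + 1 : ℕ) : ℝ) / 2)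
      ≤ ((k + 2 : ℕ) : ℝ) ^ (((k + 1 : ℕ) : ℝ) / 2) := by gcongr; simp
    _ ≤ _ := by
      apply Real.rpow_le_rpow_of_exponent_le
      · push_cast; linarith [(Nat.cast_nonneg k : (0 : ℝ) ≤ k)]
      · gcongr; simp

/-- Powers `x ^ (k + 1)`, `x ^ (k + 2)` are bounded by `C D ^ k k ^ (k / 2) exp (Q x ^ 2)`. -/
theorem exists_pow_le_exp_sq {Q : ℝ} (hQ : 0 < Q) :
    ∃ C D : ℝ, 0 < C ∧ 1 ≤ D ∧ ∀ (k : ℕ) (x : ℝ), 0 ≤ x →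
      x ^ (k + 1) ≤ C * D ^ k * (k : ℝ) ^ ((k : ℝ) / 2) * Real.exp (Q * x ^ 2) ∧
      x ^ (k + 2) ≤ C * D ^ k * (k : ℝ) ^ ((k : ℝ) / 2) * Real.exp (Q * x ^ 2) := by
  set M : ℝ := max 1 (1 / (2 * Q)) with hM
  have hM1 : 1 ≤ M := le_max_left _ _
  have hM0 : 0 < M := by linarith
  have key : ∀ n : ℕ, ((n : ℝ) / (2 * Q)) ^ ((n : ℝ) / 2) ≤ M ^ n * (n : ℝ) ^ ((n : ℝ) / 2) := by
    intro n
    calc ((n : ℝ) / (2 * Q)) ^ ((n : ℝ) / 2) ≤ (M * n) ^ ((n : ℝ) / 2) := by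
          gcongr
          rw [div_eq_mul_one_div, mul_comm]
          gcongr
          exact le_max_right _ _
      _ = M ^ ((n : ℝ) / 2) * (n : ℝ) ^ ((n : ℝ) / 2) := Real.mul_rpow hM0.le (by positivity)
      _ ≤ M ^ (n : ℝ) * (n : ℝ) ^ ((n : ℝ) / 2) := by
          gcongr
          linarith [(Nat.cast_nonneg n : (0 : ℝ) ≤ n)]
      _ = _ := by rw [Real.rpow_natCast]
  refine ⟨9 * M ^ 2, 6 * M, by positivity, by linarith, fun k x hx => ⟨?_, ?_⟩⟩
  · calc x ^ (k + 1) ≤ _ := pow_le_rpow_mul_exp_sq hQ (k + 1) hx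
      _ ≤ (M ^ (k + 1) * (9 * 6 ^ k * (k : ℝ) ^ ((k : ℝ) / 2))) * Real.exp (Q * x ^ 2) := by
          gcongr
          exact (key _).trans (by gcongr; exact halfPow_add_one_le k)
      _ ≤ (M ^ (k + 2) * (9 * 6 ^ k * (k : ℝ) ^ ((k : ℝ) / 2))) * Real.exp (Q * x ^ 2) := by
          gcongr
          norm_num
      _ = _ := by rw [mul_pow]; ring
  · calc x ^ (k + 2) ≤ _ := pow_le_rpow_mul_exp_sq hQ (k + 2) hx
      _ ≤ (M ^ (k + 2) * (9 * 6 ^ k * (k : ℝ) ^ ((k : ℝ) / 2))) * Real.exp (Q * x ^ 2) := by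
          gcongr
          exact (key _).trans (by gcongr; exact halfPow_add_two_le k)
      _ = _ := by rw [mul_pow]; ring

open Complex in
-- The remainder of order N + 1 has derivative I times the remainder of order N, so induction
-- integrates the bound; conjugation handles v < 0. As the exponent is imaginary, no factor exp |v|
-- appears, which matters because the bound is used for all real arguments.
theorem norm_exp_mul_I_sub_sum_le (N : ℕ) (v : ℝ) :
    ‖cexp (I * v) - ∑ n ∈ Finset.range N, (I * v) ^ n / (n.factorial : ℂ)‖ ≤
      |v| ^ N / N.factorial := by
  have main : ∀ N : ℕ, ∀ v : ℝ, 0 ≤ v →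
      ‖cexp (I * v) - ∑ n ∈ Finset.range N, (I * v) ^ n / (n.factorial : ℂ)‖ ≤
        v ^ N / N.factorial := by
    intro N
    induction N with
    | zero =>
      intro v _
      simp only [Finset.range_zero, Finset.sum_empty, sub_zero, pow_zero, Nat.factorial_zero]
      rw [mul_comm, norm_exp_ofReal_mul_I]; simp
    | succ N ih =>
      intro v hv
      have hd : ∀ x : ℝ, HasDerivAt (fun x : ℝ => cexp (I * x) -
          ∑ n ∈ Finset.range (N + 1), (I * x) ^ n / (n.factorial : ℂ))
          (I * (cexp (I * x) - ∑ n ∈ Finset.range N, (I * x) ^ n / (n.factorial : ℂ))) x := by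
        intro x
        have h0 : HasDerivAt (fun x : ℝ => I * (x : ℂ)) I x := by
          simpa using (Complex.ofRealCLM.hasDerivAt (x := x)).const_mul I
        have h1 := h0.cexp
        have h2 : HasDerivAt (fun x : ℝ => ∑ n ∈ Finset.range (N + 1),
            (I * (x : ℂ)) ^ n / (n.factorial : ℂ))
            (∑ n ∈ Finset.range (N + 1), (n * (I * (x : ℂ)) ^ (n - 1) * I) / (n.factorial : ℂ)) x :=
          HasDerivAt.fun_sum fun n _ => (h0.fun_pow n).div_const _
        refine (h1.sub h2).congr_deriv ?_
        rw [Finset.sum_range_succ', mul_sub, mul_comm I (cexp _)]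
        simp only [Nat.cast_zero, zero_mul, zero_div, add_zero, Finset.mul_sum]
        congr 1
        refine Finset.sum_congr rfl fun n _ => ?_
        rw [Nat.factorial_succ]
        have : ((n : ℂ) + 1) ≠ 0 := by exact_mod_cast Nat.succ_ne_zero n
        have h3 : (n.factorial : ℂ) ≠ 0 := by exact_mod_cast n.factorial_ne_zero
        push_cast
        field_simp
      have hB : ∀ x : ℝ, HasDerivAt (fun x : ℝ => x ^ (N + 1) / (N + 1).factorial)
          (x ^ N / N.factorial) x := by
        intro x
        refine ((hasDerivAt_pow (N + 1) x).div_const _).congr_deriv ?_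
        rw [Nat.factorial_succ]
        push_cast
        field_simp
      refine image_norm_le_of_norm_deriv_right_le_deriv_boundary (a := 0) (b := v)
        (fun x _ => (hd x).continuousAt.continuousWithinAt) (fun x _ => (hd x).hasDerivWithinAt)
        ?_ hB ?_ (right_mem_Icc.2 hv)
      · simp [Finset.sum_range_succ']
      · intro x hx
        rw [norm_mul, norm_I, one_mul]
        exact ih x hx.1
  rcases le_total 0 v with hv | hv
  · rw [abs_of_nonneg hv]; exact main N v hv
  · rw [abs_of_nonpos hv]
    convert main N (-v) (by linarith) using 1
    rw [← norm_conj]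
    simp [map_sub, map_sum, ← exp_conj]

/-! ### Expanding an exponential by weight -/

/-- The term of order `j` in the expansion of the exponential of `c 3 + ⋯ + c (k + 2)`, when `c n`
is given the weight `n - 2`. -/
noncomputable def wordSum (c : ℕ → ℂ) (k j : ℕ) : ℂ :=
  ∑ l ∈ Finset.range (k + 1), (1 / (l.factorial : ℂ)) *
    ∑ n ∈ (Fintype.piFinset (fun _ : Fin l => Finset.Icc 3 (k + 2))).filter
      (fun n => ∑ i, (n i - 2) = j), ∏ i, c (n i)

section Words

variable {c : ℕ → ℂ} {β : ℕ → ℝ} {k : ℕ} {θ : ℝ}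

theorem norm_prod_word_le (hc : ∀ n ∈ Finset.Icc 3 (k + 2), ‖c n‖ ≤ β n * θ ^ (n - 2))
    {l : ℕ} {n : Fin l → ℕ} (hn : n ∈ Fintype.piFinset (fun _ : Fin l => Finset.Icc 3 (k + 2))) :
    ‖∏ i, c (n i)‖ ≤ (∏ i, β (n i)) * θ ^ (∑ i, (n i - 2)) := by
  rw [norm_prod, ← Finset.prod_pow_eq_pow_sum, ← Finset.prod_mul_distrib]
  exact Finset.prod_le_prod (fun _ _ => norm_nonneg _)
    fun i _ => hc _ (Fintype.mem_piFinset.1 hn i)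

/-- Multiplying out (∑ β)^l lists all words of length l. Restricting to words satisfying p only
drops nonnegative terms, and p is used solely to bound the power of θ. -/
theorem norm_sum_words_le (hβ : ∀ n, 0 ≤ β n)
    (hc : ∀ n ∈ Finset.Icc 3 (k + 2), ‖c n‖ ≤ β n * θ ^ (n - 2)) (l : ℕ) {M : ℝ}
    (p : (Fin l → ℕ) → Prop) [DecidablePred p] (hp : ∀ n, p n → θ ^ (∑ i, (n i - 2)) ≤ M)
    (hM : 0 ≤ M) :
    ‖∑ n ∈ (Fintype.piFinset (fun _ : Fin l => Finset.Icc 3 (k + 2))).filter p, ∏ i, c (n i)‖ ≤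
      M * (∑ n ∈ Finset.Icc 3 (k + 2), β n) ^ l := by
  have h1 : (∑ n ∈ Finset.Icc 3 (k + 2), β n) ^ l =
      ∑ n ∈ Fintype.piFinset (fun _ : Fin l => Finset.Icc 3 (k + 2)), ∏ i, β (n i) := by
    rw [← Finset.prod_univ_sum, Finset.prod_const, Finset.card_univ, Fintype.card_fin]
  rw [h1, Finset.mul_sum]
  refine (norm_sum_le _ _).trans ?_
  calc _ ≤ ∑ n ∈ (Fintype.piFinset (fun _ : Fin l => Finset.Icc 3 (k + 2))).filter p,
        M * ∏ i, β (n i) := by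
        refine Finset.sum_le_sum fun n hn => ?_
        rw [Finset.mem_filter] at hn
        refine (norm_prod_word_le hc hn.1).trans ?_
        rw [mul_comm]
        gcongr
        · exact Finset.prod_nonneg fun i _ => hβ _
        · exact hp n hn.2
    _ ≤ _ := Finset.sum_le_sum_of_subset_of_nonneg (Finset.filter_subset _ _)
        fun n _ _ => mul_nonneg hM (Finset.prod_nonneg fun i _ => hβ _)

theorem norm_wordSum_le (hβ : ∀ n, 0 ≤ β n) (hθ : 0 ≤ θ)
    (hc : ∀ n ∈ Finset.Icc 3 (k + 2), ‖c n‖ ≤ β n * θ ^ (n - 2)) (j : ℕ) :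
    ‖wordSum c k j‖ ≤ θ ^ j * Real.exp (∑ n ∈ Finset.Icc 3 (k + 2), β n) := by
  set B := ∑ n ∈ Finset.Icc 3 (k + 2), β n
  have hB : 0 ≤ B := Finset.sum_nonneg fun n _ => hβ n
  calc ‖wordSum c k j‖ ≤ ∑ l ∈ Finset.range (k + 1), θ ^ j * (B ^ l / l.factorial) := by
        refine (norm_sum_le _ _).trans (Finset.sum_le_sum fun l _ => ?_)
        rw [norm_mul, norm_div, norm_one, Complex.norm_natCast]
        have := norm_sum_words_le hβ hc l (M := θ ^ j) (fun n => ∑ i, (n i - 2) = j)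
          (fun n hn => by rw [hn]) (by positivity)
        calc _ ≤ 1 / (l.factorial : ℝ) * (θ ^ j * B ^ l) := by gcongr
          _ = _ := by ring
    _ ≤ _ := by
        rw [← Finset.mul_sum]
        gcongr
        exact Real.sum_le_exp_of_nonneg hB _

theorem sum_filter_words_eq_sum_range (l : ℕ) :
    ∑ j ∈ Finset.range (k + 1),
      ∑ n ∈ (Fintype.piFinset (fun _ : Fin l => Finset.Icc 3 (k + 2))).filter
        (fun n => ∑ i, (n i - 2) = j), ∏ i, c (n i) =
    ∑ n ∈ (Fintype.piFinset (fun _ : Fin l => Finset.Icc 3 (k + 2))).filter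
        (fun n => ¬ k < ∑ i, (n i - 2)), ∏ i, c (n i) := by
  rw [← Finset.sum_fiberwise_of_maps_to (g := fun n : Fin l → ℕ => ∑ i, (n i - 2))
    (t := Finset.range (k + 1))]
  · refine Finset.sum_congr rfl fun j hj => Finset.sum_congr ?_ fun _ _ => rfl
    ext n
    simp only [Finset.mem_filter, Finset.mem_range] at hj ⊢
    grind
  · intro n hn
    simp only [Finset.mem_filter, Finset.mem_range] at hn ⊢
    omega

/-- In the exponential series, the l-th power of the sum is a sum over words of length l. Words of
weight at most k are exactly those collected by `wordSum`. Each other word carries at least θ^(k+1),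
because θ ≤ 1, and summing the majorants over l rebuilds an exponential. -/
theorem norm_exp_sum_sub_sum_wordSum_le (hβ : ∀ n, 0 ≤ β n) (hθ : 0 ≤ θ) (hθ1 : θ ≤ 1)
    (hc : ∀ n ∈ Finset.Icc 3 (k + 2), ‖c n‖ ≤ β n * θ ^ (n - 2)) :
    ‖Complex.exp (∑ n ∈ Finset.Icc 3 (k + 2), c n) -
        ∑ j ∈ Finset.range (k + 1), wordSum c k j‖ ≤
      θ ^ (k + 1) * Real.exp (∑ n ∈ Finset.Icc 3 (k + 2), β n) := by
  set B := ∑ n ∈ Finset.Icc 3 (k + 2), β n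
  have hB : 0 ≤ B := Finset.sum_nonneg fun n _ => hβ n
  set z := ∑ n ∈ Finset.Icc 3 (k + 2), c n with hz
  let hi : ℕ → ℂ := fun l => ∑ n ∈ (Fintype.piFinset
    (fun _ : Fin l => Finset.Icc 3 (k + 2))).filter (fun n => k < ∑ i, (n i - 2)), ∏ i, c (n i)
  let lo : ℕ → ℂ := fun l => ∑ n ∈ (Fintype.piFinset
    (fun _ : Fin l => Finset.Icc 3 (k + 2))).filter (fun n => ¬ k < ∑ i, (n i - 2)), ∏ i, c (n i)
  have hpow : ∀ l, z ^ l = hi l + lo l := by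
    intro l
    rw [Finset.sum_filter_add_sum_filter_not, hz, ← Finset.prod_univ_sum, Finset.prod_const,
      Finset.card_univ, Fintype.card_fin]
  -- Every letter is at least 3 and so weighs at least 1. Words longer than k therefore weigh more
  -- than k, and cutting l at k in `wordSum` loses nothing.
  have hlo : ∀ l, l ∉ Finset.range (k + 1) → lo l = 0 := by
    intro l hl
    refine Finset.sum_eq_zero fun n hn => ?_
    exfalso
    rw [Finset.mem_filter] at hn
    have : ∑ i : Fin l, 1 ≤ ∑ i, (n i - 2) := Finset.sum_le_sum fun i _ => by
      have := Finset.mem_Icc.1 (Fintype.mem_piFinset.1 hn.1 i)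
      omega
    simp at this hl hn
    omega
  have hsum : ∑ j ∈ Finset.range (k + 1), wordSum c k j =
      ∑ l ∈ Finset.range (k + 1), (1 / (l.factorial : ℂ)) * lo l := by
    simp only [wordSum]
    rw [Finset.sum_comm]
    refine Finset.sum_congr rfl fun l _ => ?_
    rw [← Finset.mul_sum, sum_filter_words_eq_sum_range]
  have h1 : HasSum (fun l : ℕ => (1 / (l.factorial : ℂ)) * lo l)
      (∑ j ∈ Finset.range (k + 1), wordSum c k j) := by
    rw [hsum]
    exact hasSum_sum_of_ne_finset_zero fun l hl => by rw [hlo l hl, mul_zero]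
  have h2 : HasSum (fun l : ℕ => z ^ l / (l.factorial : ℂ)) (Complex.exp z) := by
    rw [Complex.exp_eq_exp_ℂ]
    exact NormedSpace.expSeries_div_hasSum_exp z
  have h3 := h2.sub h1
  have h4 : HasSum (fun l : ℕ => θ ^ (k + 1) * (B ^ l / (l.factorial : ℝ)))
      (θ ^ (k + 1) * Real.exp B) := by
    rw [Real.exp_eq_exp_ℝ]
    exact (NormedSpace.expSeries_div_hasSum_exp B).mul_left _
  rw [← h3.tsum_eq]
  refine tsum_of_norm_bounded h4 fun l => ?_
  have h5 : z ^ l / (l.factorial : ℂ) - (1 / (l.factorial : ℂ)) * lo l =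
      (1 / (l.factorial : ℂ)) * hi l := by rw [hpow]; ring
  rw [h5, norm_mul, norm_div, norm_one, Complex.norm_natCast]
  have := norm_sum_words_le hβ hc l (M := θ ^ (k + 1)) (fun n => k < ∑ i, (n i - 2))
    (fun n hn => pow_le_pow_of_le_one hθ hθ1 hn) (by positivity)
  calc _ ≤ 1 / (l.factorial : ℝ) * (θ ^ (k + 1) * B ^ l) := by gcongr
    _ = _ := by ring

end Words

/-! ### The Edgeworth term as a Gaussian expectation -/

open Complex in
-- Both sides are the m-th derivative at 0 of exp(-t²/2): once as a characteristic function, once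
-- through the Hermite formula for derivatives of the Gaussian.
theorem integral_I_mul_pow_gaussianReal (m : ℕ) :
    ∫ x : ℝ, (I * x) ^ m ∂(gaussianReal 0 1) =
      (-1) ^ m * (((Polynomial.hermite m).eval 0 : ℤ) : ℂ) := by
  have h1 := iteratedDeriv_charFun_zero (μ := gaussianReal 0 1) (n := m)
    (memLp_id_gaussianReal' _ (by simp))
  have h2 : charFun (gaussianReal 0 1) = fun t : ℝ => ((Real.exp (-(t ^ 2 / 2)) : ℝ) : ℂ) := by
    ext t
    rw [charFun_gaussianReal]
    push_cast
    congr 1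
    simp
  have h3 : iteratedDeriv m (charFun (gaussianReal 0 1)) 0 =
      ((iteratedDeriv m (fun t : ℝ => Real.exp (-(t ^ 2 / 2))) 0 : ℝ) : ℂ) := by
    have h6 : (fun t : ℝ => ((Real.exp (-(t ^ 2 / 2)) : ℝ) : ℂ)) =
      Complex.ofRealCLM ∘ (fun t : ℝ => Real.exp (-(t ^ 2 / 2))) := rfl
    have h7 : ContDiffAt ℝ m (fun t : ℝ => Real.exp (-(t ^ 2 / 2))) 0 := by fun_prop
    rw [h2, h6, iteratedDeriv_eq_iteratedFDeriv,
      ContinuousLinearMap.iteratedFDeriv_comp_left _ h7 le_rfl]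
    simp [iteratedDeriv_eq_iteratedFDeriv]
  have h4 := Polynomial.deriv_gaussian_eq_hermite_mul_gaussian m 0
  rw [← iteratedDeriv_eq_iterate] at h4
  rw [h4] at h3
  simp_rw [mul_pow]
  rw [integral_const_mul]
  have h5 : ∫ x : ℝ, (x : ℂ) ^ m ∂(gaussianReal 0 1) = ((∫ x : ℝ, x ^ m ∂(gaussianReal 0 1) : ℝ) : ℂ) := by
    rw [← integral_complex_ofReal]; simp
  rw [h5, ← h1, h3]
  simp [Polynomial.aeval_def, Polynomial.eval₂_at_zero, Polynomial.coeff_zero_eq_eval_zero]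

/-- The `n`-th term of the exponent in the expansion of a normalised characteristic function. -/
noncomputable def cumulantTerm (κ : ℕ → ℝ) (ρ x : ℝ) (n : ℕ) : ℂ :=
  ((κ n / n.factorial / (Real.sqrt (κ 2) ^ n * ρ ^ (n - 2)) : ℝ) : ℂ) * (Complex.I * x) ^ n

/-- The letters of a word of weight j and length l add up to j + 2 l. This explains the Hermite
index and the exponent of κ₂ in the Edgeworth term. -/
theorem prod_cumulantTerm (κ : ℕ → ℝ) (ρ x : ℝ) {k j l : ℕ} {n : Fin l → ℕ}
    (hn : n ∈ Fintype.piFinset (fun _ : Fin l => Finset.Icc 3 (k + 2)))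
    (hj : ∑ i, (n i - 2) = j) :
    ∏ i, cumulantTerm κ ρ x (n i) =
      (((∏ i, κ (n i) / ((n i).factorial : ℝ)) / (Real.sqrt (κ 2) ^ (j + 2 * l) * ρ ^ j) : ℝ) : ℂ) *
        (Complex.I * x) ^ (j + 2 * l) := by
  have h1 : ∑ i, n i = j + 2 * l := by
    have : ∑ i, n i = ∑ i, ((n i - 2) + 2) := Finset.sum_congr rfl fun i _ => by
      have := Finset.mem_Icc.1 (Fintype.mem_piFinset.1 hn i)
      omega
    rw [this, Finset.sum_add_distrib, hj]
    simp [mul_comm]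
  simp only [cumulantTerm]
  rw [Finset.prod_mul_distrib, Finset.prod_pow_eq_pow_sum, h1, ← Complex.ofReal_prod,
    Finset.prod_div_distrib, Finset.prod_mul_distrib, Finset.prod_pow_eq_pow_sum,
    Finset.prod_pow_eq_pow_sum, h1, hj]

theorem wordSum_cumulantTerm (κ : ℕ → ℝ) (ρ x : ℝ) (k j : ℕ) :
    wordSum (cumulantTerm κ ρ x) k j = ∑ l ∈ Finset.range (k + 1),
      ((edgeworthCoeff κ k j l / (Real.sqrt (κ 2) ^ (j + 2 * l) * ρ ^ j) : ℝ) : ℂ) *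
        (Complex.I * x) ^ (j + 2 * l) := by
  refine Finset.sum_congr rfl fun l _ => ?_
  rw [Finset.sum_congr rfl fun n hn => prod_cumulantTerm κ ρ x (Finset.mem_filter.1 hn).1
    (Finset.mem_filter.1 hn).2, ← Finset.sum_mul, ← Complex.ofReal_sum, ← Finset.sum_div,
    edgeworthCoeff, ← mul_assoc]
  congr 1
  push_cast
  ring

theorem integrable_gaussianReal_iff {E : Type*} [NormedAddCommGroup E] [NormedSpace ℝ E]
    {f : ℝ → E} :
    Integrable f (gaussianReal 0 1) ↔ Integrable (fun x : ℝ => Real.exp (-x ^ 2 / 2) • f x) := by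
  rw [gaussianReal_of_var_ne_zero _ one_ne_zero,
    integrable_withDensity_iff_integrable_smul' (measurable_gaussianPDF _ _)
      (Filter.Eventually.of_forall fun x => ENNReal.ofReal_lt_top)]
  have h : (fun x : ℝ => (gaussianPDF 0 1 x).toReal • f x) =
      (Real.sqrt (2 * Real.pi))⁻¹ • (fun x : ℝ => Real.exp (-x ^ 2 / 2) • f x) := by
    ext x
    rw [toReal_gaussianPDF, gaussianPDFReal, Pi.smul_apply, smul_smul]
    simp
  have h2 : (Real.sqrt (2 * Real.pi))⁻¹ ≠ 0 :=
    inv_ne_zero (Real.sqrt_pos.2 (by positivity)).ne'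
  rw [h, integrable_smul_iff h2]

theorem integrable_pow_gaussianReal (m : ℕ) :
    Integrable (fun x : ℝ => (Complex.I * (x : ℂ)) ^ m) (gaussianReal 0 1) := by
  have h := (memLp_id_gaussianReal' (μ := 0) (v := 1) (m : ENNReal) (by simp)).integrable_norm_pow'
  refine h.mono (by fun_prop) (Filter.Eventually.of_forall fun x => ?_)
  simp

theorem integrable_wordSum (κ : ℕ → ℝ) (ρ : ℝ) (k j : ℕ) :
    Integrable (fun x => wordSum (cumulantTerm κ ρ x) k j) (gaussianReal 0 1) := by
  simp_rw [wordSum_cumulantTerm]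
  exact integrable_finsetSum _ fun l _ => (integrable_pow_gaussianReal _).const_mul _

theorem integral_wordSum (κ : ℕ → ℝ) (ρ : ℝ) (k j : ℕ) :
    ∫ x, wordSum (cumulantTerm κ ρ x) k j ∂(gaussianReal 0 1) = ((∑ l ∈ Finset.range (k + 1),
      edgeworthCoeff κ k j l / (Real.sqrt (κ 2) ^ (j + 2 * l) * ρ ^ j) *
        ((-1) ^ j * (((Polynomial.hermite (j + 2 * l)).eval 0 : ℤ) : ℝ)) : ℝ) : ℂ) := by
  simp_rw [wordSum_cumulantTerm]
  rw [integral_finsetSum _ fun l _ => (integrable_pow_gaussianReal _).const_mul _]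
  push_cast
  refine Finset.sum_congr rfl fun l _ => ?_
  rw [integral_const_mul, integral_I_mul_pow_gaussianReal]
  have : ((-1 : ℂ)) ^ (j + 2 * l) = (-1) ^ j := by rw [pow_add, pow_mul]; simp
  rw [this]

theorem edgeworthCoeff_zero_zero (κ : ℕ → ℝ) (k : ℕ) : edgeworthCoeff κ k 0 0 = 1 := by
  simp [edgeworthCoeff]

/-- A word of length l weighs at least l, and the empty word weighs 0. Hence the range 0 ≤ l ≤ k of
`wordSum` may be exchanged for 1 ≤ l ≤ j. -/
theorem edgeworthCoeff_eq_zero (κ : ℕ → ℝ) {k j l : ℕ} (h : j < l ∨ (l = 0 ∧ 0 < j)) :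
    edgeworthCoeff κ k j l = 0 := by
  rw [edgeworthCoeff, Finset.sum_eq_zero, mul_zero]
  intro n hn
  exfalso
  rw [Finset.mem_filter] at hn
  rcases h with h | ⟨rfl, h⟩
  · have : ∑ i : Fin l, 1 ≤ ∑ i, (n i - 2) := Finset.sum_le_sum fun i _ => by
      have := Finset.mem_Icc.1 (Fintype.mem_piFinset.1 hn.1 i)
      omega
    simp at this hn
    omega
  · simp at hn; omega

theorem sqrt_mul_edgeworthTerm {κ : ℕ → ℝ} (hκ : 0 < κ 2) (ρ : ℝ) (k : ℕ) :
    ((Real.sqrt (κ 2) * Real.sqrt (2 * Real.pi) * edgeworthTerm κ ρ k : ℝ) : ℂ) =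
      ∑ j ∈ Finset.range (k + 1), ∫ x, wordSum (cumulantTerm κ ρ x) k j ∂(gaussianReal 0 1) := by
  have h1 : Real.sqrt (κ 2) * Real.sqrt (2 * Real.pi) * edgeworthTerm κ ρ k =
      1 + ∑ j ∈ Finset.Icc 1 k, (-1) ^ j / ρ ^ j *
      ∑ l ∈ Finset.Icc 1 j, edgeworthCoeff κ k j l / κ 2 ^ ((j : ℝ) / 2 + l) *
        (((Polynomial.hermite (j + 2 * l)).eval 0 : ℤ) : ℝ) := by
    have h2 : Real.sqrt (κ 2) ≠ 0 := (Real.sqrt_pos.2 hκ).ne'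
    have h3 : Real.sqrt (2 * Real.pi) ≠ 0 := (Real.sqrt_pos.2 (by positivity)).ne'
    have h4 : gaussianPDFReal 0 1 0 = 1 / Real.sqrt (2 * Real.pi) := by
      simp [gaussianPDFReal]
    rw [edgeworthTerm, h4]
    field_simp
  rw [h1]
  simp_rw [integral_wordSum]
  rw [← Complex.ofReal_sum]
  congr 1
  rw [Finset.range_eq_Ico, Finset.sum_eq_sum_Ico_succ_bot (by omega)]
  congr 1
  · rw [Finset.sum_eq_single 0]
    · simp [edgeworthCoeff_zero_zero]
    · intro l _ hl
      rw [edgeworthCoeff_eq_zero κ (Or.inl (by omega)), zero_div, zero_mul]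
    · simp
  · refine Finset.sum_congr (by ext; simp) fun j hj => ?_
    rw [Finset.mem_Ico] at hj
    rw [← Finset.range_eq_Ico, ← Finset.sum_subset (s₁ := Finset.Icc 1 j) (s₂ := Finset.range (k + 1)), Finset.mul_sum]
    · refine Finset.sum_congr rfl fun l _ => ?_
      have h5 : κ 2 ^ ((j : ℝ) / 2 + l) = Real.sqrt (κ 2) ^ (j + 2 * l) := by
        rw [Real.sqrt_eq_rpow, ← Real.rpow_natCast, ← Real.rpow_mul hκ.le]
        congr 1; push_cast; ring
      rw [h5]
      ring
    · intro l hl; simp at hl ⊢; omega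
    · intro l _ hl
      rw [Finset.mem_Icc] at hl
      rw [edgeworthCoeff_eq_zero κ (by omega), zero_div, zero_mul]

/-! ### Edgeworth expansion at the mean -/

theorem norm_exp_sub_exp_le (a b : ℂ) :
    ‖Complex.exp a - Complex.exp b‖ ≤ ‖a - b‖ * Real.exp (‖b‖ + ‖a - b‖) := by
  have h1 : Complex.exp a - Complex.exp b = Complex.exp b * (Complex.exp (a - b) - 1) := by
    rw [mul_sub, ← Complex.exp_add]; simp
  have h2 := Complex.norm_exp_sub_sum_le_norm_mul_exp (a - b) 1
  simp at h2
  rw [h1, norm_mul, Real.exp_add]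
  calc _ ≤ Real.exp ‖b‖ * (‖a - b‖ * Real.exp ‖a - b‖) := by
        gcongr; exact Complex.norm_exp_le_exp_norm b
    _ = _ := by ring

theorem sum_eighth_pow_le (k : ℕ) :
    ∑ n ∈ Finset.Icc 3 (k + 2), (1 / 8 : ℝ) ^ (n - 2) ≤ 1 / 7 := by
  have h : ∑ n ∈ Finset.Icc 3 (k + 2), (1 / 8 : ℝ) ^ (n - 2) = 1 / 7 * (1 - (1 / 8) ^ k) := by
    induction k with
    | zero => simp
    | succ k ih =>
      rw [show k + 1 + 2 = (k + 2) + 1 by ring, Finset.sum_Icc_succ_top (by omega), ih,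
        show k + 2 + 1 - 2 = k + 1 by omega]
      ring
  rw [h]
  nlinarith [show (0 : ℝ) ≤ (1 / 8) ^ k by positivity]

theorem sum_mul_eighth_pow_le (k : ℕ) (x : ℝ) :
    ∑ n ∈ Finset.Icc 3 (k + 2), x ^ 2 * (1 / 8 : ℝ) ^ (n - 2) ≤ x ^ 2 / 7 := by
  rw [← Finset.mul_sum]
  calc _ ≤ x ^ 2 * (1 / 7) := by gcongr; exact sum_eighth_pow_le k
    _ = _ := by ring

section Edgeworth

variable {κ : ℕ → ℝ} {A ρ δ : ℝ}

/-- With θ = 8 A δ |x|, the factor (A δ |x|)^(n-2) splits as (1/8)^(n-2) θ^(n-2). The eighths make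
the word majorant summable to at most x²/7, safely below the Gaussian exponent x²/2. -/
theorem norm_cumulantTerm_le
    (hκ : ∀ n, 3 ≤ n → |κ n / n.factorial / (Real.sqrt (κ 2) ^ n * ρ ^ (n - 2))| ≤ (A * δ) ^ (n - 2))
    (x : ℝ) (k : ℕ) : ∀ n ∈ Finset.Icc 3 (k + 2),
      ‖cumulantTerm κ ρ x n‖ ≤ (x ^ 2 * (1 / 8) ^ (n - 2)) * (8 * A * δ * |x|) ^ (n - 2) := by
  intro n hn
  have hn3 := (Finset.mem_Icc.1 hn).1
  rw [cumulantTerm, norm_mul, norm_pow, norm_mul, Complex.norm_I, one_mul, Complex.norm_real,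
    Complex.norm_real, Real.norm_eq_abs, Real.norm_eq_abs]
  calc _ ≤ (A * δ) ^ (n - 2) * |x| ^ n := by gcongr; exact hκ n hn3
    _ = (A * δ) ^ (n - 2) * |x| ^ ((n - 2) + 2) := by congr 2; omega
    _ = _ := by
      rw [pow_add, sq_abs, mul_assoc (x ^ 2), ← mul_pow, show 1 / 8 * (8 * A * δ * |x|) = (A * δ) * |x|
        by ring, mul_pow (A * δ)]
      ring

theorem norm_wordSum_cumulantTerm_le (hA : 0 ≤ A) (hδ : 0 ≤ δ)
    (hκ : ∀ n, 3 ≤ n → |κ n / n.factorial / (Real.sqrt (κ 2) ^ n * ρ ^ (n - 2))| ≤ (A * δ) ^ (n - 2))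
    (x : ℝ) (k j : ℕ) :
    ‖wordSum (cumulantTerm κ ρ x) k j‖ ≤ (8 * A * δ * |x|) ^ j * Real.exp (x ^ 2 / 7) := by
  refine (norm_wordSum_le (β := fun n => x ^ 2 * (1 / 8) ^ (n - 2)) (fun n => by positivity)
    (by positivity) (norm_cumulantTerm_le hκ x k) j).trans ?_
  gcongr
  exact sum_mul_eighth_pow_le k x

/-- For θ = 8 A δ |x| at most 1, the function is compared with the exponential of the truncated
exponent, and that with the truncated word sum. For θ > 1 no cancellation is sought: the polynomial
part is still small against the Gaussian, and the function itself is left for a separate tail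
estimate. -/
theorem edgeworth_pointwise (hA : 0 ≤ A) (hδ : 0 ≤ δ)
    (hκ : ∀ n, 3 ≤ n → |κ n / n.factorial / (Real.sqrt (κ 2) ^ n * ρ ^ (n - 2))| ≤ (A * δ) ^ (n - 2))
    {g : ℂ} {x : ℝ} (k : ℕ)
    (hg : ∀ N : ℕ, ‖g - ∑ n ∈ Finset.Icc 3 (N + 2), cumulantTerm κ ρ x n‖ ≤
      x ^ 2 * (A * δ * |x|) ^ (N + 1)) :
    ‖Complex.exp (-(x : ℂ) ^ 2 / 2 + g) - Complex.exp (-(x : ℂ) ^ 2 / 2) *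
        ∑ j ∈ Finset.range (k + 1), wordSum (cumulantTerm κ ρ x) k j‖ ≤
      17 * 2 ^ k * (8 * A * δ * |x|) ^ (k + 1) * Real.exp (-(5 / 32) * x ^ 2) +
        {x : ℝ | 1 < 8 * A * δ * |x|}.indicator
          (fun _ => ‖Complex.exp (-(x : ℂ) ^ 2 / 2 + g)‖) x := by
  set θ := 8 * A * δ * |x| with hθ
  have hθ0 : 0 ≤ θ := by positivity
  have hE : ‖Complex.exp (-(x : ℂ) ^ 2 / 2)‖ = Real.exp (-x ^ 2 / 2) := by
    rw [Complex.norm_exp]; congr 1; norm_cast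
  -- For θ > 1 each of the k + 1 ≤ 2^k word sums is bounded through θ^j ≤ θ^(k+1).
  by_cases h1 : 1 < θ
  · rw [indicator_of_mem (show x ∈ {x : ℝ | 1 < 8 * A * δ * |x|} from h1)]
    refine (norm_sub_le _ _).trans ?_
    rw [add_comm]
    gcongr
    rw [norm_mul, hE]
    have h2 : ‖∑ j ∈ Finset.range (k + 1), wordSum (cumulantTerm κ ρ x) k j‖ ≤
        2 ^ k * (θ ^ (k + 1) * Real.exp (x ^ 2 / 7)) := by
      calc _ ≤ ∑ j ∈ Finset.range (k + 1), θ ^ (k + 1) * Real.exp (x ^ 2 / 7) := by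
            refine norm_sum_le_of_le _ fun j hj => ?_
            refine (norm_wordSum_cumulantTerm_le hA hδ hκ x k j).trans ?_
            gcongr
            · exact h1.le
            · exact (Finset.mem_range.1 hj).le
        _ = ((k + 1 : ℕ) : ℝ) * (θ ^ (k + 1) * Real.exp (x ^ 2 / 7)) := by
            rw [Finset.sum_const, Finset.card_range, nsmul_eq_mul]
        _ ≤ _ := by
            gcongr
            exact_mod_cast Nat.lt_two_pow_self
    calc _ ≤ Real.exp (-x ^ 2 / 2) * (2 ^ k * (θ ^ (k + 1) * Real.exp (x ^ 2 / 7))) := by gcongr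
      _ = 1 * 2 ^ k * θ ^ (k + 1) * Real.exp (-x ^ 2 / 2 + x ^ 2 / 7) := by rw [Real.exp_add]; ring
      _ ≤ _ := by
        gcongr
        · norm_num
        · nlinarith [sq_nonneg x]
  · rw [indicator_of_notMem (show x ∉ {x : ℝ | 1 < 8 * A * δ * |x|} from h1), add_zero]
    rw [not_lt] at h1
    set G := ∑ n ∈ Finset.Icc 3 (k + 2), cumulantTerm κ ρ x n with hG
    have hAδ : A * δ * |x| = θ / 8 := by rw [hθ]; ring
    have hsum : ∑ n ∈ Finset.Icc 3 (k + 2), x ^ 2 * (1 / 8 : ℝ) ^ (n - 2) ≤ x ^ 2 / 7 :=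
      sum_mul_eighth_pow_le k x
    have h3 : ‖Complex.exp G - ∑ j ∈ Finset.range (k + 1), wordSum (cumulantTerm κ ρ x) k j‖ ≤
        θ ^ (k + 1) * Real.exp (x ^ 2 / 7) := by
      refine (norm_exp_sum_sub_sum_wordSum_le (β := fun n => x ^ 2 * (1 / 8) ^ (n - 2))
        (fun n => by positivity) hθ0 h1 (norm_cumulantTerm_le hκ x k)).trans ?_
      gcongr
    have h4 : ‖G‖ ≤ x ^ 2 / 7 := by
      refine (norm_sum_le_of_le _ (norm_cumulantTerm_le hκ x k)).trans (le_trans ?_ hsum)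
      refine Finset.sum_le_sum fun n _ => ?_
      exact mul_le_of_le_one_right (by positivity) (pow_le_one₀ hθ0 h1)
    have h5 : ‖g - G‖ ≤ x ^ 2 * (θ / 8) ^ (k + 1) := by rw [← hAδ]; exact hg k
    have h6 : ‖g - G‖ ≤ x ^ 2 * θ ^ (k + 1) := h5.trans (by gcongr; linarith)
    have h7 : ‖g - G‖ ≤ x ^ 2 / 8 := by
      refine h5.trans ?_
      have : (θ / 8) ^ (k + 1) ≤ 1 / 8 := by
        rw [pow_succ]
        have : (θ / 8) ^ k ≤ 1 := pow_le_one₀ (by positivity) (by linarith)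
        nlinarith [show 0 ≤ (θ / 8) ^ k by positivity]
      calc _ ≤ x ^ 2 * (1 / 8) := by gcongr
        _ = _ := by ring
    have h8 : ‖Complex.exp g - Complex.exp G‖ ≤
        16 * θ ^ (k + 1) * Real.exp (x ^ 2 * (1 / 7 + 1 / 8 + 1 / 16)) := by
      -- The exponents spent are 1/7 on the truncated exponent, 1/8 on its error and 1/16 on the
      -- factor x². Taken from 1/2 they leave more than 5/32. The constant 17 is this 16 plus 1 from
      -- the word sum error.
      have h9 : x ^ 2 ≤ 16 * Real.exp (x ^ 2 / 16) := by
        have := Real.add_one_le_exp (x ^ 2 / 16); linarith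
      calc _ ≤ _ := norm_exp_sub_exp_le g G
        _ ≤ (x ^ 2 * θ ^ (k + 1)) * Real.exp (x ^ 2 / 7 + x ^ 2 / 8) := by gcongr
        _ ≤ ((16 * Real.exp (x ^ 2 / 16)) * θ ^ (k + 1)) * Real.exp (x ^ 2 / 7 + x ^ 2 / 8) := by
          gcongr
        _ = 16 * θ ^ (k + 1) * (Real.exp (x ^ 2 / 16) * Real.exp (x ^ 2 / 7 + x ^ 2 / 8)) := by ring
        _ = _ := by rw [← Real.exp_add]; congr 2; ring
    have h10 : Complex.exp (-(x : ℂ) ^ 2 / 2 + g) - Complex.exp (-(x : ℂ) ^ 2 / 2) *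
        ∑ j ∈ Finset.range (k + 1), wordSum (cumulantTerm κ ρ x) k j =
        Complex.exp (-(x : ℂ) ^ 2 / 2) * ((Complex.exp g - Complex.exp G) +
          (Complex.exp G - ∑ j ∈ Finset.range (k + 1), wordSum (cumulantTerm κ ρ x) k j)) := by
      rw [Complex.exp_add]; ring
    have h11 : Real.exp (x ^ 2 / 7) ≤ Real.exp (x ^ 2 * (1 / 7 + 1 / 8 + 1 / 16)) := by
      gcongr; nlinarith [sq_nonneg x]
    rw [h10, norm_mul, hE]
    calc _ ≤ Real.exp (-x ^ 2 / 2) * (16 * θ ^ (k + 1) * Real.exp (x ^ 2 * (1 / 7 + 1 / 8 + 1 / 16)) +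
          θ ^ (k + 1) * Real.exp (x ^ 2 * (1 / 7 + 1 / 8 + 1 / 16))) := by
          gcongr
          exact (norm_add_le _ _).trans (add_le_add h8 (h3.trans (by gcongr)))
      _ = 17 * 1 * θ ^ (k + 1) * (Real.exp (-x ^ 2 / 2) *
          Real.exp (x ^ 2 * (1 / 7 + 1 / 8 + 1 / 16))) := by ring
      _ ≤ _ := by
        rw [← Real.exp_add]
        gcongr
        · exact one_le_pow₀ (by norm_num)
        · nlinarith [sq_nonneg x]

end Edgeworth

/-- Edgeworth expansion at the mean for a function `exp (-x ^ 2 / 2 + g x)`. -/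
theorem exists_edgeworth_bound {A : ℝ} (hA : 0 < A) :
    ∃ C D C' : ℝ, 0 < C ∧ 1 ≤ D ∧ 0 < C' ∧ ∀ (κ : ℕ → ℝ) (ρ δ : ℝ), 0 < κ 2 → 0 < δ →
      (∀ n, 3 ≤ n →
        |κ n / n.factorial / (Real.sqrt (κ 2) ^ n * ρ ^ (n - 2))| ≤ (A * δ) ^ (n - 2)) →
      ∀ k : ℕ,
        (C' * (δ * Real.sqrt k) ≤ 1 →
          |Real.sqrt (κ 2) * Real.sqrt (2 * Real.pi) * edgeworthTerm κ ρ k - 1| ≤ 1 / 2) ∧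
        ∀ (g : ℝ → ℂ),
          (∀ (N : ℕ) (x : ℝ), ‖g x - ∑ n ∈ Finset.Icc 3 (N + 2), cumulantTerm κ ρ x n‖ ≤
            x ^ 2 * (A * δ * |x|) ^ (N + 1)) →
          Integrable (fun x : ℝ => Complex.exp (-(x : ℂ) ^ 2 / 2 + g x)) →
          ‖((1 / Real.sqrt (2 * Real.pi) : ℝ) : ℂ) * (∫ x : ℝ, Complex.exp (-(x : ℂ) ^ 2 / 2 + g x)) -
            ((Real.sqrt (κ 2) * Real.sqrt (2 * Real.pi) * edgeworthTerm κ ρ k : ℝ) : ℂ)‖ ≤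
            C * D ^ k * (k : ℝ) ^ ((k : ℝ) / 2) * δ ^ (k + 1) +
              ∫ x in {x : ℝ | 1 < 8 * A * δ * |x|}, ‖Complex.exp (-(x : ℂ) ^ 2 / 2 + g x)‖ := by
  -- Of the decay exp(-(5/32) x²), a share of 1/32 absorbs the power of |x| and 1/8 is kept for
  -- integrability.
  obtain ⟨C₀, D₀, hC₀, hD₀, hpow⟩ := exists_pow_le_exp_sq (Q := 1 / 32) (by norm_num)
  -- The rate 3/8 exceeds 1/8 + 1/7, spent on the power of |x| and on the word sums, yet stays below
  -- 1/2.
  have hgi : Integrable (fun x : ℝ => Real.exp (3 / 8 * x ^ 2)) (gaussianReal 0 1) := by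
    rw [integrable_gaussianReal_iff]
    refine (integrable_exp_neg_mul_sq (b := 1 / 8) (by norm_num)).congr
      (Filter.Eventually.of_forall fun x => ?_)
    simp only [smul_eq_mul]
    rw [← Real.exp_add]
    congr 1; ring
  set G := ∫ x, Real.exp (3 / 8 * x ^ 2) ∂(gaussianReal 0 1) with hG
  have hG0 : 0 ≤ G := integral_nonneg fun x => (Real.exp_pos _).le
  set G' := ∫ x : ℝ, Real.exp (-(1 / 8) * x ^ 2) with hG'
  have hi' : Integrable (fun x : ℝ => Real.exp (-(1 / 8) * x ^ 2)) :=
    integrable_exp_neg_mul_sq (by norm_num)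
  have hG0' : 0 < G' := integral_exp_pos hi'
  -- The third constant gives (2 G + 1) y ≤ 1 for y = 16 A δ √k. For y < 1 this says G y / (1 - y) ≤
  -- 1/2, the geometric bound on all terms of positive order.
  refine ⟨17 * (8 * A) * C₀ * G', 2 * (8 * A + 1) * D₀, 16 * A * (2 * G + 1), by positivity, by nlinarith,
    by positivity, fun κ ρ δ hκ2 hδ hκ k => ⟨fun hC => ?_, fun g hg hint => ?_⟩⟩
  · have h1 := sqrt_mul_edgeworthTerm hκ2 ρ k
    rw [Finset.sum_range_succ'] at h1
    have h0 : ∫ x, wordSum (cumulantTerm κ ρ x) k 0 ∂(gaussianReal 0 1) = 1 := by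
      rw [integral_wordSum, Finset.sum_eq_single 0]
      · simp [edgeworthCoeff_zero_zero]
      · intro l _ hl
        rw [edgeworthCoeff_eq_zero κ (Or.inl (by omega)), zero_div, zero_mul]
      · simp
    set y := 16 * A * (δ * Real.sqrt k) with hy
    have hy0 : 0 ≤ y := by positivity
    have hyG : (2 * G + 1) * y ≤ 1 := by rw [hy]; linarith
    have hterm : ∀ j ∈ Finset.range k,
        ‖∫ x, wordSum (cumulantTerm κ ρ x) k (j + 1) ∂(gaussianReal 0 1)‖ ≤ G * y ^ (j + 1) := by
      intro j hj
      rw [Finset.mem_range] at hj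
      rw [mul_comm, hG, ← integral_const_mul]
      refine norm_integral_le_of_norm_le (hgi.const_mul _) (Filter.Eventually.of_forall fun x => ?_)
      refine (norm_wordSum_cumulantTerm_le hA.le hδ.le hκ x k (j + 1)).trans ?_
      have h2 := pow_le_rpow_mul_exp_sq (Q := 1 / 8) (by norm_num) (j + 1) (abs_nonneg x)
      -- As j + 1 ≤ k, the base 4 (j + 1) is at most (2 √k)², so growth in j becomes a geometric
      -- progression.
      have h3 : (((j + 1 : ℕ) : ℝ) / (2 * (1 / 8))) ^ (((j + 1 : ℕ) : ℝ) / 2) ≤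
          (2 * Real.sqrt k) ^ (j + 1) := by
        calc (((j + 1 : ℕ) : ℝ) / (2 * (1 / 8))) ^ (((j + 1 : ℕ) : ℝ) / 2)
            ≤ ((2 * Real.sqrt k) ^ 2) ^ (((j + 1 : ℕ) : ℝ) / 2) := by
              gcongr
              rw [mul_pow, Real.sq_sqrt (by positivity)]
              have : ((j + 1 : ℕ) : ℝ) ≤ k := by exact_mod_cast hj
              rw [div_le_iff₀ (by norm_num)]
              linarith
          _ = _ := by
            rw [← Real.rpow_natCast _ 2, ← Real.rpow_mul (by positivity), ← Real.rpow_natCast]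
            congr 1; push_cast; ring
      calc _ = (8 * A * δ) ^ (j + 1) * |x| ^ (j + 1) * Real.exp (x ^ 2 / 7) := by rw [mul_pow]
        _ ≤ (8 * A * δ) ^ (j + 1) * ((2 * Real.sqrt k) ^ (j + 1) * Real.exp (1 / 8 * |x| ^ 2)) *
            Real.exp (x ^ 2 / 7) := by
          gcongr
          exact h2.trans (by gcongr)
        _ = y ^ (j + 1) * (Real.exp (1 / 8 * |x| ^ 2) * Real.exp (x ^ 2 / 7)) := by
          rw [hy, show 16 * A * (δ * Real.sqrt k) = (8 * A * δ) * (2 * Real.sqrt k) by ring,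
            mul_pow (8 * A * δ)]
          ring
        _ ≤ _ := by
          rw [← Real.exp_add, sq_abs]
          gcongr
          nlinarith [sq_nonneg x]
    have h4 : ((Real.sqrt (κ 2) * Real.sqrt (2 * Real.pi) * edgeworthTerm κ ρ k - 1 : ℝ) : ℂ) =
        ∑ j ∈ Finset.range k, ∫ x, wordSum (cumulantTerm κ ρ x) k (j + 1) ∂(gaussianReal 0 1) := by
      rw [Complex.ofReal_sub, h1, h0]; simp
    rw [← Real.norm_eq_abs, ← Complex.norm_real, h4]
    refine (norm_sum_le_of_le _ hterm).trans ?_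
    rcases eq_or_lt_of_le hG0 with hG00 | hG00
    · rw [← hG00]; simp
    have hy1 : y < 1 := by nlinarith
    have h5 : ∑ j ∈ Finset.range k, y ^ j ≤ 1 / (1 - y) := by
      rw [one_div, ← tsum_geometric_of_lt_one hy0 hy1]
      exact (summable_geometric_of_lt_one hy0 hy1).sum_le_tsum _ fun i _ => by positivity
    have h6 : ∑ j ∈ Finset.range k, G * y ^ (j + 1) = G * y * ∑ j ∈ Finset.range k, y ^ j := by
      rw [Finset.mul_sum]; exact Finset.sum_congr rfl fun j _ => by ring
    rw [h6]
    calc _ ≤ G * y * (1 / (1 - y)) := by gcongr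
      _ ≤ 1 / 2 := by
        rw [mul_one_div, div_le_iff₀ (by linarith)]; nlinarith
  · have hP : Integrable (fun x : ℝ => ∑ j ∈ Finset.range (k + 1),
        wordSum (cumulantTerm κ ρ x) k j) (gaussianReal 0 1) :=
      integrable_finsetSum _ fun j _ => integrable_wordSum κ ρ k j
    have hP' : Integrable (fun x : ℝ => Complex.exp (-(x : ℂ) ^ 2 / 2) *
        ∑ j ∈ Finset.range (k + 1), wordSum (cumulantTerm κ ρ x) k j) := by
      refine (integrable_gaussianReal_iff.1 hP).congr (Filter.Eventually.of_forall fun x => ?_)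
      simp only [Complex.real_smul]
      push_cast
      rfl
    have h1 : ((Real.sqrt (κ 2) * Real.sqrt (2 * Real.pi) * edgeworthTerm κ ρ k : ℝ) : ℂ) =
        ((1 / Real.sqrt (2 * Real.pi) : ℝ) : ℂ) * ∫ x : ℝ, Complex.exp (-(x : ℂ) ^ 2 / 2) *
        ∑ j ∈ Finset.range (k + 1), wordSum (cumulantTerm κ ρ x) k j := by
      rw [sqrt_mul_edgeworthTerm hκ2, ← integral_finsetSum _ fun j _ => integrable_wordSum κ ρ k j,
        integral_gaussianReal_eq_integral_smul one_ne_zero, ← integral_const_mul]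
      congr 1; ext x
      rw [Complex.real_smul, gaussianPDFReal]
      push_cast
      simp
      ring
    have hmeas : MeasurableSet {x : ℝ | 1 < 8 * A * δ * |x|} :=
      measurableSet_lt measurable_const (by fun_prop)
    rw [h1, ← mul_sub, ← integral_sub hint hP', norm_mul]
    have h2 : ‖((1 / Real.sqrt (2 * Real.pi) : ℝ) : ℂ)‖ ≤ 1 := by
      rw [Complex.norm_real, Real.norm_eq_abs, abs_of_pos (by positivity)]
      rw [div_le_one (by positivity), Real.one_le_sqrt]
      nlinarith [Real.pi_gt_three]
    have h3 : ∀ x : ℝ, 17 * 2 ^ k * (8 * A * δ * |x|) ^ (k + 1) * Real.exp (-(5 / 32) * x ^ 2) ≤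
        (17 * (8 * A) * C₀ * (2 * (8 * A + 1) * D₀) ^ k * (k : ℝ) ^ ((k : ℝ) / 2) * δ ^ (k + 1)) *
          Real.exp (-(1 / 8) * x ^ 2) := by
      intro x
      have h4 := (hpow k |x| (abs_nonneg x)).1
      rw [sq_abs] at h4
      calc _ = 17 * 2 ^ k * (8 * A) ^ k * (8 * A) * δ ^ (k + 1) * |x| ^ (k + 1) *
            Real.exp (-(5 / 32) * x ^ 2) := by rw [mul_pow, mul_pow]; ring
        _ ≤ 17 * 2 ^ k * (8 * A + 1) ^ k * (8 * A) * δ ^ (k + 1) *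
            (C₀ * D₀ ^ k * (k : ℝ) ^ ((k : ℝ) / 2) * Real.exp (1 / 32 * x ^ 2)) *
            Real.exp (-(5 / 32) * x ^ 2) := by
          gcongr
          linarith
        _ = (17 * (8 * A) * C₀ * (2 * (8 * A + 1) * D₀) ^ k * (k : ℝ) ^ ((k : ℝ) / 2) *
            δ ^ (k + 1)) * (Real.exp (1 / 32 * x ^ 2) * Real.exp (-(5 / 32) * x ^ 2)) := by
          rw [mul_pow, mul_pow]; ring
        _ = _ := by rw [← Real.exp_add]; congr 2; ring
    set K := 17 * (8 * A) * C₀ * (2 * (8 * A + 1) * D₀) ^ k * (k : ℝ) ^ ((k : ℝ) / 2) * δ ^ (k + 1)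
      with hK
    have h4 : ‖∫ x : ℝ, (Complex.exp (-(x : ℂ) ^ 2 / 2 + g x) - Complex.exp (-(x : ℂ) ^ 2 / 2) *
        ∑ j ∈ Finset.range (k + 1), wordSum (cumulantTerm κ ρ x) k j)‖ ≤
        ∫ x : ℝ, (K * Real.exp (-(1 / 8) * x ^ 2) + {x : ℝ | 1 < 8 * A * δ * |x|}.indicator
          (fun x => ‖Complex.exp (-(x : ℂ) ^ 2 / 2 + g x)‖) x) := by
      refine norm_integral_le_of_norm_le ((hi'.const_mul _).add (hint.norm.indicator hmeas))
        (Filter.Eventually.of_forall fun x => ?_)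
      refine (edgeworth_pointwise hA.le hδ.le hκ k (hg · x)).trans ?_
      exact add_le_add (h3 x) le_rfl
    rw [integral_add (hi'.const_mul _) (hint.norm.indicator hmeas), integral_const_mul,
      integral_indicator hmeas] at h4
    calc _ ≤ 1 * _ := mul_le_mul h2 h4 (norm_nonneg _) zero_le_one
      _ = _ := by rw [hK, ← hG']; ring

/-! ### Fourier inversion for an integrable characteristic function -/

section Density
open Filter Topology

variable {μ : Measure ℝ} [IsProbabilityMeasure μ]

/-- Fubini and the Fourier transform of a Gaussian. The right side is an average of Gaussian
kernels, which shows that the damped inversion integral is real and nonnegative. -/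
theorem integral_charFun_mul_gaussian {b : ℝ} (hb : 0 < b) (x : ℝ) :
    ∫ t : ℝ, Complex.exp (-b * (t : ℂ) ^ 2) * (charFun μ t * Complex.exp (-(t * x * Complex.I))) =
      ((∫ z, Real.sqrt (Real.pi / b) * Real.exp (-(z - x) ^ 2 / (4 * b)) ∂μ : ℝ) : ℂ) := by
  have h1 : ∀ t : ℝ, Complex.exp (-b * (t : ℂ) ^ 2) *
      (charFun μ t * Complex.exp (-(t * x * Complex.I))) =
      ∫ z : ℝ, Complex.exp (Complex.I * ((z - x : ℝ) : ℂ) * t) * Complex.exp (-b * (t : ℂ) ^ 2) ∂μ := by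
    intro t
    rw [charFun_apply_real, ← integral_mul_const, ← integral_const_mul]
    congr 1; ext z
    rw [← Complex.exp_add, ← Complex.exp_add, ← Complex.exp_add]
    congr 1; push_cast; ring
  have hint : Integrable (Function.uncurry fun (t z : ℝ) =>
      Complex.exp (Complex.I * ((z - x : ℝ) : ℂ) * t) * Complex.exp (-b * (t : ℂ) ^ 2))
      (volume.prod μ) := by
    refine ((integrable_exp_neg_mul_sq hb).mul_prod (integrable_const (1 : ℝ)) (ν := μ)).mono'
      (Continuous.aestronglyMeasurable (by unfold Function.uncurry; fun_prop))
      (Eventually.of_forall fun p => ?_)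
    simp only [Function.uncurry, norm_mul]
    rw [Complex.norm_exp, Complex.norm_exp, mul_one, ← Real.exp_add]
    refine le_of_eq ?_
    congr 1
    simp [← Complex.ofReal_pow]
  simp_rw [h1]
  rw [integral_integral_swap hint, ← integral_complex_ofReal]
  congr 1; ext z
  rw [fourierIntegral_gaussian (by simpa using hb)]
  push_cast
  congr 1
  rw [show ((Real.pi : ℂ) / b) = ((Real.pi / b : ℝ) : ℂ) by push_cast; rfl, Real.sqrt_eq_rpow,
      Complex.ofReal_cpow (by positivity)]
  norm_num

/-- The Gaussian-damped inversion integrals tend pointwise to the undamped one, so the latter is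
real and nonnegative. Each damped version has mass 1, and Fatou gives mass at most 1 in the limit,
hence integrability. Fourier inversion then identifies the characteristic function of the limit
density with that of μ. -/
theorem exists_continuous_density (h : Integrable (charFun μ)) :
    ∃ f : ℝ → ℝ, Continuous f ∧ (∀ x, 0 ≤ f x) ∧
      μ = volume.withDensity (fun x => ENNReal.ofReal (f x)) ∧
      ∀ x : ℝ, (f x : ℂ) = ((1 / (2 * Real.pi) : ℝ) : ℂ) *
        ∫ t : ℝ, charFun μ t * Complex.exp (-(t * x * Complex.I)) := by
  set F : ℝ → ℂ := fun x => ((1 / (2 * Real.pi) : ℝ) : ℂ) *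
    ∫ t : ℝ, charFun μ t * Complex.exp (-(t * x * Complex.I)) with hF
  have hnorm : ∀ t x : ℝ, ‖Complex.exp (-(t * x * Complex.I))‖ = 1 := by
    intro t x
    rw [Complex.norm_exp]; simp
  have hFi : ∀ x : ℝ, Integrable (fun t : ℝ => charFun μ t * Complex.exp (-(t * x * Complex.I))) := by
    intro x
    refine h.mono (h.1.mul (Continuous.aestronglyMeasurable (by fun_prop)))
      (Eventually.of_forall fun t => ?_)
    rw [norm_mul, hnorm, mul_one]
  have hcont : Continuous F := by
    refine continuous_const.mul (continuous_of_dominated (bound := fun t => ‖charFun μ t‖)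
      (fun x => (hFi x).1) (fun x => Eventually.of_forall fun t => ?_) h.norm
      (Eventually.of_forall fun t => by fun_prop))
    rw [norm_mul, hnorm, mul_one]
  let G : ℕ → ℝ → ℝ := fun n x => 1 / (2 * Real.pi) *
    ∫ z, Real.sqrt (Real.pi / (n + 1 : ℝ)⁻¹) * Real.exp (-(z - x) ^ 2 / (4 * (n + 1 : ℝ)⁻¹)) ∂μ
  have hG0 : ∀ n x, 0 ≤ G n x := fun n x => mul_nonneg (by positivity)
    (integral_nonneg fun z => by positivity)
  have hlim : ∀ x, Tendsto (fun n => (G n x : ℂ)) atTop (𝓝 (F x)) := by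
    intro x
    have h1 := (Real.tendsto_integral_cexp_sq_smul (hFi x)).comp
      (tendsto_natCast_atTop_atTop.atTop_add (tendsto_const_nhds (x := (1 : ℝ))) :
        Tendsto (fun n : ℕ => (n : ℝ) + 1) atTop atTop)
    refine (h1.const_mul ((1 / (2 * Real.pi) : ℝ) : ℂ)).congr fun n => ?_
    simp only [G, Function.comp]
    rw [Complex.ofReal_mul, ← integral_charFun_mul_gaussian (by positivity)]
    congr 2; ext t
    rw [smul_eq_mul, Real.norm_eq_abs, ← Complex.ofReal_pow, sq_abs]
    push_cast; rfl
  have hre : ∀ x, Tendsto (fun n => G n x) atTop (𝓝 (F x).re) := fun x => by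
    simpa using! (Complex.continuous_re.tendsto _).comp (hlim x)
  have him : ∀ x, ((F x).re : ℂ) = F x := fun x =>
    tendsto_nhds_unique ((Complex.continuous_ofReal.tendsto _).comp (hre x)) (hlim x)
  have hnn : ∀ x, 0 ≤ (F x).re := fun x => ge_of_tendsto' (hre x) fun n => hG0 n x
  have hcre : Continuous fun x => (F x).re := Complex.continuous_re.comp hcont
  have hGl : ∀ n x, ENNReal.ofReal (G n x) = ∫⁻ z, ENNReal.ofReal (1 / (2 * Real.pi) *
      (Real.sqrt (Real.pi / (n + 1 : ℝ)⁻¹) *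
        Real.exp (-(z - x) ^ 2 / (4 * (n + 1 : ℝ)⁻¹)))) ∂μ := by
    intro n x
    simp only [G]
    rw [← integral_const_mul, ofReal_integral_eq_lintegral_ofReal]
    · refine Integrable.of_bound (Continuous.aestronglyMeasurable (by fun_prop))
        (1 / (2 * Real.pi) * (Real.sqrt (Real.pi / (n + 1 : ℝ)⁻¹) * 1))
        (Eventually.of_forall fun z => ?_)
      rw [Real.norm_of_nonneg (by positivity)]
      gcongr
      rw [Real.exp_le_one_iff, neg_div]
      exact neg_nonpos.2 (by positivity)
    · exact Eventually.of_forall fun z => by positivity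
  have hGm : ∀ n, Measurable fun x => ENNReal.ofReal (G n x) := by
    intro n
    simp_rw [hGl n]
    exact Measurable.lintegral_prod_right' (f := fun p : ℝ × ℝ => ENNReal.ofReal (1 / (2 * Real.pi) *
      (Real.sqrt (Real.pi / (n + 1 : ℝ)⁻¹) *
        Real.exp (-(p.2 - p.1) ^ 2 / (4 * (n + 1 : ℝ)⁻¹))))) (by fun_prop)
  have hGint : ∀ n, ∫⁻ x, ENNReal.ofReal (G n x) = 1 := by
    intro n
    simp_rw [hGl n]
    rw [lintegral_lintegral_swap (Measurable.aemeasurable (by unfold Function.uncurry; fun_prop))]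
    have h1 : ∀ z : ℝ, ∫⁻ x : ℝ, ENNReal.ofReal (1 / (2 * Real.pi) *
        (Real.sqrt (Real.pi / (n + 1 : ℝ)⁻¹) *
          Real.exp (-(z - x) ^ 2 / (4 * (n + 1 : ℝ)⁻¹)))) = 1 := by
      intro z
      rw [lintegral_sub_left_eq_self (fun u : ℝ => ENNReal.ofReal (1 / (2 * Real.pi) *
        (Real.sqrt (Real.pi / (n + 1 : ℝ)⁻¹) * Real.exp (-u ^ 2 / (4 * (n + 1 : ℝ)⁻¹))))) z]
      have h2 : (fun u : ℝ => 1 / (2 * Real.pi) * (Real.sqrt (Real.pi / (n + 1 : ℝ)⁻¹) *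
          Real.exp (-u ^ 2 / (4 * (n + 1 : ℝ)⁻¹)))) = fun u : ℝ => (1 / (2 * Real.pi) *
          Real.sqrt (Real.pi / (n + 1 : ℝ)⁻¹)) * Real.exp (-((n + 1 : ℝ) / 4) * u ^ 2) := by
        ext u
        rw [mul_assoc]
        congr 3
        field_simp
      have h3 := (integrable_exp_neg_mul_sq (b := (n + 1 : ℝ) / 4) (by positivity)).const_mul
        (1 / (2 * Real.pi) * Real.sqrt (Real.pi / (n + 1 : ℝ)⁻¹))
      have h4 : ∀ u : ℝ, ENNReal.ofReal (1 / (2 * Real.pi) * (Real.sqrt (Real.pi / (n + 1 : ℝ)⁻¹) *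
          Real.exp (-u ^ 2 / (4 * (n + 1 : ℝ)⁻¹)))) = ENNReal.ofReal ((1 / (2 * Real.pi) *
          Real.sqrt (Real.pi / (n + 1 : ℝ)⁻¹)) * Real.exp (-((n + 1 : ℝ) / 4) * u ^ 2)) :=
        fun u => by rw [congrFun h2 u]
      simp_rw [h4]
      rw [← ofReal_integral_eq_lintegral_ofReal h3 (Eventually.of_forall fun u => by positivity),
        integral_const_mul, integral_gaussian, mul_assoc, ← Real.sqrt_mul (by positivity)]
      have h5 : Real.pi / (n + 1 : ℝ)⁻¹ * (Real.pi / ((n + 1 : ℝ) / 4)) = (2 * Real.pi) ^ 2 := by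
        field_simp; ring
      rw [h5, Real.sqrt_sq (by positivity), one_div, inv_mul_cancel₀ (by positivity)]
      simp
    simp_rw [h1]
    simp
  have hle : ∫⁻ x, ENNReal.ofReal (F x).re ≤ 1 := by
    calc ∫⁻ x, ENNReal.ofReal (F x).re = ∫⁻ x, liminf (fun n => ENNReal.ofReal (G n x)) atTop := by
          refine lintegral_congr fun x => ?_
          exact (((ENNReal.continuous_ofReal.tendsto _).comp (hre x)).liminf_eq).symm
      _ ≤ liminf (fun n => ∫⁻ x, ENNReal.ofReal (G n x)) atTop := lintegral_liminf_le hGm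
      _ = 1 := by simp [hGint]
  have hFint : Integrable F := by
    refine ⟨hcont.aestronglyMeasurable, ?_⟩
    rw [hasFiniteIntegral_iff_norm]
    refine lt_of_le_of_lt (le_of_eq (lintegral_congr fun x => ?_)) (lt_of_le_of_lt hle ENNReal.one_lt_top)
    rw [← him x, Complex.norm_real, Complex.ofReal_re, Real.norm_of_nonneg (hnn x)]
  have hFin : IsFiniteMeasure (volume.withDensity (fun x => ENNReal.ofReal (F x).re)) :=
    isFiniteMeasure_withDensity (ne_of_lt (lt_of_le_of_lt hle ENNReal.one_lt_top))
  refine ⟨fun x => (F x).re, hcre, hnn, Measure.ext_of_charFun ?_, him⟩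
  -- The dilation by -2π converts the kernel exp(2πi w x) of the inverse transform into exp(-i t x).
  let H : ℝ → ℂ := fun w => charFun μ (-(2 * Real.pi) * w)
  have hH : FourierTransformInv.fourierInv H = F := by
    ext x
    rw [Real.fourierInv_eq', hF]
    have := Measure.integral_comp_mul_left
      (fun t : ℝ => charFun μ t * Complex.exp (-(t * x * Complex.I))) (-(2 * Real.pi))
    simp only at this ⊢
    rw [abs_inv, abs_neg, abs_of_pos (by positivity : (0 : ℝ) < 2 * Real.pi), Complex.real_smul,
      ← one_div] at this
    rw [← this]
    congr 1; ext w
    rw [smul_eq_mul, mul_comm]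
    simp only [H]
    congr 2
    simp
    ring
  have hHi : Integrable H := h.comp_mul_left' (by simp [Real.pi_ne_zero])
  have hHc : Continuous H := continuous_charFun.comp (by fun_prop)
  have hinv := hHc.fourier_fourierInv_eq hHi (by
    have h3 : FourierTransform.fourier H = fun x => F (-x) := by
      ext x; rw [← hH, Real.fourierInv_eq_fourier_neg, neg_neg]
    rw [h3]; exact hFint.comp_neg)
  rw [hH] at hinv
  ext t
  have h2 := congrFun hinv (-(2 * Real.pi)⁻¹ * t)
  simp only [H] at h2
  rw [show -(2 * Real.pi) * (-(2 * Real.pi)⁻¹ * t) = t by field_simp] at h2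
  rw [← h2, charFun_apply_real, integral_withDensity_eq_integral_toReal_smul (by fun_prop)
    (Eventually.of_forall fun x => ENNReal.ofReal_lt_top), Real.fourier_eq']
  congr 1; ext x
  rw [ENNReal.toReal_ofReal (hnn x), Complex.real_smul, him x, smul_eq_mul, mul_comm]
  congr 2
  simp
  field_simp

end Density

/-! ### The power law and its tilted moments -/

/-- The probability measure with density `(2 - α) u ^ (1 - α)` on `(0, 1]`. -/
noncomputable def powerLaw (α : ℝ) : Measure ℝ :=
  (volume.restrict (Ioc 0 1)).withDensity (fun u => ENNReal.ofReal ((2 - α) * u ^ (1 - α)))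

section PowerLaw

variable {α : ℝ} {E : Type*} [NormedAddCommGroup E] [NormedSpace ℝ E]

theorem measurable_powerLaw_density :
    Measurable fun u : ℝ => ENNReal.ofReal ((2 - α) * u ^ (1 - α)) := by fun_prop

theorem integral_powerLaw (hα1 : α < 1) (f : ℝ → E) :
    ∫ u, f u ∂(powerLaw α) = ∫ u in Ioc (0 : ℝ) 1, ((2 - α) * u ^ (1 - α)) • f u := by
  rw [powerLaw, integral_withDensity_eq_integral_toReal_smul measurable_powerLaw_density
    (Filter.Eventually.of_forall fun x => ENNReal.ofReal_lt_top)]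
  refine setIntegral_congr_fun measurableSet_Ioc fun u hu => ?_
  rw [ENNReal.toReal_ofReal (mul_nonneg (by linarith) (Real.rpow_nonneg hu.1.le _))]

theorem integrable_powerLaw_iff (hα1 : α < 1) (f : ℝ → E) :
    Integrable f (powerLaw α) ↔
      IntegrableOn (fun u => ((2 - α) * u ^ (1 - α)) • f u) (Ioc (0 : ℝ) 1) := by
  rw [powerLaw, integrable_withDensity_iff_integrable_smul' measurable_powerLaw_density
    (Filter.Eventually.of_forall fun x => ENNReal.ofReal_lt_top)]
  refine integrable_congr ?_
  filter_upwards [ae_restrict_mem measurableSet_Ioc] with u hu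
  rw [ENNReal.toReal_ofReal (mul_nonneg (by linarith) (Real.rpow_nonneg hu.1.le _))]

theorem ae_powerLaw : ∀ᵐ u ∂(powerLaw α), u ∈ Ioc (0 : ℝ) 1 :=
  (withDensity_absolutelyContinuous _ _).ae_le (ae_restrict_mem measurableSet_Ioc)

theorem integrableOn_rpow_Ioc {s h : ℝ} (hs : -1 < s) :
    IntegrableOn (fun u : ℝ => u ^ s) (Ioc 0 h) := by
  rcases le_total 0 h with hh | hh
  · exact (intervalIntegrable_iff_integrableOn_Ioc_of_le hh).1
      (intervalIntegral.intervalIntegrable_rpow' hs)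
  · rw [Ioc_eq_empty (by linarith)]; simp

theorem powerLaw_Ioc (hα1 : α < 1) {h : ℝ} (h0 : 0 ≤ h) (h1 : h ≤ 1) :
    powerLaw α (Ioc 0 h) = ENNReal.ofReal (h ^ (2 - α)) := by
  rw [powerLaw, withDensity_apply _ measurableSet_Ioc, Measure.restrict_restrict measurableSet_Ioc,
    Ioc_inter_Ioc, max_self, min_eq_left h1, ← ofReal_integral_eq_lintegral_ofReal]
  · rw [integral_const_mul, ← intervalIntegral.integral_of_le h0, integral_rpow (Or.inl (by linarith)),
      Real.zero_rpow (by linarith), show 1 - α + 1 = 2 - α by ring]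
    congr 1
    field_simp [show 2 - α ≠ 0 by linarith]
    simp
  · exact (integrableOn_rpow_Ioc (by linarith)).const_mul _
  · filter_upwards [ae_restrict_mem measurableSet_Ioc] with u hu
    exact mul_nonneg (by linarith) (Real.rpow_nonneg hu.1.le _)

theorem isProbabilityMeasure_powerLaw (hα1 : α < 1) : IsProbabilityMeasure (powerLaw α) := by
  constructor
  have h := powerLaw_Ioc hα1 zero_le_one le_rfl
  rw [Real.one_rpow, ENNReal.ofReal_one] at h
  rw [← h]
  refine (measure_eq_measure_of_null_sdiff (subset_univ _) ?_).symm
  have := ae_powerLaw (α := α)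
  rw [ae_iff] at this
  rwa [← compl_eq_univ_sdiff]

theorem integrable_of_bound_Ioc {F : Type*} [NormedAddCommGroup F] (hα1 : α < 1) {f : ℝ → F}
    (hf : AEStronglyMeasurable f (powerLaw α)) (C : ℝ) (hC : ∀ u ∈ Ioc (0 : ℝ) 1, ‖f u‖ ≤ C) :
    Integrable f (powerLaw α) := by
  have := isProbabilityMeasure_powerLaw hα1
  exact Integrable.of_bound hf C (ae_powerLaw.mono hC)

theorem integrable_inv_powerLaw (hα1 : α < 1) : Integrable (fun u : ℝ => u⁻¹) (powerLaw α) := by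
  rw [integrable_powerLaw_iff hα1]
  refine IntegrableOn.congr_fun
    ((integrableOn_rpow_Ioc (s := -α) (h := 1) (by linarith)).const_mul (2 - α))
    (fun u hu => ?_) measurableSet_Ioc
  simp only [smul_eq_mul]
  rw [show -α = 1 - α - 1 by ring, Real.rpow_sub_one hu.1.ne']
  ring_nf

/-- The moments of the exponentially tilted power law. -/
noncomputable def powerMoment (α : ℝ) (n : ℕ) (b : ℝ) : ℝ :=
  ∫ u, u ^ n * Real.exp (b * u) ∂(powerLaw α)

theorem exp_mul_le {b u : ℝ} (hu : u ∈ Ioc (0 : ℝ) 1) : Real.exp (b * u) ≤ Real.exp |b| := by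
  gcongr
  calc b * u ≤ |b| * u := mul_le_mul_of_nonneg_right (le_abs_self b) hu.1.le
    _ ≤ |b| := mul_le_of_le_one_right (abs_nonneg b) hu.2

theorem integrable_pow_mul_exp (hα1 : α < 1) (n : ℕ) (b : ℝ) :
    Integrable (fun u : ℝ => u ^ n * Real.exp (b * u)) (powerLaw α) := by
  refine integrable_of_bound_Ioc hα1 (Continuous.aestronglyMeasurable (by fun_prop)) (Real.exp |b|)
    fun u hu => ?_
  have h0 := hu.1.le
  rw [Real.norm_of_nonneg (by positivity)]
  calc _ ≤ 1 * Real.exp |b| := by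
        gcongr
        · exact pow_le_one₀ hu.1.le hu.2
        · exact Real.exp_le_exp.1 (exp_mul_le hu)
    _ = _ := one_mul _

theorem powerMoment_nonneg (n : ℕ) (b : ℝ) : 0 ≤ powerMoment α n b := by
  refine integral_nonneg_of_ae (ae_powerLaw.mono fun u hu => ?_)
  have := hu.1.le
  simp only [Pi.zero_apply]
  positivity

theorem powerMoment_le (hα1 : α < 1) (n : ℕ) (b : ℝ) : powerMoment α n b ≤ powerMoment α 0 b := by
  refine integral_mono_ae (integrable_pow_mul_exp hα1 n b) (integrable_pow_mul_exp hα1 0 b)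
    (ae_powerLaw.mono fun u hu => ?_)
  simp only [pow_zero]
  gcongr
  exact pow_le_one₀ hu.1.le hu.2

theorem powerMoment_zero_mono (hα1 : α < 1) {b b' : ℝ} (h : b ≤ b') :
    powerMoment α 0 b ≤ powerMoment α 0 b' := by
  refine integral_mono_ae (integrable_pow_mul_exp hα1 0 b) (integrable_pow_mul_exp hα1 0 b')
    (ae_powerLaw.mono fun u hu => ?_)
  simp only [pow_zero, one_mul]
  have := hu.1.le
  gcongr

theorem powerMoment_zero_zero (hα1 : α < 1) : powerMoment α 0 0 = 1 := by
  have := isProbabilityMeasure_powerLaw hα1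
  simp [powerMoment]

theorem powerMoment_zero_le_exp (hα1 : α < 1) {b : ℝ} (hb : 0 ≤ b) :
    powerMoment α 0 b ≤ Real.exp b := by
  have := isProbabilityMeasure_powerLaw hα1
  calc powerMoment α 0 b ≤ ∫ _, Real.exp b ∂(powerLaw α) := by
        refine integral_mono_ae (integrable_pow_mul_exp hα1 0 b) (integrable_const _)
          (ae_powerLaw.mono fun u hu => ?_)
        have := exp_mul_le (b := b) hu
        rw [abs_of_nonneg hb] at this
        simpa using this
    _ = _ := by simp

theorem powerMoment_zero_pos (hα1 : α < 1) (b : ℝ) : 0 < powerMoment α 0 b := by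
  have := isProbabilityMeasure_powerLaw hα1
  have h := integrable_pow_mul_exp hα1 0 b
  simp only [pow_zero, one_mul] at h
  simp only [powerMoment, pow_zero, one_mul]
  exact integral_exp_pos h

/-- Lower bound for the total mass of the power law tilted to the left. -/
theorem le_powerMoment_zero_neg (hα1 : α < 1) {a : ℝ} (ha : 0 ≤ a) :
    Real.exp (-1) * (1 + a) ^ (-(2 - α)) ≤ powerMoment α 0 (-a) := by
  have := isProbabilityMeasure_powerLaw hα1
  have h1 : (1 + a)⁻¹ ≤ 1 := inv_le_one_of_one_le₀ (by linarith)
  have h2 : (powerLaw α).real (Ioc 0 (1 + a)⁻¹) = (1 + a) ^ (-(2 - α)) := by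
    rw [Measure.real, powerLaw_Ioc hα1 (by positivity) h1, ENNReal.toReal_ofReal (by positivity),
      Real.inv_rpow (by positivity), Real.rpow_neg (by positivity)]
  rw [← h2]
  -- On (0, 1 / (1 + a)] the tilt is at least exp(-1), and the power law gives this interval the
  -- mass (1 + a)^(-(2 - α)).
  refine le_trans (setIntegral_ge_of_const_le_real measurableSet_Ioc (measure_ne_top _ _)
    (f := fun u : ℝ => u ^ 0 * Real.exp (-a * u)) (fun u hu => ?_)
    (integrable_pow_mul_exp hα1 0 (-a)).integrableOn) (setIntegral_le_integral
      (integrable_pow_mul_exp hα1 0 (-a)) (ae_powerLaw.mono fun u hu => ?_))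
  · rw [pow_zero, one_mul]
    gcongr
    have := hu.2
    have h3 : a * u ≤ a * (1 + a)⁻¹ := by gcongr
    have h4 : a * (1 + a)⁻¹ ≤ 1 := by
      rw [← div_eq_mul_inv, div_le_one (by positivity)]; linarith
    linarith
  · simp only [Pi.zero_apply]; positivity

/-- Upper bound for the moments of the power law tilted to the left. -/
theorem exists_powerMoment_neg_le (hα0 : 0 < α) (hα1 : α < 1) : ∃ C : ℝ, 1 ≤ C ∧ ∀ (n : ℕ) (a : ℝ), 0 ≤ a →
    powerMoment α n (-a) ≤ C * n.factorial * (2 / (1 + a)) ^ n * (1 + a) ^ (-(2 - α)) := by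
  refine ⟨max 1 (Real.exp 1 * ((2 - α) * (2 ^ (2 - α) * Real.Gamma (2 - α)))), le_max_left _ _,
    fun n a ha => ?_⟩
  set c := 1 + a with hc
  have hc0 : 0 < c := by positivity
  have hI : ∫ u, Real.exp (-(c / 2) * u) ∂(powerLaw α) ≤
      (2 - α) * (2 ^ (2 - α) * Real.Gamma (2 - α)) * c ^ (-(2 - α)) := by
    have hG := Real.integral_rpow_mul_exp_neg_mul_Ioi (a := 2 - α) (r := c / 2) (by linarith)
      (by positivity)
    have hGi : IntegrableOn (fun u : ℝ => u ^ (2 - α - 1) * Real.exp (-(c / 2 * u))) (Ioi 0) := by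
      refine (integrableOn_rpow_mul_exp_neg_mul_rpow (p := 1) (s := 2 - α - 1) (b := c / 2)
        (by linarith) one_pos (by positivity)).congr_fun (fun u _ => ?_) measurableSet_Ioi
      simp
    rw [integral_powerLaw hα1]
    calc _ = ∫ u in Ioc (0 : ℝ) 1, (2 - α) * (u ^ (2 - α - 1) * Real.exp (-(c / 2 * u))) := by
          refine setIntegral_congr_fun measurableSet_Ioc fun u _ => ?_
          simp only [smul_eq_mul]
          rw [show 2 - α - 1 = 1 - α by ring]; ring_nf
      _ ≤ (2 - α) * ∫ u in Ioi (0 : ℝ), u ^ (2 - α - 1) * Real.exp (-(c / 2 * u)) := by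
          rw [integral_const_mul]
          refine mul_le_mul_of_nonneg_left (setIntegral_mono_set hGi ?_
            Ioc_subset_Ioi_self.eventuallyLE) (by linarith)
          filter_upwards [ae_restrict_mem measurableSet_Ioi] with u hu
          exact mul_nonneg (Real.rpow_nonneg (le_of_lt hu) _) (Real.exp_pos _).le
      _ = _ := by
          rw [hG, one_div, inv_div, Real.div_rpow (by norm_num) hc0.le, Real.rpow_neg hc0.le]
          ring
  -- With c = 1 + a, half of the rate c pays for the power through (c u / 2)^n ≤ n! exp(c u / 2).
  -- Replacing a by c costs a factor exp u ≤ e. The other half of the rate remains for the Gamma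
  -- integral.
  have hb : ∀ u ∈ Ioc (0 : ℝ) 1, u ^ n * Real.exp (-a * u) ≤
      Real.exp 1 * n.factorial * (2 / c) ^ n * Real.exp (-(c / 2) * u) := by
    intro u hu
    have h0 := hu.1.le
    have h1 := Real.pow_div_factorial_le_exp (c * u / 2) (by positivity) n
    rw [div_le_iff₀ (by positivity)] at h1
    have h2 : u ^ n = (2 / c) ^ n * (c * u / 2) ^ n := by
      rw [← mul_pow]; congr 1; field_simp
    calc u ^ n * Real.exp (-a * u) ≤ (2 / c) ^ n * (Real.exp (c * u / 2) * n.factorial) *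
          Real.exp (-a * u) := by rw [h2]; gcongr
      _ = (n.factorial * (2 / c) ^ n) * (Real.exp (c * u / 2) * Real.exp (-a * u)) := by ring
      _ ≤ (n.factorial * (2 / c) ^ n) * (Real.exp 1 * Real.exp (-(c / 2) * u)) := by
          rw [← Real.exp_add, ← Real.exp_add]
          refine mul_le_mul_of_nonneg_left (Real.exp_le_exp.2 ?_) (by positivity)
          have := hu.2
          rw [hc]; linarith
      _ = _ := by ring
  calc powerMoment α n (-a) ≤
        ∫ u, Real.exp 1 * n.factorial * (2 / c) ^ n * Real.exp (-(c / 2) * u) ∂(powerLaw α) := by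
        refine integral_mono_ae (integrable_pow_mul_exp hα1 n (-a)) ?_ (ae_powerLaw.mono hb)
        have := integrable_pow_mul_exp hα1 0 (-(c / 2))
        simp only [pow_zero, one_mul] at this
        exact this.const_mul _
    _ ≤ Real.exp 1 * n.factorial * (2 / c) ^ n *
        ((2 - α) * (2 ^ (2 - α) * Real.Gamma (2 - α)) * c ^ (-(2 - α))) := by
        rw [integral_const_mul]; gcongr
    _ = (Real.exp 1 * ((2 - α) * (2 ^ (2 - α) * Real.Gamma (2 - α)))) * n.factorial *
        (2 / c) ^ n * c ^ (-(2 - α)) := by ring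
    _ ≤ _ := by gcongr; exact le_max_right _ _

end PowerLaw

/-! ### Lower bounds for the decay rate -/

section Oscillation

/-- Strictness of |sin v| < v together with compactness on a bounded interval; beyond v₀ + 2 the
quotient is at most 1/2. -/
theorem exists_abs_sin_le {v₀ : ℝ} (hv₀ : 0 < v₀) :
    ∃ c : ℝ, 0 < c ∧ ∀ v, v₀ ≤ v → c ≤ 1 - |Real.sin v| / v := by
  have hcont : ContinuousOn (fun v : ℝ => 1 - |Real.sin v| / v) (Icc v₀ (v₀ + 2)) := by
    refine continuousOn_const.sub (ContinuousOn.div (by fun_prop) continuousOn_id fun x hx => ?_)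
    exact (lt_of_lt_of_le hv₀ hx.1).ne'
  obtain ⟨w, hw, hmin⟩ := isCompact_Icc.exists_isMinOn (nonempty_Icc.2 (by linarith)) hcont
  have hw0 : 0 < w := lt_of_lt_of_le hv₀ hw.1
  have hpos : 0 < 1 - |Real.sin w| / w := by
    rw [sub_pos, div_lt_one hw0]
    simpa [abs_of_pos hw0] using Real.abs_sin_lt_abs hw0.ne'
  refine ⟨min (1 - |Real.sin w| / w) (1 / 2), lt_min hpos (by norm_num), fun v hv => ?_⟩
  rcases le_total v (v₀ + 2) with h | h
  · exact (min_le_left _ _).trans (hmin ⟨hv, h⟩)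
  · refine (min_le_right _ _).trans ?_
    have hv0 : 0 < v := by linarith
    have : |Real.sin v| / v ≤ 1 / 2 := by
      rw [div_le_div_iff₀ hv0 (by norm_num)]
      have := Real.abs_sin_le_one v
      linarith
    linarith

/-- The integral is 1/2 - (sin t - sin(t/2)) / t. The product formula bounds the difference of sines
by 2 |sin(t/4)|, leaving half of 1 - |sin v| / v at v = t/4. -/
theorem exists_le_integral_one_sub_cos {c₀ : ℝ} (hc₀ : 0 < c₀) :
    ∃ c : ℝ, 0 < c ∧ ∀ t : ℝ, c₀ ≤ |t| → c ≤ ∫ u in (1 / 2 : ℝ)..1, (1 - Real.cos (t * u)) := by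
  obtain ⟨c, hc, h⟩ := exists_abs_sin_le (v₀ := c₀ / 4) (by positivity)
  refine ⟨c / 2, by positivity, fun t ht => ?_⟩
  have hpos : ∀ t : ℝ, c₀ ≤ t → c / 2 ≤ ∫ u in (1 / 2 : ℝ)..1, (1 - Real.cos (t * u)) := by
    intro t ht
    have ht0 : 0 < t := by linarith
    have h1 : ∫ u in (1 / 2 : ℝ)..1, (1 - Real.cos (t * u)) =
        1 / 2 - t⁻¹ * (Real.sin t - Real.sin (t / 2)) := by
      rw [intervalIntegral.integral_sub (by simp)
        (Continuous.intervalIntegrable (by fun_prop) _ _),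
        intervalIntegral.integral_comp_mul_left (fun x => Real.cos x) ht0.ne', integral_cos]
      simp only [intervalIntegral.integral_const, smul_eq_mul]
      rw [mul_one, show t * (1 / 2) = t / 2 by ring]
      norm_num
    have h2 := h (t / 4) (by linarith)
    have h3 : Real.sin t - Real.sin (t / 2) = 2 * Real.sin (t / 4) * Real.cos (3 * t / 4) := by
      rw [Real.sin_sub_sin]; congr 2 <;> ring_nf
    have h4 : Real.sin t - Real.sin (t / 2) ≤ 2 * |Real.sin (t / 4)| := by
      rw [h3]
      calc _ ≤ |2 * Real.sin (t / 4) * Real.cos (3 * t / 4)| := le_abs_self _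
        _ = 2 * |Real.sin (t / 4)| * |Real.cos (3 * t / 4)| := by rw [abs_mul, abs_mul, abs_two]
        _ ≤ 2 * |Real.sin (t / 4)| * 1 := by gcongr; exact Real.abs_cos_le_one _
        _ = _ := by ring
    rw [h1]
    have h5 : t⁻¹ * (Real.sin t - Real.sin (t / 2)) ≤ (|Real.sin (t / 4)| / (t / 4)) / 2 := by
      calc _ ≤ t⁻¹ * (2 * |Real.sin (t / 4)|) := by gcongr
        _ = _ := by field_simp; ring
    linarith
  rcases le_total 0 t with h0 | h0
  · rw [abs_of_nonneg h0] at ht; exact hpos t ht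
  · rw [abs_of_nonpos h0] at ht
    have := hpos (-t) ht
    simpa using this

end Oscillation

section Decay

variable {α : ℝ}

/-- The rate of decay of the characteristic function of the tilted law. -/
noncomputable def decayRate (α b t : ℝ) : ℝ :=
  ∫ u, (1 - Real.cos (t * u)) / u ^ 2 * Real.exp (b * u) ∂(powerLaw α)

theorem integrable_decayRate (hα1 : α < 1) (b t : ℝ) :
    Integrable (fun u : ℝ => (1 - Real.cos (t * u)) / u ^ 2 * Real.exp (b * u)) (powerLaw α) := by
  refine integrable_of_bound_Ioc hα1 (Measurable.aestronglyMeasurable (by fun_prop))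
    (t ^ 2 / 2 * Real.exp |b|) fun u hu => ?_
  have h1 : 0 ≤ 1 - Real.cos (t * u) := by linarith [Real.cos_le_one (t * u)]
  have h2 := Real.one_sub_sq_div_two_le_cos (x := t * u)
  rw [Real.norm_of_nonneg (by positivity)]
  refine mul_le_mul ?_ (exp_mul_le hu) (Real.exp_pos _).le (by positivity)
  rw [div_le_iff₀ (pow_pos hu.1 2)]
  nlinarith

theorem decayRate_integrand_nonneg (b t u : ℝ) :
    0 ≤ (1 - Real.cos (t * u)) / u ^ 2 * Real.exp (b * u) := by
  have h1 : 0 ≤ 1 - Real.cos (t * u) := by linarith [Real.cos_le_one (t * u)]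
  positivity

/-- Only u ≤ c₁ / |t| is used. There 1 - cos(t u) is at least 2 (t u)² / π², the condition on |t|
keeps the tilt above exp(-1), and the mass is (c₁ / |t|)^(2 - α). The product is of order |t|^α. -/
theorem exists_rpow_le_decayRate (hα0 : 0 < α) (hα1 : α < 1) {c₁ : ℝ} (h0 : 0 < c₁) (h1 : c₁ ≤ 1) :
    ∃ c : ℝ, 0 < c ∧ ∀ b t : ℝ, c₁ * (1 + max (-b) 0) ≤ |t| → c * |t| ^ α ≤ decayRate α b t := by
  have := isProbabilityMeasure_powerLaw hα1
  refine ⟨2 / Real.pi ^ 2 * Real.exp (-1) * c₁ ^ (2 - α), by positivity, fun b t ht => ?_⟩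
  set a := max (-b) 0 with ha
  have ha0 : 0 ≤ a := le_max_right _ _
  have ht0 : 0 < |t| := lt_of_lt_of_le (by positivity) ht
  have hh1 : c₁ / |t| ≤ 1 := by
    rw [div_le_one ht0]; nlinarith
  have h2 : (powerLaw α).real (Ioc 0 (c₁ / |t|)) = (c₁ / |t|) ^ (2 - α) := by
    rw [Measure.real, powerLaw_Ioc hα1 (by positivity) hh1, ENNReal.toReal_ofReal (by positivity)]
  have h3 : 2 / Real.pi ^ 2 * Real.exp (-1) * c₁ ^ (2 - α) * |t| ^ α =
      (2 / Real.pi ^ 2 * |t| ^ 2 * Real.exp (-1)) * (powerLaw α).real (Ioc 0 (c₁ / |t|)) := by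
    rw [h2, Real.div_rpow h0.le ht0.le, Real.rpow_sub ht0, Real.rpow_two]
    field_simp
  rw [h3]
  refine le_trans (setIntegral_ge_of_const_le_real measurableSet_Ioc (measure_ne_top _ _)
    (f := fun u : ℝ => (1 - Real.cos (t * u)) / u ^ 2 * Real.exp (b * u)) (fun u hu => ?_)
    (integrable_decayRate hα1 b t).integrableOn) (setIntegral_le_integral
      (integrable_decayRate hα1 b t)
      (Filter.Eventually.of_forall fun u => decayRate_integrand_nonneg b t u))
  have hu0 := hu.1
  have htu : |t| * u ≤ c₁ := by
    have := hu.2; rwa [le_div_iff₀ ht0, mul_comm] at this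
  have htu' : |t * u| ≤ 1 := by rw [abs_mul, abs_of_pos hu0]; linarith
  refine mul_le_mul ?_ (Real.exp_le_exp.2 ?_) (Real.exp_pos _).le
    (div_nonneg (by linarith [Real.cos_le_one (t * u)]) (by positivity))
  · rw [le_div_iff₀ (by positivity)]
    have := Real.cos_le_one_sub_mul_cos_sq (x := t * u) (by linarith [Real.pi_gt_three])
    rw [sq_abs]
    nlinarith
  · have h4 : (1 + a) * u ≤ 1 := by
      have : c₁ * ((1 + a) * u) ≤ c₁ * 1 := by nlinarith
      exact le_of_mul_le_mul_left this h0
    have h5 : -b ≤ a := le_max_left _ _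
    nlinarith

/-- On (1/2, 1] the tilt is at least exp(b / 2) and the density of the power law at least 1/2, so
the untilted oscillation bound applies. -/
theorem exists_exp_le_decayRate (hα0 : 0 < α) (hα1 : α < 1) {c₀ : ℝ} (hc₀ : 0 < c₀) :
    ∃ c : ℝ, 0 < c ∧ ∀ b t : ℝ, 0 ≤ b → c₀ ≤ |t| → c * Real.exp (b / 2) ≤ decayRate α b t := by
  obtain ⟨c, hc, h⟩ := exists_le_integral_one_sub_cos hc₀
  refine ⟨c / 2, by positivity, fun b t hb ht => ?_⟩
  have hi := (integrable_powerLaw_iff hα1 _).1 (integrable_decayRate (α := α) hα1 b t)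
  rw [decayRate, integral_powerLaw hα1]
  have hsub : Ioc (1 / 2 : ℝ) 1 ⊆ Ioc 0 1 := Ioc_subset_Ioc_left (by norm_num)
  calc c / 2 * Real.exp (b / 2)
      ≤ (1 / 2 * Real.exp (b / 2)) * ∫ u in (1 / 2 : ℝ)..1, (1 - Real.cos (t * u)) := by
        have := h t ht
        nlinarith [Real.exp_pos (b / 2)]
    _ = ∫ u in Ioc (1 / 2 : ℝ) 1, (1 / 2 * Real.exp (b / 2)) * (1 - Real.cos (t * u)) := by
        rw [intervalIntegral.integral_of_le (by norm_num), integral_const_mul]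
    _ ≤ ∫ u in Ioc (1 / 2 : ℝ) 1, ((2 - α) * u ^ (1 - α)) •
          ((1 - Real.cos (t * u)) / u ^ 2 * Real.exp (b * u)) := by
        refine setIntegral_mono_on (Continuous.integrableOn_Ioc (by fun_prop)) (hi.mono_set hsub)
          measurableSet_Ioc fun u hu => ?_
        have hu0 : 0 < u := by linarith [hu.1]
        have hcos : 0 ≤ 1 - Real.cos (t * u) := by linarith [Real.cos_le_one (t * u)]
        have h1 : 1 / 2 ≤ (2 - α) * u ^ (1 - α) := by
          have : u ^ (1 : ℝ) ≤ u ^ (1 - α) :=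
            Real.rpow_le_rpow_of_exponent_ge hu0 hu.2 (by linarith)
          rw [Real.rpow_one] at this
          nlinarith [hu.1]
        have h2 : 1 - Real.cos (t * u) ≤ (1 - Real.cos (t * u)) / u ^ 2 := by
          rw [le_div_iff₀ (by positivity)]
          exact mul_le_of_le_one_right hcos (pow_le_one₀ hu0.le hu.2)
        have h3 : Real.exp (b / 2) ≤ Real.exp (b * u) := by
          gcongr; nlinarith [hu.1]
        rw [smul_eq_mul]
        calc _ = 1 / 2 * ((1 - Real.cos (t * u)) * Real.exp (b / 2)) := by ring
          _ ≤ _ := by gcongr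
    _ ≤ _ := by
        refine setIntegral_mono_set hi ?_ hsub.eventuallyLE
        filter_upwards [ae_restrict_mem measurableSet_Ioc] with u hu
        exact smul_nonneg (mul_nonneg (by linarith) (Real.rpow_nonneg hu.1.le _))
          (decayRate_integrand_nonneg b t u)

theorem integrable_exp_neg_mul_abs_rpow (hα0 : 0 < α) {c : ℝ} (hc : 0 < c) :
    Integrable (fun t : ℝ => Real.exp (-c * |t| ^ α)) := by
  have h1 : IntegrableOn (fun t : ℝ => Real.exp (-c * |t| ^ α)) (Ioi 0) := by
    refine (integrableOn_rpow_mul_exp_neg_mul_rpow (p := α) (s := 0) (b := c) (by norm_num) hα0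
      hc).congr_fun (fun u hu => ?_) measurableSet_Ioi
    simp [abs_of_pos (show 0 < u from hu)]
  rw [← integrableOn_univ, ← Iic_union_Ioi (a := (0 : ℝ)), integrableOn_union]
  refine ⟨?_, h1⟩
  rw [integrableOn_Iic_iff_integrableOn_Iio]
  rw [← integrable_indicator_iff measurableSet_Ioi] at h1
  rw [← integrable_indicator_iff measurableSet_Iio]
  refine h1.comp_neg.congr (Filter.Eventually.of_forall fun t => ?_)
  simp [indicator]

end Decay

/-! ### The centred exponent and its rescaled integral -/

section Exponent

variable {α : ℝ}

/-- The centred Lévy exponent of the tilted law at the imaginary argument `i t`. -/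
noncomputable def centredExponent (α b t : ℝ) : ℂ :=
  ∫ u, (Complex.exp (Complex.I * ((t * u : ℝ) : ℂ)) - 1 - Complex.I * ((t * u : ℝ) : ℂ)) /
    ((u ^ 2 : ℝ) : ℂ) * ((Real.exp (b * u) : ℝ) : ℂ) ∂(powerLaw α)

theorem norm_exp_sub_one_sub_le (v : ℝ) :
    ‖Complex.exp (Complex.I * v) - 1 - Complex.I * v‖ ≤ v ^ 2 / 2 := by
  have := norm_exp_mul_I_sub_sum_le 2 v
  simp [Finset.sum_range_succ] at this
  rwa [← sub_sub] at this

theorem integrable_centredExponent (hα1 : α < 1) (b t : ℝ) :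
    Integrable (fun u : ℝ => (Complex.exp (Complex.I * ((t * u : ℝ) : ℂ)) - 1 -
      Complex.I * ((t * u : ℝ) : ℂ)) / ((u ^ 2 : ℝ) : ℂ) * ((Real.exp (b * u) : ℝ) : ℂ))
      (powerLaw α) := by
  refine integrable_of_bound_Ioc hα1 (Measurable.aestronglyMeasurable (by fun_prop))
    (t ^ 2 / 2 * Real.exp |b|) fun u hu => ?_
  rw [norm_mul, norm_div, Complex.norm_real, Complex.norm_real, Real.norm_of_nonneg (Real.exp_pos _).le,
    Real.norm_of_nonneg (by positivity)]
  refine mul_le_mul ?_ (exp_mul_le hu) (Real.exp_pos _).le (by positivity)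
  rw [div_le_iff₀ (pow_pos hu.1 2)]
  refine (norm_exp_sub_one_sub_le _).trans (le_of_eq ?_)
  ring

theorem measurable_centredExponent (hα1 : α < 1) (b : ℝ) : Measurable (centredExponent α b) := by
  have := isProbabilityMeasure_powerLaw hα1
  have h : StronglyMeasurable (Function.uncurry fun (t u : ℝ) =>
      (Complex.exp (Complex.I * ((t * u : ℝ) : ℂ)) - 1 -
      Complex.I * ((t * u : ℝ) : ℂ)) / ((u ^ 2 : ℝ) : ℂ) * ((Real.exp (b * u) : ℝ) : ℂ)) := by
    refine Measurable.stronglyMeasurable ?_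
    unfold Function.uncurry
    fun_prop
  exact h.integral_prod_right.measurable

theorem re_centredExponent (hα1 : α < 1) (b t : ℝ) :
    (centredExponent α b t).re = -decayRate α b t := by
  have h := integral_re (integrable_centredExponent hα1 b t)
  have h2 : (centredExponent α b t).re = ∫ u, RCLike.re ((Complex.exp (Complex.I * ((t * u : ℝ) : ℂ)) - 1 -
      Complex.I * ((t * u : ℝ) : ℂ)) / ((u ^ 2 : ℝ) : ℂ) * ((Real.exp (b * u) : ℝ) : ℂ))
      ∂(powerLaw α) := h.symm
  rw [h2, decayRate, ← integral_neg]
  congr 1; ext u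
  simp only [RCLike.re_to_complex, Complex.re_mul_ofReal, Complex.div_ofReal_re]
  rw [mul_comm Complex.I, Complex.sub_re, Complex.sub_re, Complex.exp_ofReal_mul_I_re]
  simp
  ring

theorem norm_exp_centredExponent (hα1 : α < 1) (ρ b t : ℝ) :
    ‖Complex.exp ((ρ ^ 2 : ℝ) * centredExponent α b t)‖ = Real.exp (-(ρ ^ 2 * decayRate α b t)) := by
  rw [Complex.norm_exp, Complex.re_ofReal_mul, re_centredExponent hα1]
  congr 1; ring

/-- Taylor expansion in t u under the integral; dividing by u² lowers the moment order from n to n -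
2. The remainder involves only the next moment, so bounds on the cumulants control it too. -/
theorem norm_centredExponent_sub_sum_le (hα1 : α < 1) (b t : ℝ) (N : ℕ) :
    ‖centredExponent α b t - ∑ n ∈ Finset.Icc 2 (N + 2),
        ((powerMoment α (n - 2) b / n.factorial : ℝ) : ℂ) * (Complex.I * t) ^ n‖ ≤
      |t| ^ (N + 3) / (N + 3).factorial * powerMoment α (N + 1) b := by
  have h1 : ∀ n : ℕ, ((powerMoment α (n - 2) b / n.factorial : ℝ) : ℂ) * (Complex.I * t) ^ n =
      ∫ u : ℝ, ((u ^ (n - 2) * Real.exp (b * u) : ℝ) : ℂ) *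
        ((Complex.I * t) ^ n / n.factorial) ∂(powerLaw α) := by
    intro n
    rw [integral_mul_const, integral_complex_ofReal, powerMoment]
    push_cast; ring
  have hi : ∀ n : ℕ, Integrable (fun u : ℝ => ((u ^ (n - 2) * Real.exp (b * u) : ℝ) : ℂ) *
        ((Complex.I * t) ^ n / n.factorial)) (powerLaw α) := fun n =>
    ((integrable_pow_mul_exp hα1 _ b).ofReal).mul_const _
  simp_rw [h1]
  rw [centredExponent, ← integral_finsetSum _ fun n _ => hi n,
    ← integral_sub (integrable_centredExponent hα1 b t) (integrable_finsetSum _ fun n _ => hi n),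
    powerMoment, ← integral_const_mul]
  refine norm_integral_le_of_norm_le ((integrable_pow_mul_exp hα1 _ b).const_mul _)
    (ae_powerLaw.mono fun u hu => ?_)
  have hu0 : 0 < u := hu.1
  have h2 : (Complex.exp (Complex.I * ((t * u : ℝ) : ℂ)) - 1 - Complex.I * ((t * u : ℝ) : ℂ)) /
      ((u ^ 2 : ℝ) : ℂ) * ((Real.exp (b * u) : ℝ) : ℂ) - ∑ n ∈ Finset.Icc 2 (N + 2),
        ((u ^ (n - 2) * Real.exp (b * u) : ℝ) : ℂ) * ((Complex.I * t) ^ n / n.factorial) =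
      (Complex.exp (Complex.I * ((t * u : ℝ) : ℂ)) - ∑ n ∈ Finset.range (N + 3),
        (Complex.I * ((t * u : ℝ) : ℂ)) ^ n / (n.factorial : ℂ)) * ((Real.exp (b * u) / u ^ 2 : ℝ) : ℂ) := by
    have h3 : ∑ n ∈ Finset.range (N + 3), (Complex.I * ((t * u : ℝ) : ℂ)) ^ n / (n.factorial : ℂ) =
        1 + Complex.I * ((t * u : ℝ) : ℂ) + ∑ n ∈ Finset.Icc 2 (N + 2),
          (Complex.I * ((t * u : ℝ) : ℂ)) ^ n / (n.factorial : ℂ) := by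
      rw [Finset.range_eq_Ico, Finset.sum_eq_sum_Ico_succ_bot (by omega),
        Finset.sum_eq_sum_Ico_succ_bot (by omega), ← add_assoc]
      congr 1
      simp
    have h4 : ∑ n ∈ Finset.Icc 2 (N + 2),
        ((u ^ (n - 2) * Real.exp (b * u) : ℝ) : ℂ) * ((Complex.I * t) ^ n / n.factorial) =
        (∑ n ∈ Finset.Icc 2 (N + 2), (Complex.I * ((t * u : ℝ) : ℂ)) ^ n / (n.factorial : ℂ)) *
          ((Real.exp (b * u) / u ^ 2 : ℝ) : ℂ) := by
      rw [Finset.sum_mul]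
      refine Finset.sum_congr rfl fun n hn => ?_
      obtain ⟨m, rfl⟩ : ∃ m, n = m + 2 := ⟨n - 2, by have := (Finset.mem_Icc.1 hn).1; omega⟩
      have hu' : (u : ℂ) ≠ 0 := by exact_mod_cast hu0.ne'
      have hf : (((m + 2).factorial : ℕ) : ℂ) ≠ 0 := by exact_mod_cast (m + 2).factorial_ne_zero
      rw [Nat.add_sub_cancel]
      push_cast
      field_simp
      ring
    rw [h4, h3]
    push_cast
    ring
  rw [h2, norm_mul, Complex.norm_real, Real.norm_of_nonneg (by positivity)]
  calc _ ≤ |t * u| ^ (N + 3) / (N + 3).factorial * (Real.exp (b * u) / u ^ 2) := by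
        gcongr; exact norm_exp_mul_I_sub_sum_le _ _
    _ = _ := by
        rw [abs_mul, abs_of_pos hu0]
        field_simp
        ring

/-- The decay rate dominates |t|^α beyond R, and K absorbs |t| ≤ R. This serves integrability for
fixed b and ρ only; uniformity in them comes later. -/
theorem exists_norm_exp_centredExponent_le (hα0 : 0 < α) (hα1 : α < 1) {ρ : ℝ} (hρ : 0 < ρ) (b : ℝ) :
    ∃ K c : ℝ, 0 < c ∧ ∀ t : ℝ,
      ‖Complex.exp ((ρ ^ 2 : ℝ) * centredExponent α b t)‖ ≤ K * Real.exp (-c * |t| ^ α) := by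
  obtain ⟨c, hc, h⟩ := exists_rpow_le_decayRate hα0 hα1 one_pos le_rfl
  set R := 1 + max (-b) 0
  have hR : 0 < R := by have := le_max_right (-b) 0; positivity
  refine ⟨Real.exp (ρ ^ 2 * c * R ^ α), ρ ^ 2 * c, by positivity, fun t => ?_⟩
  rw [norm_exp_centredExponent hα1, ← Real.exp_add]
  gcongr
  rcases le_total R |t| with ht | ht
  · have h1 := h b t (by rw [one_mul]; exact ht)
    have : 0 ≤ ρ ^ 2 * c * R ^ α := by positivity
    have h2 : ρ ^ 2 * (c * |t| ^ α) ≤ ρ ^ 2 * decayRate α b t := by gcongr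
    linarith
  · have h1 : 0 ≤ decayRate α b t := integral_nonneg fun u => decayRate_integrand_nonneg b t u
    have h2 : ρ ^ 2 * c * |t| ^ α ≤ ρ ^ 2 * c * R ^ α := by gcongr
    have h3 : 0 ≤ ρ ^ 2 * decayRate α b t := by positivity
    linarith

theorem integrable_exp_centredExponent (hα0 : 0 < α) (hα1 : α < 1) {ρ : ℝ} (hρ : 0 < ρ) (b : ℝ) :
    Integrable (fun t : ℝ => Complex.exp ((ρ ^ 2 : ℝ) * centredExponent α b t)) := by
  obtain ⟨K, c, hc, h⟩ := exists_norm_exp_centredExponent_le hα0 hα1 hρ b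
  refine ((integrable_exp_neg_mul_abs_rpow hα0 hc).const_mul K).mono' ?_ (Filter.Eventually.of_forall h)
  have := measurable_centredExponent hα1 b
  exact Measurable.aestronglyMeasurable (by fun_prop)

/-- Edgeworth expansion for the centred exponent, with an error term for the tail. -/
theorem exists_centredExponent_bound {A : ℝ} (hA : 0 < A) :
    ∃ C D C' : ℝ, 0 < C ∧ 1 ≤ D ∧ 0 < C' ∧ ∀ α : ℝ, 0 < α → α < 1 → ∀ (κ : ℕ → ℝ) (ρ δ b : ℝ),
      0 < ρ → 0 < δ → (∀ n, 2 ≤ n → κ n = powerMoment α (n - 2) b) →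
      (∀ n, 3 ≤ n → κ n / n.factorial / (Real.sqrt (κ 2) ^ n * ρ ^ (n - 2)) ≤ (A * δ) ^ (n - 2)) →
      ∀ k : ℕ,
        (C' * (δ * Real.sqrt k) ≤ 1 →
          |Real.sqrt (κ 2) * Real.sqrt (2 * Real.pi) * edgeworthTerm κ ρ k - 1| ≤ 1 / 2) ∧
        ‖((1 / Real.sqrt (2 * Real.pi) : ℝ) : ℂ) * (((Real.sqrt (κ 2) * ρ : ℝ) : ℂ) *
            ∫ t : ℝ, Complex.exp ((ρ ^ 2 : ℝ) * centredExponent α b t)) -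
          ((Real.sqrt (κ 2) * Real.sqrt (2 * Real.pi) * edgeworthTerm κ ρ k : ℝ) : ℂ)‖ ≤
          C * D ^ k * (k : ℝ) ^ ((k : ℝ) / 2) * δ ^ (k + 1) +
            Real.sqrt (κ 2) * ρ * ∫ t in {t : ℝ | 1 < 8 * A * δ * (Real.sqrt (κ 2) * ρ) * |t|},
              Real.exp (-(ρ ^ 2 * decayRate α b t)) := by
  obtain ⟨C, D, C', hC, hD, hC', h⟩ := exists_edgeworth_bound hA
  refine ⟨C, D, C', hC, hD, hC', fun α hα0 hα1 κ ρ δ b hρ hδ hκ hA1 k => ?_⟩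
  have hκ2 : 0 < κ 2 := by rw [hκ 2 le_rfl]; exact powerMoment_zero_pos hα1 b
  have hκn : ∀ n, 2 ≤ n → 0 ≤ κ n := fun n hn => by rw [hκ n hn]; exact powerMoment_nonneg _ _
  set s := Real.sqrt (κ 2) with hs
  have hs0 : 0 < s := Real.sqrt_pos.2 hκ2
  have hs2 : s ^ 2 = κ 2 := Real.sq_sqrt hκ2.le
  have hsρ : 0 < s * ρ := by positivity
  have hk := h κ ρ δ hκ2 hδ (fun n hn => by
    rw [abs_of_nonneg (by have := hκn n (by omega); positivity)]; exact hA1 n hn) k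
  refine ⟨hk.1, ?_⟩
  -- The dilation t = x / (s ρ) makes the quadratic term of the exponent exactly -x²/2, which is
  -- split off from g.
  set g : ℝ → ℂ := fun x => (ρ ^ 2 : ℝ) * centredExponent α b (x / (s * ρ)) + (x : ℂ) ^ 2 / 2 with hg
  have hexp : ∀ x : ℝ, Complex.exp (-(x : ℂ) ^ 2 / 2 + g x) =
      Complex.exp ((ρ ^ 2 : ℝ) * centredExponent α b (x / (s * ρ))) := by
    intro x; congr 1; simp only [hg]; ring
  have hgb : ∀ (N : ℕ) (x : ℝ), ‖g x - ∑ n ∈ Finset.Icc 3 (N + 2), cumulantTerm κ ρ x n‖ ≤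
      x ^ 2 * (A * δ * |x|) ^ (N + 1) := by
    intro N x
    have h1 := norm_centredExponent_sub_sum_le hα1 b (x / (s * ρ)) N
    have hterm : ∀ n, 2 ≤ n → ((ρ ^ 2 : ℝ) : ℂ) * (((powerMoment α (n - 2) b / n.factorial : ℝ) : ℂ) *
        (Complex.I * ((x / (s * ρ) : ℝ) : ℂ)) ^ n) = cumulantTerm κ ρ x n := by
      intro n hn
      obtain ⟨m, rfl⟩ : ∃ m, n = m + 2 := ⟨n - 2, by omega⟩
      have e1 : (Complex.I * ((x / (s * ρ) : ℝ) : ℂ)) ^ (m + 2) =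
          ((1 / (s * ρ) ^ (m + 2) : ℝ) : ℂ) * (Complex.I * x) ^ (m + 2) := by
        push_cast
        rw [← one_div_pow, ← mul_pow]; congr 1; ring
      rw [cumulantTerm, hκ (m + 2) hn, e1, ← hs, ← mul_assoc, ← mul_assoc, ← Complex.ofReal_mul,
        ← Complex.ofReal_mul, Nat.add_sub_cancel]
      congr 2
      field_simp
      ring
    have h2 : g x - ∑ n ∈ Finset.Icc 3 (N + 2), cumulantTerm κ ρ x n =
        ((ρ ^ 2 : ℝ) : ℂ) * (centredExponent α b (x / (s * ρ)) - ∑ n ∈ Finset.Icc 2 (N + 2),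
        ((powerMoment α (n - 2) b / n.factorial : ℝ) : ℂ) *
          (Complex.I * ((x / (s * ρ) : ℝ) : ℂ)) ^ n) := by
      rw [mul_sub, Finset.mul_sum, Finset.sum_congr rfl fun n hn => hterm n (Finset.mem_Icc.1 hn).1,
        ← Finset.add_sum_Ioc_eq_sum_Icc (by omega : 2 ≤ N + 2)]
      have h3 : cumulantTerm κ ρ x 2 = -(x : ℂ) ^ 2 / 2 := by
        rw [cumulantTerm, ← hs, hs2, mul_pow, Complex.I_sq]
        have : (κ 2 : ℂ) ≠ 0 := by exact_mod_cast hκ2.ne'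
        simp
        field_simp
      have h4 : Finset.Ioc 2 (N + 2) = Finset.Icc 3 (N + 2) := by ext; simp; omega
      rw [h3, h4]
      simp only [hg]
      ring
    -- The Taylor remainder has as coefficient the normalised cumulant of order N + 3, which the
    -- hypothesis bounds by (A δ)^(N+1).
    rw [h2, norm_mul, Complex.norm_real, Real.norm_of_nonneg (by positivity)]
    calc _ ≤ ρ ^ 2 * (|x / (s * ρ)| ^ (N + 3) / (N + 3).factorial * powerMoment α (N + 1) b) := by
          gcongr
      _ = (κ (N + 3) / (N + 3).factorial / (s ^ (N + 3) * ρ ^ (N + 1))) * |x| ^ (N + 3) := by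
          rw [hκ (N + 3) (by omega), abs_div, abs_of_pos hsρ, show N + 3 - 2 = N + 1 by omega, div_pow, mul_pow]
          field_simp
          ring
      _ ≤ (A * δ) ^ (N + 1) * |x| ^ (N + 3) := by
          gcongr; exact hA1 (N + 3) (by omega)
      _ = _ := by
          rw [show N + 3 = (N + 1) + 2 by ring, pow_add |x|, sq_abs, mul_pow]; ring
  have hint : Integrable (fun x : ℝ => Complex.exp (-(x : ℂ) ^ 2 / 2 + g x)) := by
    simp_rw [hexp]
    exact (integrable_exp_centredExponent hα0 hα1 hρ b).comp_div hsρ.ne'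
  have hfin := hk.2 g hgb hint
  simp_rw [hexp] at hfin
  have hsub := Measure.integral_comp_div
    (fun t : ℝ => Complex.exp ((ρ ^ 2 : ℝ) * centredExponent α b t)) (s * ρ)
  rw [hsub, abs_of_pos hsρ, Complex.real_smul] at hfin
  refine hfin.trans (le_of_eq ?_)
  congr 1
  have hm1 : MeasurableSet {x : ℝ | 1 < 8 * A * δ * |x|} :=
    measurableSet_lt measurable_const (by fun_prop)
  have hm2 : MeasurableSet {t : ℝ | 1 < 8 * A * δ * (s * ρ) * |t|} :=
    measurableSet_lt measurable_const (by fun_prop)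
  rw [← integral_indicator hm1, ← integral_indicator hm2]
  have hsub2 := Measure.integral_comp_div (fun t : ℝ => {t : ℝ | 1 < 8 * A * δ * (s * ρ) * |t|}.indicator
    (fun t => Real.exp (-(ρ ^ 2 * decayRate α b t))) t) (s * ρ)
  rw [abs_of_pos hsρ, smul_eq_mul] at hsub2
  rw [← hsub2]
  congr 1; ext x
  simp only [indicator, mem_ofPred_eq]
  rw [norm_exp_centredExponent hα1]
  have : 8 * A * δ * (s * ρ) * |x / (s * ρ)| = 8 * A * δ * |x| := by
    rw [abs_div, abs_of_pos hsρ]; field_simp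
  rw [this]

end Exponent

/-! ### Uniform expansions for right and left tilting -/

section Expansion

variable {α : ℝ}

/-- The exponent is halved. One half absorbs ρ^(k+2) and creates k^(k/2). The other absorbs s^(k+2)
at merely geometric cost, because k + 2 ≤ 3 ρ²; hence uniformity in s. -/
theorem exists_mul_pow_mul_exp_le {c : ℝ} (hc : 0 < c) :
    ∃ C D : ℝ, 0 < C ∧ 1 ≤ D ∧ ∀ (k : ℕ) (s ρ : ℝ), 1 ≤ s → 1 ≤ ρ → Real.sqrt k ≤ ρ →
      (s * ρ) ^ (k + 2) * Real.exp (-(c * (ρ ^ 2 * s))) ≤ C * D ^ k * (k : ℝ) ^ ((k : ℝ) / 2) := by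
  obtain ⟨C, D, hC, hD, h⟩ := exists_pow_le_exp_sq (Q := c / 2) (by positivity)
  set M := max 1 (6 / c) with hM
  have hM1 : 1 ≤ M := le_max_left _ _
  refine ⟨C * M ^ 2, D * M, by positivity, by nlinarith, fun k s ρ hs hρ hk => ?_⟩
  have hρ0 : 0 < ρ := by linarith
  have hs0 : 0 < s := by linarith
  have h1 := (h k ρ hρ0.le).2
  have h2 : (k : ℝ) ≤ ρ ^ 2 := by
    rw [← Real.sqrt_le_left hρ0.le]; exact hk
  have h3 : s ^ (k + 2) ≤ M ^ (k + 2) * Real.exp (c / 2 * (ρ ^ 2 * s)) := by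
    have h4 : s ≤ M * Real.exp (c * s / 6) := by
      have := Real.add_one_le_exp (c * s / 6)
      calc s = 6 / c * (c * s / 6) := by field_simp
        _ ≤ M * Real.exp (c * s / 6) := by
          gcongr
          · exact le_max_right _ _
          · linarith
    calc s ^ (k + 2) ≤ (M * Real.exp (c * s / 6)) ^ (k + 2) := by gcongr
      _ = M ^ (k + 2) * Real.exp ((k + 2) * (c * s / 6)) := by
        rw [mul_pow, ← Real.exp_nat_mul]; push_cast; rfl
      _ ≤ _ := by
        have h5 : (k + 2 : ℝ) ≤ 3 * ρ ^ 2 := by nlinarith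
        refine mul_le_mul_of_nonneg_left (Real.exp_le_exp.2 ?_) (by positivity)
        calc (k + 2 : ℝ) * (c * s / 6) ≤ (3 * ρ ^ 2) * (c * s / 6) := by gcongr
          _ = _ := by ring
  calc (s * ρ) ^ (k + 2) * Real.exp (-(c * (ρ ^ 2 * s)))
      = s ^ (k + 2) * ρ ^ (k + 2) * Real.exp (-(c * (ρ ^ 2 * s))) := by rw [mul_pow]
    _ ≤ (M ^ (k + 2) * Real.exp (c / 2 * (ρ ^ 2 * s))) *
        (C * D ^ k * (k : ℝ) ^ ((k : ℝ) / 2) * Real.exp (c / 2 * ρ ^ 2)) *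
        Real.exp (-(c * (ρ ^ 2 * s))) := by gcongr
    _ = (C * M ^ 2) * (D * M) ^ k * (k : ℝ) ^ ((k : ℝ) / 2) * (Real.exp (c / 2 * (ρ ^ 2 * s)) *
        Real.exp (c / 2 * ρ ^ 2) * Real.exp (-(c * (ρ ^ 2 * s)))) := by
      rw [mul_pow D]; ring
    _ ≤ (C * M ^ 2) * (D * M) ^ k * (k : ℝ) ^ ((k : ℝ) / 2) * 1 := by
      gcongr
      rw [← Real.exp_add, ← Real.exp_add, Real.exp_le_one_iff]
      have : c * ρ ^ 2 * 1 ≤ c * ρ ^ 2 * s := by gcongr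
      nlinarith
    _ = _ := mul_one _

/-- Separates the two uses of a lower bound on the exponent: |t|^α for integrability, and T for
smallness. -/
theorem setIntegral_exp_neg_le (hα0 : 0 < α) {c T : ℝ} (hc : 0 < c) {S : Set ℝ}
    (hS : MeasurableSet S) {J : ℝ → ℝ} (hJ : ∀ t ∈ S, c * |t| ^ α + T ≤ J t) :
    ∫ t in S, Real.exp (-J t) ≤ (∫ t : ℝ, Real.exp (-c * |t| ^ α)) * Real.exp (-T) := by
  have hi := (integrable_exp_neg_mul_abs_rpow hα0 hc).mul_const (Real.exp (-T))
  rw [← integral_mul_const]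
  refine le_trans (integral_mono_of_nonneg (Filter.Eventually.of_forall fun t => (Real.exp_pos _).le)
    hi.integrableOn ?_) (setIntegral_le_integral hi
      (Filter.Eventually.of_forall fun t => by simp only [Pi.zero_apply]; positivity))
  filter_upwards [ae_restrict_mem hS] with t ht
  rw [← Real.exp_add]
  gcongr
  linarith [hJ t ht]

/-- Expansion for tilting to the right. -/
theorem exists_right_expansion (hα0 : 0 < α) (hα1 : α < 1) :
    ∃ C₂ C₃ C₄ : ℝ, 0 < C₂ ∧ 0 < C₃ ∧ 0 < C₄ ∧ ∀ (κ : ℕ → ℝ) (ρ b : ℝ), 1 ≤ ρ → 0 ≤ b →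
      (∀ n, 2 ≤ n → κ n = powerMoment α (n - 2) b) → ∀ k : ℕ, C₄ * Real.sqrt k ≤ ρ →
        |Real.sqrt (κ 2) * Real.sqrt (2 * Real.pi) * edgeworthTerm κ ρ k - 1| ≤ 1 / 2 ∧
        ‖((1 / Real.sqrt (2 * Real.pi) : ℝ) : ℂ) * (((Real.sqrt (κ 2) * ρ : ℝ) : ℂ) *
            ∫ t : ℝ, Complex.exp ((ρ ^ 2 : ℝ) * centredExponent α b t)) -
          ((Real.sqrt (κ 2) * Real.sqrt (2 * Real.pi) * edgeworthTerm κ ρ k : ℝ) : ℂ)‖ ≤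
          C₂ * C₃ ^ k * (k : ℝ) ^ ((k : ℝ) / 2) / (Real.sqrt (κ 2) * ρ) ^ (k + 1) := by
  obtain ⟨C, D, C', hC, hD, hC', h⟩ := exists_centredExponent_bound one_pos
  -- With A = 1 and δ = 1 / (s ρ) the tail set is |t| > 1/8, whence both thresholds.
  obtain ⟨c₁, hc₁, hJ₁⟩ := exists_rpow_le_decayRate hα0 hα1 (c₁ := 1 / 8) (by norm_num) (by norm_num)
  obtain ⟨c₂, hc₂, hJ₂⟩ := exists_exp_le_decayRate hα0 hα1 (c₀ := 1 / 8) (by norm_num)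
  obtain ⟨C₀, D₀, hC₀, hD₀, hT⟩ := exists_mul_pow_mul_exp_le (c := c₂ / 2) (by positivity)
  set I := ∫ t : ℝ, Real.exp (-(c₁ / 2) * |t| ^ α) with hI
  have hI0 : 0 ≤ I := integral_nonneg fun t => (Real.exp_pos _).le
  refine ⟨C + I * C₀, D * D₀, max C' 1, by positivity, by positivity, by positivity,
    fun κ ρ b hρ hb hκ k hk => ?_⟩
  have hρ0 : 0 < ρ := by linarith
  have hκ2 : κ 2 = powerMoment α 0 b := hκ 2 le_rfl
  have hκ1 : 1 ≤ κ 2 := by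
    rw [hκ2, ← powerMoment_zero_zero hα1]; exact powerMoment_zero_mono hα1 hb
  set s := Real.sqrt (κ 2) with hs
  have hs1 : 1 ≤ s := by rw [hs, Real.one_le_sqrt]; exact hκ1
  have hs0 : 0 < s := by linarith
  have hs2 : s ^ 2 = κ 2 := Real.sq_sqrt (by linarith)
  have hsρ : 0 < s * ρ := by positivity
  -- Since κ₂ ≤ exp b, the lower bound c₂ exp(b / 2) for the decay rate may be replaced by c₂ s.
  have hse : s ≤ Real.exp (b / 2) := by
    rw [hs, Real.sqrt_le_left (Real.exp_pos _).le, ← Real.exp_nat_mul, hκ2]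
    refine (powerMoment_zero_le_exp hα1 hb).trans (le_of_eq ?_)
    congr 1; push_cast; ring
  have hk1 : Real.sqrt k ≤ ρ := le_trans
    (le_mul_of_one_le_left (Real.sqrt_nonneg _) (le_max_right C' 1)) hk
  have hkC : C' * Real.sqrt k ≤ ρ := le_trans
    (mul_le_mul_of_nonneg_right (le_max_left C' 1) (Real.sqrt_nonneg _)) hk
  -- All moments are at most κ₂ = s² because u ≤ 1, so A = 1 suffices.
  obtain ⟨hE1, hE2⟩ := h α hα0 hα1 κ ρ (1 / (s * ρ)) b hρ0 (by positivity) hκ (fun n hn => by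
    obtain ⟨m, rfl⟩ : ∃ m, n = m + 2 := ⟨n - 2, by omega⟩
    rw [Nat.add_sub_cancel, one_mul]
    have h1 : κ (m + 2) ≤ s ^ 2 := by
      rw [hs2, hκ2, hκ _ (by omega), Nat.add_sub_cancel]; exact powerMoment_le hα1 m b
    have h2 : κ (m + 2) / (m + 2).factorial ≤ s ^ 2 := by
      rw [div_le_iff₀ (by positivity)]
      have : (1 : ℝ) ≤ (m + 2).factorial := by exact_mod_cast (m + 2).factorial_pos
      nlinarith [sq_nonneg s]
    calc _ ≤ s ^ 2 / (s ^ (m + 2) * ρ ^ m) := by gcongr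
      _ = _ := by rw [div_pow, mul_pow, pow_add, one_pow]; field_simp) k
  refine ⟨hE1 ?_, hE2.trans ?_⟩
  · rw [div_mul_eq_mul_div, one_mul, mul_div_assoc', div_le_one hsρ]
    nlinarith
  have hset : MeasurableSet {t : ℝ | 1 < 8 * 1 * (1 / (s * ρ)) * (s * ρ) * |t|} :=
    measurableSet_lt measurable_const (by fun_prop)
  -- The average of the two lower bounds is used: half of c₁ |t|^α for convergence, half of c₂ s for
  -- smallness.
  have htail := setIntegral_exp_neg_le (α := α) hα0 (c := c₁ / 2) (T := c₂ / 2 * (ρ ^ 2 * s))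
    (by positivity) hset (J := fun t => ρ ^ 2 * decayRate α b t) (fun t ht => by
      have ht' : 1 / 8 ≤ |t| := by
        have ht : 1 < 8 * 1 * (1 / (s * ρ)) * (s * ρ) * |t| := ht
        rw [mul_assoc (8 * 1 : ℝ), one_div_mul_cancel hsρ.ne'] at ht
        linarith
      have h1 := hJ₁ b t (by rw [max_eq_right (by linarith)]; linarith)
      have h2 := hJ₂ b t hb ht'
      have h3 : c₂ * s ≤ decayRate α b t := le_trans (by gcongr) h2
      have h4 : 0 ≤ c₁ * |t| ^ α := by positivity
      have h5 : 1 ≤ ρ ^ 2 := one_le_pow₀ hρ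
      nlinarith)
  have hfin := hT k s ρ hs1 hρ hk1
  rw [← hI] at htail
  calc _ ≤ C * D ^ k * (k : ℝ) ^ ((k : ℝ) / 2) * (1 / (s * ρ)) ^ (k + 1) +
        s * ρ * (I * Real.exp (-(c₂ / 2 * (ρ ^ 2 * s)))) := by gcongr
    _ = (C * D ^ k * (k : ℝ) ^ ((k : ℝ) / 2) +
        I * ((s * ρ) ^ (k + 2) * Real.exp (-(c₂ / 2 * (ρ ^ 2 * s))))) / (s * ρ) ^ (k + 1) := by
      rw [one_div_pow, pow_succ (s * ρ) (k + 1)]; field_simp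
    _ ≤ (C * (D * D₀) ^ k * (k : ℝ) ^ ((k : ℝ) / 2) +
        I * (C₀ * (D * D₀) ^ k * (k : ℝ) ^ ((k : ℝ) / 2))) / (s * ρ) ^ (k + 1) := by
      have h1 : D ≤ D * D₀ := by nlinarith
      have h2 : D₀ ≤ D * D₀ := by nlinarith
      have h3 : C * D ^ k * (k : ℝ) ^ ((k : ℝ) / 2) ≤
          C * (D * D₀) ^ k * (k : ℝ) ^ ((k : ℝ) / 2) := by gcongr
      have h4 : C₀ * D₀ ^ k * (k : ℝ) ^ ((k : ℝ) / 2) ≤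
          C₀ * (D * D₀) ^ k * (k : ℝ) ^ ((k : ℝ) / 2) := by gcongr
      exact div_le_div_of_nonneg_right
        (add_le_add h3 (mul_le_mul_of_nonneg_left (hfin.trans h4) hI0)) (by positivity)
    _ = _ := by ring

set_option maxHeartbeats 1000000 in
/-- Expansion for tilting to the left. -/
theorem exists_left_expansion (hα0 : 0 < α) (hα1 : α < 1) :
    ∃ C₂ C₃ C₄ : ℝ, 0 < C₂ ∧ 0 < C₃ ∧ 0 < C₄ ∧ ∀ (κ : ℕ → ℝ) (ρ b : ℝ), 1 ≤ ρ → b ≤ 0 →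
      (∀ n, 2 ≤ n → κ n = powerMoment α (n - 2) b) → ∀ k : ℕ, C₄ * Real.sqrt k ≤ ρ →
        |Real.sqrt (κ 2) * Real.sqrt (2 * Real.pi) * edgeworthTerm κ ρ k - 1| ≤ 1 / 2 ∧
        ‖((1 / Real.sqrt (2 * Real.pi) : ℝ) : ℂ) * (((Real.sqrt (κ 2) * ρ : ℝ) : ℂ) *
            ∫ t : ℝ, Complex.exp ((ρ ^ 2 : ℝ) * centredExponent α b t)) -
          ((Real.sqrt (κ 2) * Real.sqrt (2 * Real.pi) * edgeworthTerm κ ρ k : ℝ) : ℂ)‖ ≤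
          C₂ * C₃ ^ k * (k : ℝ) ^ ((k : ℝ) / 2) *
            (κ 2 ^ (1 / (2 - α) - 1 / 2) / ρ) ^ (k + 1) := by
  obtain ⟨B, hB, hM⟩ := exists_powerMoment_neg_le hα0 hα1
  set e := Real.exp 1 with he
  have he1 : 1 ≤ e := Real.one_le_exp zero_le_one
  -- The factor 2 e comes from 2 / (1 + a) ≤ 2 e q. The remaining B e is a prefactor, at least 1,
  -- that can be raised to the power n - 2 ≥ 1.
  set A := 2 * B * e ^ 2 with hA
  have hA0 : 0 < A := by positivity
  have hA1 : 1 ≤ A := by nlinarith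
  obtain ⟨C, D, C', hC, hD, hC', h⟩ := exists_centredExponent_bound hA0
  -- On the tail set |t| > 1 / (8 A q), and q ≤ B / (1 + a), so |t| exceeds (1 + a) / (8 A B), the
  -- range where decay of order |t|^α holds.
  obtain ⟨c₁, hc₁, hJ₁⟩ := exists_rpow_le_decayRate hα0 hα1 (c₁ := 1 / (8 * A * B)) (by positivity)
    (by rw [div_le_one (by positivity)]; nlinarith)
  set c₂ := c₁ / 2 * (8 * A) ^ (-α) with hc₂
  obtain ⟨C₀, D₀, hC₀, hD₀, hT⟩ := exists_pow_le_exp_sq (Q := c₂) (by positivity)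
  set I := ∫ t : ℝ, Real.exp (-(c₁ / 2) * |t| ^ α) with hI
  have hI0 : 0 ≤ I := integral_nonneg fun t => (Real.exp_pos _).le
  refine ⟨C + I * C₀, D * D₀, C', by positivity, by positivity, by positivity,
    fun κ ρ b hρ hb hκ k hk => ?_⟩
  obtain ⟨a, rfl⟩ : ∃ a, b = -a := ⟨-b, by ring⟩
  have ha : 0 ≤ a := by linarith
  have hρ0 : 0 < ρ := by linarith
  have hκ2 : κ 2 = powerMoment α 0 (-a) := hκ 2 le_rfl
  have hκ0 : 0 < κ 2 := by rw [hκ2]; exact powerMoment_zero_pos hα1 _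
  have hκ1 : κ 2 ≤ 1 := by
    rw [hκ2, ← powerMoment_zero_zero hα1]; exact powerMoment_zero_mono hα1 hb
  set s := Real.sqrt (κ 2) with hs
  have hs0 : 0 < s := Real.sqrt_pos.2 hκ0
  have hs2 : s ^ 2 = κ 2 := Real.sq_sqrt hκ0.le
  have hp : 0 < 2 - α := by linarith
  have hp1 : 1 / (2 - α) ≤ 1 := by rw [div_le_one hp]; linarith
  -- Up to constants κ₂ is (1 + a)^(-(2 - α)), so q is comparable to 1 / (1 + a), the scale of u
  -- under left tilting. Below, δ is chosen with s ρ δ = q.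
  set q := κ 2 ^ (1 / (2 - α)) with hq
  have hq0 : 0 < q := by positivity
  have hq1 : q ≤ 1 := Real.rpow_le_one hκ0.le hκ1 (by positivity)
  set δ := κ 2 ^ (1 / (2 - α) - 1 / 2) / ρ with hδ
  have hδ0 : 0 < δ := by positivity
  have hqδ : s * ρ * δ = q := by
    rw [hδ, hs, hq, Real.sqrt_eq_rpow, Real.rpow_sub hκ0]; field_simp
  have hδρ : δ ≤ 1 / ρ := by
    rw [hδ]; gcongr
    refine Real.rpow_le_one hκ0.le hκ1 ?_
    rw [sub_nonneg]
    exact one_div_le_one_div_of_le hp (by linarith)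
  have hroot : ((1 + a) ^ (-(2 - α))) ^ (1 / (2 - α)) = (1 + a)⁻¹ := by
    rw [← Real.rpow_mul (by positivity), neg_mul, mul_one_div_cancel hp.ne', Real.rpow_neg_one]
  have hlow : (1 + a) ^ (-(2 - α)) ≤ e * κ 2 := by
    have := le_powerMoment_zero_neg hα1 ha
    rw [← hκ2, Real.exp_neg, ← he, inv_mul_le_iff₀ (by positivity)] at this
    exact this
  have hup : κ 2 ≤ B * (1 + a) ^ (-(2 - α)) := by
    have := hM 0 a ha
    rw [← hκ2] at this
    simpa using this
  have hqlow : (1 + a)⁻¹ ≤ e * q := by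
    rw [← hroot]
    calc _ ≤ (e * κ 2) ^ (1 / (2 - α)) := by gcongr
      _ = e ^ (1 / (2 - α)) * q := Real.mul_rpow (by positivity) hκ0.le
      _ ≤ e ^ (1 : ℝ) * q := by gcongr
      _ = _ := by rw [Real.rpow_one]
  have hqup : q ≤ B * (1 + a)⁻¹ := by
    rw [← hroot]
    calc q ≤ (B * (1 + a) ^ (-(2 - α))) ^ (1 / (2 - α)) := by rw [hq]; gcongr
      _ = B ^ (1 / (2 - α)) * ((1 + a) ^ (-(2 - α))) ^ (1 / (2 - α)) :=
        Real.mul_rpow (by positivity) (by positivity)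
      _ ≤ B ^ (1 : ℝ) * ((1 + a) ^ (-(2 - α))) ^ (1 / (2 - α)) := by gcongr
      _ = _ := by rw [Real.rpow_one]
  obtain ⟨hE1, hE2⟩ := h α hα0 hα1 κ ρ δ (-a) hρ0 hδ0 hκ (fun n hn => by
    obtain ⟨m, rfl⟩ : ∃ m, n = m + 3 := ⟨n - 3, by omega⟩
    rw [show m + 3 - 2 = m + 1 by omega]
    have h1 : κ (m + 3) ≤ s ^ 2 * (m + 3).factorial * (A * q) ^ (m + 1) := by
      calc κ (m + 3) ≤ B * (m + 1).factorial * (2 / (1 + a)) ^ (m + 1) * (1 + a) ^ (-(2 - α)) := by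
            rw [hκ _ (by omega), show m + 3 - 2 = m + 1 by omega]; exact hM (m + 1) a ha
        _ ≤ (B * e) * (m + 3).factorial * (2 * (e * q)) ^ (m + 1) * κ 2 := by
            have hf : ((m + 1).factorial : ℝ) ≤ (m + 3).factorial := by
              exact_mod_cast Nat.factorial_le (by omega)
            calc _ ≤ B * (m + 3).factorial * (2 * (e * q)) ^ (m + 1) * (e * κ 2) := by
                  rw [div_eq_mul_inv]; gcongr
              _ = _ := by ring
        _ ≤ (B * e) ^ (m + 1) * (m + 3).factorial * (2 * (e * q)) ^ (m + 1) * κ 2 := by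
            gcongr
            exact le_self_pow₀ (by nlinarith) (by omega)
        _ = _ := by
            rw [hs2, hA, show 2 * B * e ^ 2 * q = (B * e) * (2 * (e * q)) by ring,
              mul_pow (B * e)]; ring
    calc _ ≤ s ^ 2 * (m + 3).factorial * (A * q) ^ (m + 1) / (m + 3).factorial /
          (s ^ (m + 3) * ρ ^ (m + 1)) := by gcongr
      _ = _ := by
          rw [← hqδ, show A * (s * ρ * δ) = (A * δ) * s * ρ by ring, mul_pow, mul_pow,
            show m + 3 = (m + 1) + 2 by ring, pow_add s (m + 1)]
          field_simp) k
  refine ⟨hE1 ?_, hE2.trans ?_⟩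
  · calc C' * (δ * Real.sqrt k) ≤ C' * (1 / ρ * Real.sqrt k) := by gcongr
      _ = C' * Real.sqrt k / ρ := by ring
      _ ≤ 1 := by rw [div_le_one hρ0]; exact hk
  have hset : MeasurableSet {t : ℝ | 1 < 8 * A * δ * (s * ρ) * |t|} :=
    measurableSet_lt measurable_const (by fun_prop)
  have htail := setIntegral_exp_neg_le (α := α) hα0 (c := c₁ / 2) (T := c₂ * (1 / δ) ^ 2)
    (by positivity) hset (J := fun t => ρ ^ 2 * decayRate α (-a) t) (fun t ht => by
      have ht : 1 < 8 * A * δ * (s * ρ) * |t| := ht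
      rw [show 8 * A * δ * (s * ρ) * |t| = 8 * A * (s * ρ * δ) * |t| by ring, hqδ] at ht
      have ht0 : 0 < |t| := by
        by_contra h0
        have : |t| = 0 := le_antisymm (not_lt.1 h0) (abs_nonneg t)
        rw [this, mul_zero] at ht; linarith
      have h1 := hJ₁ (-a) t (by
        rw [neg_neg, max_eq_left ha, div_mul_eq_mul_div, one_mul, div_le_iff₀ (by positivity)]
        have h2 : 8 * A * q * |t| ≤ 8 * A * (B * (1 + a)⁻¹) * |t| := by gcongr
        have h3 : 1 ≤ 8 * A * (B * (1 + a)⁻¹) * |t| := by linarith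
        calc 1 + a = 1 * (1 + a) := by ring
          _ ≤ (8 * A * (B * (1 + a)⁻¹) * |t|) * (1 + a) := by gcongr
          _ = _ := by field_simp)
      -- By the choice of exponents (1 / δ)² = ρ² q^(-α), so decay of order |t|^α beyond 1 / (8 A q)
      -- becomes exp(-c₂ / δ²).
      have h2 : (8 * A) ^ (-α) * (1 / δ) ^ 2 ≤ ρ ^ 2 * |t| ^ α := by
        have h3 : (1 / δ) ^ 2 = ρ ^ 2 * q ^ (-α) := by
          rw [hδ, hq, ← Real.rpow_mul hκ0.le, one_div_div, div_pow, div_eq_mul_inv, ← Real.rpow_natCast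
            (κ 2 ^ (1 / (2 - α) - 1 / 2)), ← Real.rpow_mul hκ0.le, ← Real.rpow_neg hκ0.le]
          congr 2
          push_cast
          field_simp
          ring
        rw [h3]
        calc (8 * A) ^ (-α) * (ρ ^ 2 * q ^ (-α)) = ρ ^ 2 * (8 * A * q) ^ (-α) := by
              rw [Real.mul_rpow (by positivity) hq0.le]; ring
          _ = ρ ^ 2 * ((8 * A * q)⁻¹) ^ α := by
              rw [Real.inv_rpow (by positivity), Real.rpow_neg (by positivity)]
          _ ≤ ρ ^ 2 * |t| ^ α := by
              gcongr
              rw [inv_le_iff_one_le_mul₀ (by positivity)]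
              linarith
      have h5 : 1 ≤ ρ ^ 2 := one_le_pow₀ hρ
      have h6 : 0 ≤ |t| ^ α := by positivity
      have h7 : ρ ^ 2 * (c₁ * |t| ^ α) ≤ ρ ^ 2 * decayRate α (-a) t := by gcongr
      have h8 : c₂ * (1 / δ) ^ 2 ≤ c₁ / 2 * (ρ ^ 2 * |t| ^ α) := by
        rw [hc₂, mul_assoc]; gcongr
      have h9 : c₁ / 2 * |t| ^ α * 1 ≤ c₁ / 2 * |t| ^ α * ρ ^ 2 := by gcongr
      nlinarith)
  have hfin := (hT k (1 / δ) (by positivity)).2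
  rw [← hI] at htail
  -- The prefactor s ρ of the tail costs one more power of 1 / δ, hence k + 2 in the power bound.
  have hsρ : s * ρ ≤ 1 / δ := by rw [le_div_iff₀ hδ0, hqδ]; exact hq1
  have hexp : 1 / δ * Real.exp (-(c₂ * (1 / δ) ^ 2)) ≤
      C₀ * D₀ ^ k * (k : ℝ) ^ ((k : ℝ) / 2) * δ ^ (k + 1) := by
    rw [Real.exp_neg, ← div_eq_mul_inv, div_le_iff₀ (Real.exp_pos _)]
    calc 1 / δ = (1 / δ) ^ (k + 2) * δ ^ (k + 1) := by
          rw [one_div_pow, pow_succ δ (k + 1)]; field_simp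
      _ ≤ (C₀ * D₀ ^ k * (k : ℝ) ^ ((k : ℝ) / 2) * Real.exp (c₂ * (1 / δ) ^ 2)) * δ ^ (k + 1) := by
          gcongr
      _ = _ := by ring
  calc _ ≤ C * D ^ k * (k : ℝ) ^ ((k : ℝ) / 2) * δ ^ (k + 1) +
        1 / δ * (I * Real.exp (-(c₂ * (1 / δ) ^ 2))) := by gcongr
    _ = C * D ^ k * (k : ℝ) ^ ((k : ℝ) / 2) * δ ^ (k + 1) +
        I * (1 / δ * Real.exp (-(c₂ * (1 / δ) ^ 2))) := by ring
    _ ≤ C * (D * D₀) ^ k * (k : ℝ) ^ ((k : ℝ) / 2) * δ ^ (k + 1) +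
        I * (C₀ * (D * D₀) ^ k * (k : ℝ) ^ ((k : ℝ) / 2) * δ ^ (k + 1)) := by
      have h1 : D ≤ D * D₀ := by nlinarith
      have h2 : D₀ ≤ D * D₀ := by nlinarith
      have h3 : C * D ^ k * (k : ℝ) ^ ((k : ℝ) / 2) * δ ^ (k + 1) ≤
          C * (D * D₀) ^ k * (k : ℝ) ^ ((k : ℝ) / 2) * δ ^ (k + 1) := by gcongr
      have h4 : C₀ * D₀ ^ k * (k : ℝ) ^ ((k : ℝ) / 2) * δ ^ (k + 1) ≤
          C₀ * (D * D₀) ^ k * (k : ℝ) ^ ((k : ℝ) / 2) * δ ^ (k + 1) := by gcongr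
      exact add_le_add h3 (mul_le_mul_of_nonneg_left (hexp.trans h4) hI0)
    _ = _ := by ring

end Expansion

/-! ### Ordered radii and counts in shells -/

section Radii

variable {Ω : Type*} {d : ℕ} {Φ : Ω → Set (EuclideanSpace ℝ (Fin d))} {ω : Ω}

theorem count_closedBall_mono {x y : ℝ} (h : x ≤ y) :
    count Φ (Metric.closedBall 0 x) ω ≤ count Φ (Metric.closedBall 0 y) ω :=
  encard_le_encard (inter_subset_inter_right _ (Metric.closedBall_subset_closedBall h))

/-- The infimum in the definition of the radius is attained. -/
theorem le_count_closedBall_radius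
    (hfin : ∀ x : ℝ, (Φ ω ∩ Metric.closedBall 0 x).Finite) {k : ℕ}
    (hne : ∃ x : ℝ, 0 ≤ x ∧ (k : ℕ∞) ≤ count Φ (Metric.closedBall 0 x) ω) :
    (k : ℕ∞) ≤ count Φ (Metric.closedBall 0 (radius Φ k ω)) ω := by
  set R := radius Φ k ω with hR
  have hF : (Φ ω ∩ Metric.closedBall 0 (R + 1) ∩ {p | R < ‖p‖}).Finite :=
    (hfin (R + 1)).subset inter_subset_left
  -- Finitely many points of the ball of radius R + 1 lie beyond R, so a slightly larger ball meets
  -- no new point.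
  have hev : ∀ᶠ x in nhds R, ∀ p ∈ Φ ω ∩ Metric.closedBall 0 (R + 1) ∩ {p | R < ‖p‖}, x < ‖p‖ :=
    (Filter.eventually_all_finite hF).2 fun p hp => Iio_mem_nhds hp.2
  obtain ⟨ε, hε, hball⟩ := Metric.eventually_nhds_iff.1 hev
  obtain ⟨x, ⟨hx0, hxk⟩, hx⟩ := exists_lt_of_csInf_lt (s := {x : ℝ | 0 ≤ x ∧
    (k : ℕ∞) ≤ count Φ (Metric.closedBall 0 x) ω}) hne
    (show sInf _ < R + min ε 1 by
      have : 0 < min ε 1 := by positivity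
      change R < _
      linarith)
  have hRx : R ≤ x := csInf_le ⟨0, fun y hy => hy.1⟩ ⟨hx0, hxk⟩
  refine hxk.trans (encard_le_encard fun p hp => ⟨hp.1, ?_⟩)
  rw [mem_closedBall_zero_iff]
  by_contra hlt
  have hpx := mem_closedBall_zero_iff.1 hp.2
  have h1 := min_le_left ε 1
  have h2 := min_le_right ε 1
  have := hball (y := x) (by rw [Real.dist_eq, abs_of_nonneg (by linarith)]; linarith) p
    ⟨⟨hp.1, mem_closedBall_zero_iff.2 (by linarith)⟩, not_le.1 hlt⟩
  linarith

theorem radius_mem_Ioc_iff (hfin : ∀ x : ℝ, (Φ ω ∩ Metric.closedBall 0 x).Finite) {k : ℕ}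
    {a b : ℝ} (ha : 0 ≤ a) (hb : 0 ≤ b) :
    radius Φ k ω ∈ Ioc a b ↔ count Φ (Metric.closedBall 0 a) ω < k ∧
      (k : ℕ∞) ≤ count Φ (Metric.closedBall 0 b) ω := by
  have hle : ∀ x : ℝ, 0 ≤ x → (k : ℕ∞) ≤ count Φ (Metric.closedBall 0 x) ω →
      radius Φ k ω ≤ x := fun x hx hk => csInf_le ⟨0, fun y hy => hy.1⟩ ⟨hx, hk⟩
  constructor
  · rintro ⟨h1, h2⟩
    have hne : ∃ x : ℝ, 0 ≤ x ∧ (k : ℕ∞) ≤ count Φ (Metric.closedBall 0 x) ω := by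
      -- If there are fewer than k points the radius is `sInf ∅ = 0`, which 0 ≤ a < radius excludes.
      by_contra hne
      have : {x : ℝ | 0 ≤ x ∧ (k : ℕ∞) ≤ count Φ (Metric.closedBall 0 x) ω} = ∅ :=
        eq_empty_iff_forall_notMem.2 fun x hx => hne ⟨x, hx⟩
      rw [radius, this, Real.sInf_empty] at h1
      linarith
    refine ⟨not_le.1 fun h => (hle a ha h).not_gt h1, ?_⟩
    exact (le_count_closedBall_radius hfin hne).trans (count_closedBall_mono h2)
  · rintro ⟨h1, h2⟩
    refine ⟨not_le.1 fun h => h1.not_ge ?_, hle b hb h2⟩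
    exact (le_count_closedBall_radius hfin ⟨b, hb, h2⟩).trans (count_closedBall_mono h)

/-- If the closed balls of radius a and b contain m and n points, the radius of index k + 1 lies in
(a, b] exactly for m ≤ k < n. This also covers points at equal distance. -/
theorem hasSum_indicator_radius (hfin : ∀ x : ℝ, (Φ ω ∩ Metric.closedBall 0 x).Finite)
    {a b : ℝ} (ha : 0 ≤ a) (hab : a ≤ b) :
    HasSum (fun k : ℕ => (Ioc a b).indicator (fun _ => (1 : ℝ)) (radius Φ (k + 1) ω))
      ((count Φ (Metric.closedBall 0 b \ Metric.closedBall 0 a) ω).toNat : ℝ) := by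
  obtain ⟨m, hm⟩ := ENat.ne_top_iff_exists.1 (encard_ne_top_iff.2 (hfin a))
  obtain ⟨n, hn⟩ := ENat.ne_top_iff_exists.1 (encard_ne_top_iff.2 (hfin b))
  have hm' : count Φ (Metric.closedBall 0 a) ω = m := hm.symm
  have hn' : count Φ (Metric.closedBall 0 b) ω = n := hn.symm
  have hmn : m ≤ n := by
    have := count_closedBall_mono (Φ := Φ) (ω := ω) hab
    rw [hm', hn'] at this
    exact_mod_cast this
  have hc : (count Φ (Metric.closedBall 0 b \ Metric.closedBall 0 a) ω).toNat = n - m := by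
    have h := encard_sdiff_add_encard_of_subset (inter_subset_inter_right (Φ ω)
      (Metric.closedBall_subset_closedBall (x := (0 : EuclideanSpace ℝ (Fin d))) hab))
    rw [← inter_sdiff_distrib_left, ← hm, ← hn] at h
    rw [count]
    have hne : (Φ ω ∩ (Metric.closedBall 0 b \ Metric.closedBall 0 a)).encard ≠ ⊤ :=
      encard_ne_top_iff.2 ((hfin b).subset (inter_subset_inter_right _ sdiff_subset))
    obtain ⟨j, hj⟩ := ENat.ne_top_iff_exists.1 hne
    rw [← hj] at h ⊢
    have h' : j + m = n := by exact_mod_cast h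
    rw [ENat.toNat_natCast]; omega
  have hmem : ∀ k : ℕ, radius Φ (k + 1) ω ∈ Ioc a b ↔ k ∈ Finset.Ico m n := fun k => by
    rw [radius_mem_Ioc_iff hfin ha (ha.trans hab), hm', hn', Finset.mem_Ico]
    norm_cast
    omega
  have := hasSum_sum_of_ne_finset_zero (L := SummationFilter.unconditional ℕ) (f := fun k : ℕ => (Ioc a b).indicator
    (fun _ => (1 : ℝ)) (radius Φ (k + 1) ω)) (s := Finset.Ico m n)
    (fun k hk => indicator_of_notMem (fun h => hk ((hmem k).1 h)) _)
  rw [Finset.sum_congr rfl (fun k hk => indicator_of_mem ((hmem k).2 hk) _)] at this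
  rw [hc]
  simpa using this

end Radii

/-! ### Step function approximation of the noise -/

section Grid

/-- The `i`-th point of the grid of mesh `1 / (m + 1)` that starts at `r`. -/
noncomputable def gridPoint (r : ℝ) (m i : ℕ) : ℝ := r + i / (m + 1)

/-- Step functions increasing to `x ↦ x ^ (-γ)` on `(r, ∞)`. -/
noncomputable def stepFun (γ r : ℝ) (m : ℕ) (x : ℝ) : ℝ :=
  ∑ i : Fin ((m + 1) ^ 2), gridPoint r m (i + 1) ^ (-γ) *
    (Ioc (gridPoint r m i) (gridPoint r m (i + 1))).indicator (fun _ => (1 : ℝ)) x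

variable {γ r : ℝ} {m : ℕ}

theorem gridPoint_mono : Monotone (gridPoint r m) := fun i j h => by
  unfold gridPoint; gcongr

theorem le_gridPoint (i : ℕ) : r ≤ gridPoint r m i := by
  unfold gridPoint
  have : (0 : ℝ) ≤ i / (m + 1) := by positivity
  linarith

theorem mem_Ioc_gridPoint_iff {i : ℕ} {x : ℝ} :
    x ∈ Ioc (gridPoint r m i) (gridPoint r m (i + 1)) ↔ ⌈(x - r) * (m + 1)⌉₊ = i + 1 := by
  have hm : (0 : ℝ) < m + 1 := by positivity
  rw [Nat.ceil_eq_iff (by omega), Nat.add_sub_cancel, mem_Ioc, gridPoint, gridPoint,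
    ← lt_sub_iff_add_lt', ← sub_le_iff_le_add', div_lt_iff₀ hm, le_div_iff₀ hm]

/-- A point x > r lies in the cell ending at grid index ⌈(x - r)(m + 1)⌉. The (m + 1)² cells of mesh
1 / (m + 1) cover (r, r + m + 1], so both mesh and cutoff are removed as m grows. -/
theorem stepFun_eq (x : ℝ) : stepFun γ r m x =
    if r < x ∧ ⌈(x - r) * (m + 1)⌉₊ ≤ (m + 1) ^ 2 then
      gridPoint r m ⌈(x - r) * (m + 1)⌉₊ ^ (-γ) else 0 := by
  have hm : (0 : ℝ) < m + 1 := by positivity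
  have hpos : r < x ↔ 0 < ⌈(x - r) * (m + 1)⌉₊ := by
    rw [Nat.ceil_pos, mul_pos_iff_of_pos_right hm, sub_pos]
  simp only [stepFun, indicator_apply, mem_Ioc_gridPoint_iff, hpos]
  generalize ⌈(x - r) * (m + 1)⌉₊ = n
  split_ifs with h
  · rw [Finset.sum_eq_single (⟨n - 1, by omega⟩ : Fin ((m + 1) ^ 2))]
    · simp [Nat.sub_add_cancel h.1]
    · intro i _ hi
      rw [if_neg, mul_zero]
      rintro rfl
      exact hi (Fin.ext (by simp))
    · simp
  · refine Finset.sum_eq_zero fun i _ => ?_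
    rw [if_neg, mul_zero]
    rintro rfl
    exact h ⟨by omega, i.2⟩

theorem stepFun_nonneg (hr : 0 ≤ r) (x : ℝ) : 0 ≤ stepFun γ r m x := by
  rw [stepFun_eq]
  split_ifs
  · exact Real.rpow_nonneg (hr.trans (le_gridPoint _)) _
  · rfl

theorem stepFun_le (hγ : 0 ≤ γ) (hr : 0 ≤ r) (x : ℝ) :
    stepFun γ r m x ≤ if r < x then x ^ (-γ) else 0 := by
  have hm : (0 : ℝ) < m + 1 := by positivity
  rw [stepFun_eq]
  by_cases hx : r < x
  · rw [if_pos hx]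
    split_ifs
    · refine Real.rpow_le_rpow_of_nonpos (by linarith) ?_ (by linarith)
      rw [gridPoint, ← sub_le_iff_le_add', le_div_iff₀ hm]
      exact Nat.le_ceil _
    · exact Real.rpow_nonneg (by linarith) _
  · simp [hx]

theorem tendsto_stepFun (hr : 0 ≤ r) (x : ℝ) :
    Filter.Tendsto (fun m => stepFun γ r m x) Filter.atTop
      (nhds (if r < x then x ^ (-γ) else 0)) := by
  by_cases hx : r < x
  · have hg : Filter.Tendsto (fun m : ℕ => gridPoint r m ⌈(x - r) * (m + 1)⌉₊) Filter.atTop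
        (nhds x) := by
      have h0 : Filter.Tendsto (fun m : ℕ => x + 1 / ((m : ℝ) + 1)) Filter.atTop (nhds x) := by
        simpa using tendsto_const_nhds.add (tendsto_one_div_add_atTop_nhds_zero_nat (𝕜 := ℝ))
      refine tendsto_of_tendsto_of_tendsto_of_le_of_le tendsto_const_nhds h0
        (fun m => ?_) (fun m => ?_)
      · have hm : (0 : ℝ) < m + 1 := by positivity
        change x ≤ _
        rw [gridPoint, ← sub_le_iff_le_add', le_div_iff₀ hm]
        exact Nat.le_ceil _
      · have hm : (0 : ℝ) < m + 1 := by positivity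
        have := (Nat.ceil_lt_add_one (a := (x - r) * (m + 1))
          (mul_nonneg (by linarith) hm.le)).le
        change gridPoint _ _ _ ≤ _
        rw [gridPoint, ← le_sub_iff_add_le', div_le_iff₀ hm]
        calc _ ≤ _ := this
          _ = _ := by field_simp; ring
    rw [if_pos hx]
    refine (hg.rpow_const (Or.inl (by linarith))).congr' ?_
    filter_upwards [Filter.eventually_ge_atTop ⌈x - r⌉₊] with m hm
    have h2 : ⌈(x - r) * (m + 1)⌉₊ ≤ (m + 1) ^ 2 := by
      rw [Nat.ceil_le]
      have h1 : x - r ≤ m := Nat.ceil_le.1 hm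
      push_cast
      nlinarith [(Nat.cast_nonneg m : (0 : ℝ) ≤ m)]
    rw [stepFun_eq, if_pos ⟨hx, h2⟩]
  · simp [stepFun_eq, hx]

theorem measurable_stepFun : Measurable (stepFun γ r m) :=
  Finset.measurable_sum _ fun _ _ =>
    (measurable_const.indicator measurableSet_Ioc).const_mul _

variable {Ω : Type*} {d : ℕ} {Φ : Ω → Set (EuclideanSpace ℝ (Fin d))} {ω : Ω}

/-- The shell between two consecutive grid points. -/
def shell (d : ℕ) (r : ℝ) (m i : ℕ) : Set (EuclideanSpace ℝ (Fin d)) :=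
  Metric.closedBall 0 (gridPoint r m (i + 1)) \ Metric.closedBall 0 (gridPoint r m i)

/-- The approximation to the tail noise that belongs to `stepFun`. -/
noncomputable def stepNoise (Φ : Ω → Set (EuclideanSpace ℝ (Fin d))) (γ r : ℝ) (m : ℕ)
    (ω : Ω) : ℝ :=
  ∑ i : Fin ((m + 1) ^ 2), gridPoint r m (i + 1) ^ (-γ) * ((count Φ (shell d r m i) ω).toNat : ℝ)

/-- Passes from ordered radii to counts in disjoint shells, the only quantities the Poisson
hypothesis speaks about. -/
theorem hasSum_stepFun_radius (hr : 0 ≤ r)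
    (hfin : ∀ x : ℝ, (Φ ω ∩ Metric.closedBall 0 x).Finite) :
    HasSum (fun k : ℕ => stepFun γ r m (radius Φ (k + 1) ω)) (stepNoise Φ γ r m ω) :=
  hasSum_sum fun i _ => (hasSum_indicator_radius hfin (hr.trans (le_gridPoint i))
    (gridPoint_mono (Nat.le_succ _))).mul_left _

theorem stepNoise_nonneg (hr : 0 ≤ r) : 0 ≤ stepNoise Φ γ r m ω :=
  Finset.sum_nonneg fun _ _ => mul_nonneg (Real.rpow_nonneg (hr.trans (le_gridPoint _)) _)
    (Nat.cast_nonneg _)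

theorem tailTerm_nonneg (hr : 0 ≤ r) (k : ℕ) : 0 ≤ tailTerm Φ γ r k ω := by
  unfold tailTerm
  split_ifs with h
  · exact Real.rpow_nonneg (by linarith) _
  · rfl

/-- A finite partial sum is the limit of the same sum of step functions, each at most the full step
noise. A bound along infinitely many m is therefore enough. -/
theorem summable_tailTerm (hr : 0 ≤ r)
    (hfin : ∀ x : ℝ, (Φ ω ∩ Metric.closedBall 0 x).Finite) {M : ℝ}
    (hM : ∃ᶠ m in Filter.atTop, stepNoise Φ γ r m ω ≤ M) :
    Summable (fun k : ℕ => tailTerm Φ γ r (k + 1) ω) := by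
  refine summable_of_sum_le (c := M) (fun k => tailTerm_nonneg hr _) fun u => ?_
  have hlim : Filter.Tendsto (fun m => ∑ k ∈ u, stepFun γ r m (radius Φ (k + 1) ω)) Filter.atTop
      (nhds (∑ k ∈ u, tailTerm Φ γ r (k + 1) ω)) :=
    tendsto_finsetSum _ fun k _ => tendsto_stepFun hr _
  refine le_of_tendsto_of_frequently hlim (hM.mono fun m hm => le_trans ?_ hm)
  exact sum_le_hasSum u (fun k _ => stepFun_nonneg hr _) (hasSum_stepFun_radius hr hfin)

theorem stepNoise_le_tailNoise (hγ : 0 ≤ γ) (hr : 0 ≤ r)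
    (hfin : ∀ x : ℝ, (Φ ω ∩ Metric.closedBall 0 x).Finite)
    (hs : Summable (fun k : ℕ => tailTerm Φ γ r (k + 1) ω)) :
    stepNoise Φ γ r m ω ≤ tailNoise Φ γ r ω :=
  hasSum_le (fun _ => stepFun_le hγ hr _) (hasSum_stepFun_radius hr hfin) hs.hasSum

theorem tendsto_stepNoise (hγ : 0 ≤ γ) (hr : 0 ≤ r)
    (hfin : ∀ x : ℝ, (Φ ω ∩ Metric.closedBall 0 x).Finite)
    (hs : Summable (fun k : ℕ => tailTerm Φ γ r (k + 1) ω)) :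
    Filter.Tendsto (fun m => stepNoise Φ γ r m ω) Filter.atTop (nhds (tailNoise Φ γ r ω)) := by
  have h := tendsto_tsum_of_dominated_convergence
    (f := fun (m : ℕ) (k : ℕ) => stepFun γ r m (radius Φ (k + 1) ω)) (𝓕 := Filter.atTop)
    hs (fun k => tendsto_stepFun hr _) (Filter.Eventually.of_forall fun m k => by
      rw [Real.norm_of_nonneg (stepFun_nonneg hr _)]
      exact stepFun_le hγ hr _)
  refine h.congr fun m => (hasSum_stepFun_radius hr hfin).tsum_eq

end Grid

/-! ### Polar coordinates -/

section Radial

variable {d : ℕ} {γ r : ℝ}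

theorem nontrivial_euclideanSpace_of_one_le (hd : 1 ≤ d) : Nontrivial (EuclideanSpace ℝ (Fin d)) := by
  have : Nonempty (Fin d) := ⟨⟨0, hd⟩⟩
  infer_instance

theorem integrable_tail_norm (hd : 1 ≤ d) (hγ : (d : ℝ) < γ) (hr : 1 ≤ r) :
    Integrable (fun p : EuclideanSpace ℝ (Fin d) => if r < ‖p‖ then ‖p‖ ^ (-γ) else 0) := by
  have := nontrivial_euclideanSpace_of_one_le hd
  rw [integrable_fun_norm_addHaar volume (f := fun x : ℝ => if r < x then x ^ (-γ) else 0),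
    finrank_euclideanSpace_fin]
  have h := (integrableOn_Ioi_rpow_of_lt (a := (d : ℝ) - 1 - γ) (by linarith)
    (show (0 : ℝ) < r by linarith)).integrable_indicator measurableSet_Ioi
  refine (h.integrableOn (s := Ioi 0)).congr_fun (fun x hx => ?_) measurableSet_Ioi
  have hx : 0 < x := hx
  by_cases hxr : r < x
  · rw [indicator_of_mem (show x ∈ Ioi r from hxr)]
    simp only [if_pos hxr, smul_eq_mul]
    rw [sub_eq_add_neg, Real.rpow_add hx, ← Real.rpow_natCast, Nat.cast_sub hd, Nat.cast_one]
  · rw [indicator_of_notMem (show x ∉ Ioi r from hxr)]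
    simp [hxr]

/-- Polar coordinates, then v = y^(-γ), then v = r^(-γ) u. The sphere area cancels against the
intensity, and 2 γ - d = γ (2 - α) supplies the normalising constant of the power law. -/
theorem intensity_mul_integral_norm (hd : 1 ≤ d) (hγ : (d : ℝ) < γ) (hr : 1 ≤ r) (g : ℝ → ℂ) :
    (intensity d γ : ℂ) * ∫ p : EuclideanSpace ℝ (Fin d),
        (if r < ‖p‖ then g (‖p‖ ^ (-γ)) else 0) =
      ((rho d r ^ 2 : ℝ) : ℂ) *
        ∫ u, g (r ^ (-γ) * u) / ((u ^ 2 : ℝ) : ℂ) ∂(powerLaw (d / γ)) := by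
  have := nontrivial_euclideanSpace_of_one_le hd
  have hr0 : 0 < r := by linarith
  have hd0 : (0 : ℝ) < d := by exact_mod_cast hd
  have hγ0 : 0 < γ := by linarith
  have hα1 : (d : ℝ) / γ < 1 := by rwa [div_lt_one hγ0]
  set α := (d : ℝ) / γ with hα
  have hαγ : α * γ = d := by rw [hα]; field_simp
  set G : ℝ → ℂ := fun v => (γ⁻¹ * v ^ (-α - 1)) • (if v < r ^ (-γ) then g v else 0) with hG
  have hsphere : sphereArea d = d * volume.real (Metric.ball (0 : EuclideanSpace ℝ (Fin d)) 1) := by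
    rw [sphereArea, Measure.toSphere_real_apply_univ, finrank_euclideanSpace_fin]
  have hball : 0 < volume.real (Metric.ball (0 : EuclideanSpace ℝ (Fin d)) 1) :=
    ENNReal.toReal_pos (Metric.measure_ball_pos _ _ one_pos).ne' measure_ball_lt_top.ne
  have h1 : ∫ y in Ioi (0 : ℝ), y ^ (d - 1) • (if r < y then g (y ^ (-γ)) else 0) =
      ∫ v in Ioi (0 : ℝ), G v := by
    rw [← integral_comp_rpow_Ioi G (p := -γ) (by linarith)]
    refine setIntegral_congr_fun measurableSet_Ioi fun y hy => ?_
    have hy : 0 < y := hy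
    have hiff : y ^ (-γ) < r ^ (-γ) ↔ r < y := Real.rpow_lt_rpow_iff_of_neg hy hr0 (by linarith)
    simp only [hG, hiff, smul_smul]
    congr 1
    rw [abs_neg, abs_of_pos hγ0, ← Real.rpow_mul hy.le, ← Real.rpow_natCast, Nat.cast_sub hd,
      Nat.cast_one, show γ * y ^ (-γ - 1) * (γ⁻¹ * y ^ (-γ * (-α - 1))) =
        (γ * γ⁻¹) * (y ^ (-γ - 1) * y ^ (-γ * (-α - 1))) by ring, mul_inv_cancel₀ hγ0.ne', one_mul,
      ← Real.rpow_add hy]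
    congr 1
    rw [← hαγ]; ring
  have hrγ : 0 < r ^ (-γ) := Real.rpow_pos_of_pos hr0 _
  have h2 : ∫ v in Ioi (0 : ℝ), G v = r ^ (-γ) • ∫ u in Ioi (0 : ℝ), G (r ^ (-γ) * u) := by
    rw [integral_comp_mul_left_Ioi' G 0 hrγ, mul_zero]
  have h3 : ∀ u : ℝ, u ∈ Ioi (0 : ℝ) → u ≠ 1 → G (r ^ (-γ) * u) =
      (Ioc (0 : ℝ) 1).indicator (fun u => (γ⁻¹ * (2 - α)⁻¹ * (r ^ (-γ)) ^ (-α - 1)) •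
        (((2 - α) * u ^ (1 - α)) • (g (r ^ (-γ) * u) / ((u ^ 2 : ℝ) : ℂ)))) u := fun u hu hu1 => by
    have hu : 0 < u := hu
    have hiff : r ^ (-γ) * u < r ^ (-γ) ↔ u ∈ Ioc (0 : ℝ) 1 := by
      rw [mul_lt_iff_lt_one_right hrγ]
      exact ⟨fun h => ⟨hu, h.le⟩, fun h => lt_of_le_of_ne h.2 hu1⟩
    by_cases hmem : u ∈ Ioc (0 : ℝ) 1
    · rw [indicator_of_mem hmem]
      simp only [hG, if_pos (hiff.2 hmem)]
      rw [Real.mul_rpow hrγ.le hu.le, show -α - 1 = (1 - α) - (2 : ℕ) by push_cast; ring,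
        Real.rpow_sub_natCast hu.ne']
      simp only [Complex.real_smul]
      have : (2 - α : ℂ) ≠ 0 := by
        have : (2 - α : ℝ) ≠ 0 := by linarith
        exact_mod_cast this
      have hu' : (u : ℂ) ≠ 0 := by exact_mod_cast hu.ne'
      push_cast
      field_simp
    · rw [indicator_of_notMem hmem]
      simp only [hG, if_neg (fun h => hmem (hiff.1 h)), smul_zero]
  have h4 : ∫ u in Ioi (0 : ℝ), G (r ^ (-γ) * u) =
      (γ⁻¹ * (2 - α)⁻¹ * (r ^ (-γ)) ^ (-α - 1)) •
        ∫ u, g (r ^ (-γ) * u) / ((u ^ 2 : ℝ) : ℂ) ∂(powerLaw α) := by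
    rw [integral_powerLaw hα1, ← integral_smul]
    -- The strict condition r < ‖p‖ means u < 1, whereas the power law lives on (0, 1]; the endpoint
    -- is null.
    have hae : ∀ᵐ u : ℝ, u ≠ 1 := by
      rw [ae_iff]; simp
    rw [setIntegral_congr_ae measurableSet_Ioi (hae.mono fun u hu1 hu => h3 u hu hu1),
      setIntegral_indicator measurableSet_Ioc, inter_eq_self_of_subset_right Ioc_subset_Ioi_self]
  rw [integral_fun_norm_addHaar volume (fun x : ℝ => if r < x then g (x ^ (-γ)) else 0),
    finrank_euclideanSpace_fin, h1, h2, h4, intensity, hsphere, rho]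
  have h5 : r ^ (-γ) * (r ^ (-γ)) ^ (-α - 1) = (r ^ ((d : ℝ) / 2)) ^ 2 := by
    rw [← Real.rpow_mul hr0.le, ← Real.rpow_add hr0, ← Real.rpow_natCast, ← Real.rpow_mul hr0.le]
    congr 1
    push_cast
    rw [← hαγ]; ring
  have h6 : (2 * γ - d) = γ * (2 - α) := by rw [← hαγ]; ring
  rw [← h5, h6]
  have h7 : (2 - α : ℝ) ≠ 0 := by linarith
  simp only [Complex.real_smul, nsmul_eq_mul]
  rw [← mul_assoc, ← mul_assoc, ← mul_assoc, ← mul_assoc]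
  congr 1
  norm_cast
  field_simp

end Radial

/-! ### Campbell's formula for the tail noise -/

section Poisson

theorem integral_exp_mul_poissonMeasure (s : NNReal) (z : ℂ) :
    ∫ n : ℕ, Complex.exp (z * n) ∂(poissonMeasure s) = Complex.exp (s * (Complex.exp z - 1)) := by
  rw [integral_poissonMeasure]
  have h := (NormedSpace.expSeries_div_hasSum_exp (s * Complex.exp z : ℂ)).mul_left
    (Complex.exp (-s))
  rw [← Complex.exp_eq_exp_ℂ, ← Complex.exp_add] at h
  rw [show (s : ℂ) * (Complex.exp z - 1) = -s + s * Complex.exp z by ring, ← h.tsum_eq]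
  refine tsum_congr fun n => ?_
  rw [mul_pow, ← Complex.exp_nat_mul, Complex.real_smul, mul_comm z]
  push_cast
  ring

variable {Ω : Type*} [MeasurableSpace Ω] {P : Measure Ω} {d : ℕ}
  {Φ : Ω → Set (EuclideanSpace ℝ (Fin d))} {lam : ℝ}

/-- The law of a count is pushed forward from ℕ, hence has no mass at ⊤; integer radii suffice. -/
theorem IsHomogeneousPoisson.ae_finite (h : IsHomogeneousPoisson P Φ lam) :
    ∀ᵐ ω ∂P, ∀ x : ℝ, (Φ ω ∩ Metric.closedBall 0 x).Finite := by
  have h1 : ∀ n : ℕ, ∀ᵐ ω ∂P, count Φ (Metric.closedBall 0 (n : ℝ)) ω ≠ ⊤ := fun n => by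
    have hm := h.measurable_count (Metric.closedBall 0 (n : ℝ)) Metric.isClosed_closedBall.measurableSet
    have hl := h.law_count _ (Metric.isClosed_closedBall (x := (0 : EuclideanSpace ℝ (Fin d)))
      (ε := (n : ℝ))).measurableSet measure_closedBall_lt_top.ne
    have h2 : P.map (count Φ (Metric.closedBall 0 (n : ℝ))) {⊤} = 0 := by
      rw [hl, Measure.map_apply .of_discrete (measurableSet_singleton _)]
      convert measure_empty (μ := poissonMeasure _)
      ext k
      simp
    rw [Measure.map_apply hm (measurableSet_singleton _)] at h2
    rw [ae_iff]
    convert h2 using 2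
    ext ω
    simp
  filter_upwards [ae_all_iff.2 h1] with ω hω x
  obtain ⟨n, hn⟩ := exists_nat_ge x
  exact (encard_ne_top_iff.1 (hω n)).subset
    (inter_subset_inter_right _ (Metric.closedBall_subset_closedBall hn))

theorem IsHomogeneousPoisson.integral_exp_sum_count (h : IsHomogeneousPoisson P Φ lam)
    (hlam : 0 ≤ lam) {n : ℕ} {B : Fin n → Set (EuclideanSpace ℝ (Fin d))}
    (hB : ∀ i, MeasurableSet (B i)) (hdisj : Pairwise fun i j => Disjoint (B i) (B j))
    (hvol : ∀ i, volume (B i) ≠ ⊤) (c : Fin n → ℂ) :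
    ∫ ω, Complex.exp (∑ i, c i * ((count Φ (B i) ω).toNat : ℂ)) ∂P =
      Complex.exp (∑ i, (lam * volume.real (B i) : ℝ) * (Complex.exp (c i) - 1)) := by
  simp only [Complex.exp_sum]
  have hm : ∀ i, AEStronglyMeasurable (fun k : ℕ∞ => Complex.exp (c i * (k.toNat : ℂ)))
      (P.map (count Φ (B i))) := fun i => (Measurable.of_discrete).aestronglyMeasurable
  rw [(h.indep_count n B hB hdisj).integral_fun_prod_comp
    (f := fun i (k : ℕ∞) => Complex.exp (c i * (k.toNat : ℂ)))
    (fun i => (h.measurable_count _ (hB i)).aemeasurable) hm]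
  refine Finset.prod_congr rfl fun i _ => ?_
  rw [← integral_map (h.measurable_count _ (hB i)).aemeasurable (hm i),
    h.law_count _ (hB i) (hvol i), integral_map .of_discrete
      ((Measurable.of_discrete).aestronglyMeasurable)]
  simp only [ENat.toNat_natCast]
  rw [integral_exp_mul_poissonMeasure, Real.coe_toNNReal _ (by positivity)]

variable {γ r : ℝ}

theorem measurableSet_shell (m i : ℕ) : MeasurableSet (shell d r m i) :=
  Metric.isClosed_closedBall.measurableSet.diff Metric.isClosed_closedBall.measurableSet

theorem mem_shell_iff {m i : ℕ} {p : EuclideanSpace ℝ (Fin d)} :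
    p ∈ shell d r m i ↔ ‖p‖ ∈ Ioc (gridPoint r m i) (gridPoint r m (i + 1)) := by
  simp [shell, and_comm]

theorem volume_shell_ne_top (m i : ℕ) : volume (shell d r m i) ≠ ⊤ :=
  ((measure_mono sdiff_subset).trans_lt measure_closedBall_lt_top).ne

theorem pairwise_disjoint_shell (m : ℕ) : Pairwise fun i j : Fin ((m + 1) ^ 2) =>
    Disjoint (shell d r m i) (shell d r m j) := fun i j hij => by
  refine disjoint_left.2 fun p hi hj => hij (Fin.ext ?_)
  rw [mem_shell_iff, mem_Ioc_gridPoint_iff] at hi hj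
  omega

theorem exp_mul_stepFun_sub_one (m : ℕ) (z : ℂ) (p : EuclideanSpace ℝ (Fin d)) :
    Complex.exp (z * stepFun γ r m ‖p‖) - 1 = ∑ i : Fin ((m + 1) ^ 2),
      (shell d r m i).indicator
        (fun _ => Complex.exp (z * (gridPoint r m (i + 1) ^ (-γ) : ℝ)) - 1) p := by
  classical
  simp only [stepFun, indicator_apply, mem_shell_iff, mem_Ioc_gridPoint_iff]
  generalize ⌈(‖p‖ - r) * (m + 1)⌉₊ = n
  by_cases h : ∃ i : Fin ((m + 1) ^ 2), n = i + 1
  · obtain ⟨i, rfl⟩ := h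
    rw [Finset.sum_eq_single i, Finset.sum_eq_single i]
    · simp
    · exact fun j _ hj => if_neg fun h => hj (Fin.ext (by omega))
    · simp
    · exact fun j _ hj => by rw [if_neg fun h => hj (Fin.ext (by omega)), mul_zero]
    · simp
  · rw [Finset.sum_eq_zero, Finset.sum_eq_zero]
    · simp
    · exact fun i _ => if_neg fun hi => h ⟨i, hi⟩
    · exact fun i _ => by rw [if_neg fun hi => h ⟨i, hi⟩, mul_zero]

/-- Campbell's formula for a step function, from independence over disjoint shells and the Poisson
generating function, for every complex z. -/
theorem IsHomogeneousPoisson.integral_exp_stepNoise (h : IsHomogeneousPoisson P Φ lam)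
    (hlam : 0 ≤ lam) (m : ℕ) (z : ℂ) :
    ∫ ω, Complex.exp (z * stepNoise Φ γ r m ω) ∂P = Complex.exp (lam *
      ∫ p : EuclideanSpace ℝ (Fin d), (Complex.exp (z * stepFun γ r m ‖p‖) - 1)) := by
  have h1 := h.integral_exp_sum_count hlam (B := fun i : Fin ((m + 1) ^ 2) => shell d r m i)
    (fun i => measurableSet_shell m i) (pairwise_disjoint_shell m)
    (fun i => volume_shell_ne_top m i) (fun i => z * (gridPoint r m (i + 1) ^ (-γ) : ℝ))
  simp only [stepNoise]
  push_cast
  simp only [Finset.mul_sum, ← mul_assoc]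
  push_cast at h1
  rw [h1]
  congr 1
  simp only [exp_mul_stepFun_sub_one]
  have h2 : ∀ i ∈ (Finset.univ : Finset (Fin ((m + 1) ^ 2))), Integrable ((shell d r m i).indicator
      (fun _ => Complex.exp (z * (gridPoint r m (i + 1) ^ (-γ) : ℝ)) - 1)) := fun i _ =>
    (integrable_indicator_iff (measurableSet_shell m i)).2
      (integrableOn_const (volume_shell_ne_top m i))
  rw [integral_finsetSum _ h2, Finset.mul_sum]
  refine Finset.sum_congr rfl fun i _ => ?_
  rw [integral_indicator (measurableSet_shell m i), setIntegral_const, Complex.real_smul]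
  ring

theorem IsHomogeneousPoisson.integrable_exp_stepNoise (h : IsHomogeneousPoisson P Φ lam)
    (hlam : 0 ≤ lam) (m : ℕ) (t : ℝ) :
    Integrable (fun ω => Real.exp (t * stepNoise Φ γ r m ω)) P := by
  have h1 := h.integral_exp_stepNoise hlam (γ := γ) (r := r) m t
  have h2 : Integrable (fun ω => Complex.exp ((t : ℂ) * stepNoise Φ γ r m ω)) P := by
    -- A non-integrable function has Bochner integral 0, but the formula gives an exponential, which
    -- never vanishes.
    by_contra hn
    rw [integral_undef hn] at h1
    exact Complex.exp_ne_zero _ h1.symm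
  refine h2.norm.congr (Filter.Eventually.of_forall fun ω => ?_)
  simp only [Complex.norm_exp]
  norm_cast

theorem IsHomogeneousPoisson.measurable_stepNoise (h : IsHomogeneousPoisson P Φ lam) (m : ℕ) :
    Measurable (stepNoise Φ γ r m) :=
  Finset.measurable_sum _ fun i _ => ((Measurable.of_discrete (f := fun k : ℕ∞ => (k.toNat : ℝ))).comp
    (h.measurable_count _ (measurableSet_shell m i))).const_mul _

theorem norm_exp_mul_sub_one_le (z : ℂ) {x y : ℝ} (hx : 0 ≤ x) (hxy : x ≤ y) (hy : y ≤ 1) :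
    ‖Complex.exp (z * x) - 1‖ ≤ ‖z‖ * Real.exp ‖z‖ * y := by
  have h := Complex.norm_exp_sub_sum_le_norm_mul_exp (z * x) 1
  simp only [Finset.range_one, Finset.sum_singleton, pow_zero, Nat.factorial_zero, Nat.cast_one,
    div_one, pow_one, norm_mul, Complex.norm_real, Real.norm_of_nonneg hx] at h
  have hy0 : 0 ≤ y := hx.trans hxy
  have h1 : ‖z‖ * x ≤ ‖z‖ := mul_le_of_le_one_right (norm_nonneg _) (hxy.trans hy)
  calc _ ≤ ‖z‖ * x * Real.exp (‖z‖ * x) := h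
    _ ≤ ‖z‖ * y * Real.exp ‖z‖ := by gcongr
    _ = _ := by ring

theorem tendsto_integral_exp_stepFun (hd : 1 ≤ d) (hγ : (d : ℝ) < γ) (hr : 1 ≤ r) (z : ℂ) :
    Filter.Tendsto (fun m => ∫ p : EuclideanSpace ℝ (Fin d),
        (Complex.exp (z * stepFun γ r m ‖p‖) - 1)) Filter.atTop
      (nhds (∫ p : EuclideanSpace ℝ (Fin d),
        (if r < ‖p‖ then Complex.exp (z * (‖p‖ ^ (-γ) : ℝ)) - 1 else 0))) := by
  have hγ0 : 0 < γ := lt_of_le_of_lt (Nat.cast_nonneg _) hγ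
  have hr0 : 0 ≤ r := by linarith
  refine tendsto_integral_of_dominated_convergence
    (fun p : EuclideanSpace ℝ (Fin d) => ‖z‖ * Real.exp ‖z‖ * if r < ‖p‖ then ‖p‖ ^ (-γ) else 0)
    (fun m => ?_) ((integrable_tail_norm hd hγ hr).const_mul _) (fun m => ?_) ?_
  · have := (measurable_stepFun (γ := γ) (r := r) (m := m)).comp
      (measurable_norm (α := EuclideanSpace ℝ (Fin d)))
    exact Measurable.aestronglyMeasurable (by
      refine Measurable.sub_const (Complex.measurable_exp.comp (Measurable.const_mul ?_ z)) 1
      exact Complex.measurable_ofReal.comp this)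
  · refine Filter.Eventually.of_forall fun p =>
      norm_exp_mul_sub_one_le z (stepFun_nonneg hr0 _) (stepFun_le hγ0.le hr0 _) ?_
    split_ifs with hp
    · exact Real.rpow_le_one_of_one_le_of_nonpos (by linarith) (by linarith)
    · exact zero_le_one
  · refine Filter.Eventually.of_forall fun p => ?_
    have h1 : Continuous fun x : ℝ => Complex.exp (z * x) - 1 := by fun_prop
    have h2 := (h1.tendsto _).comp (tendsto_stepFun (γ := γ) hr0 ‖p‖)
    have h3 : (if r < ‖p‖ then Complex.exp (z * (‖p‖ ^ (-γ) : ℝ)) - 1 else 0) =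
        Complex.exp (z * ((if r < ‖p‖ then ‖p‖ ^ (-γ) else 0 : ℝ) : ℂ)) - 1 := by
      split_ifs <;> simp
    rw [h3]
    exact h2

theorem IsHomogeneousPoisson.tendsto_integral_exp_stepNoise (hd : 1 ≤ d) (hγ : (d : ℝ) < γ)
    (h : IsHomogeneousPoisson P Φ (intensity d γ)) (hlam : 0 ≤ intensity d γ) (hr : 1 ≤ r) (z : ℂ) :
    Filter.Tendsto (fun m => ∫ ω, Complex.exp (z * stepNoise Φ γ r m ω) ∂P) Filter.atTop
      (nhds (Complex.exp (((rho d r ^ 2 : ℝ) : ℂ) * ∫ u, (Complex.exp (z * (r ^ (-γ) * u : ℝ)) - 1) /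
        ((u ^ 2 : ℝ) : ℂ) ∂(powerLaw (d / γ))))) := by
  simp only [h.integral_exp_stepNoise hlam]
  refine (Complex.continuous_exp.tendsto _).comp ?_
  rw [← intensity_mul_integral_norm hd hγ hr fun x => Complex.exp (z * x) - 1]
  exact (tendsto_integral_exp_stepFun hd hγ hr z).const_mul _

theorem intensity_nonneg (hγ : (d : ℝ) < γ) : 0 ≤ intensity d γ := by
  have : (0 : ℝ) ≤ d := Nat.cast_nonneg _
  exact div_nonneg (by linarith) measureReal_nonneg

/-- A sequence of variables with convergent exponential moments is frequently bounded. -/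
theorem ae_frequently_le_of_tendsto_integral_exp {X : ℕ → Ω → ℝ} {c : ℝ}
    (hX : ∀ m, Measurable (X m)) (hint : ∀ m, Integrable (fun ω => Real.exp (X m ω)) P)
    (hlim : Filter.Tendsto (fun m => ∫ ω, Real.exp (X m ω) ∂P) Filter.atTop (nhds c)) :
    ∀ᵐ ω ∂P, ∃ M : ℝ, ∃ᶠ m in Filter.atTop, X m ω ≤ M := by
  have hm : ∀ m, Measurable fun ω => ENNReal.ofReal (Real.exp (X m ω)) := fun m =>
    (Real.measurable_exp.comp (hX m)).ennreal_ofReal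
  have h1 : ∫⁻ ω, Filter.liminf (fun m => ENNReal.ofReal (Real.exp (X m ω))) Filter.atTop ∂P ≤
      ENNReal.ofReal c := by
    refine (lintegral_liminf_le hm).trans ?_
    have h2 : Filter.Tendsto (fun m => ∫⁻ ω, ENNReal.ofReal (Real.exp (X m ω)) ∂P) Filter.atTop
        (nhds (ENNReal.ofReal c)) := by
      refine (ENNReal.tendsto_ofReal hlim).congr fun m => ?_
      exact ofReal_integral_eq_lintegral_ofReal (hint m)
        (Filter.Eventually.of_forall fun ω => (Real.exp_pos _).le)
    exact h2.liminf_eq.le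
  filter_upwards [ae_lt_top (Measurable.liminf hm) (h1.trans_lt ENNReal.ofReal_lt_top).ne] with ω hω
  obtain ⟨K, hK, -⟩ := ENNReal.lt_iff_exists_nnreal_btwn.1 hω
  refine ⟨K, (Filter.frequently_lt_of_liminf_lt (by isBoundedDefault) hK).mono fun m hm => ?_⟩
  have h3 : Real.exp (X m ω) ≤ K := by
    have := ENNReal.toReal_mono ENNReal.coe_ne_top hm.le
    rwa [ENNReal.toReal_ofReal (Real.exp_pos _).le] at this
  linarith [Real.add_one_le_exp (X m ω)]

variable (hd : 1 ≤ d) (hγ : (d : ℝ) < γ) (h : IsHomogeneousPoisson P Φ (intensity d γ))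
  (hr : 1 ≤ r)
include hd hγ h hr

theorem IsHomogeneousPoisson.tendsto_integral_real_exp_stepNoise (t : ℝ) :
    Filter.Tendsto (fun m => ∫ ω, Real.exp (t * stepNoise Φ γ r m ω) ∂P) Filter.atTop
      (nhds (Complex.exp (((rho d r ^ 2 : ℝ) : ℂ) * ∫ u, (Complex.exp (t * (r ^ (-γ) * u : ℝ)) - 1) /
        ((u ^ 2 : ℝ) : ℂ) ∂(powerLaw (d / γ)))).re) := by
  have h1 := (Complex.continuous_re.tendsto _).comp
    (h.tendsto_integral_exp_stepNoise hd hγ (intensity_nonneg hγ) hr t)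
  refine h1.congr fun m => ?_
  have h2 : ∫ ω, Complex.exp (t * stepNoise Φ γ r m ω) ∂P =
      ((∫ ω, Real.exp (t * stepNoise Φ γ r m ω) ∂P : ℝ) : ℂ) := by
    rw [← integral_complex_ofReal]
    push_cast
    rfl
  simp only [Function.comp_apply, h2, Complex.ofReal_re]

/-- Convergence of the step noise to the tail noise presupposes summability, so summability is
obtained first: converging exponential moments and Fatou bound the step noise along a subsequence.
-/
theorem IsHomogeneousPoisson.ae_summable_tailTerm :
    ∀ᵐ ω ∂P, Summable (fun k : ℕ => tailTerm Φ γ r (k + 1) ω) := by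
  have h1 := h.tendsto_integral_real_exp_stepNoise hd hγ hr 1
  have h2 := fun m => h.integrable_exp_stepNoise (γ := γ) (r := r) (intensity_nonneg hγ) m 1
  simp only [one_mul] at h1 h2
  filter_upwards [h.ae_finite, ae_frequently_le_of_tendsto_integral_exp
    (fun m => h.measurable_stepNoise m) h2 h1] with ω hfin hM
  obtain ⟨M, hM⟩ := hM
  exact summable_tailTerm (by linarith) hfin hM

theorem IsHomogeneousPoisson.ae_tendsto_stepNoise :
    ∀ᵐ ω ∂P, Filter.Tendsto (fun m => stepNoise Φ γ r m ω) Filter.atTop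
      (nhds (tailNoise Φ γ r ω)) := by
  filter_upwards [h.ae_finite, h.ae_summable_tailTerm hd hγ hr] with ω hfin hs
  exact tendsto_stepNoise (by linarith [(Nat.cast_nonneg d : (0 : ℝ) ≤ d)]) (by linarith) hfin hs

theorem IsHomogeneousPoisson.aemeasurable_tailNoise : AEMeasurable (tailNoise Φ γ r) P :=
  aemeasurable_of_tendsto_metrizable_ae Filter.atTop
    (fun m => (h.measurable_stepNoise m).aemeasurable) (h.ae_tendsto_stepNoise hd hγ hr)

theorem IsHomogeneousPoisson.integrable_exp_tailNoise (t : ℝ) :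
    Integrable (fun ω => Real.exp (t * tailNoise Φ γ r ω)) P := by
  refine ⟨(Real.measurable_exp.comp_aemeasurable
    ((h.aemeasurable_tailNoise hd hγ hr).const_mul t)).aestronglyMeasurable, ?_⟩
  have hm : ∀ m, Measurable fun ω => ENNReal.ofReal (Real.exp (t * stepNoise Φ γ r m ω)) :=
    fun m => (Real.measurable_exp.comp ((h.measurable_stepNoise m).const_mul t)).ennreal_ofReal
  rw [hasFiniteIntegral_iff_ofReal (Filter.Eventually.of_forall fun ω => (Real.exp_pos _).le)]
  have h2 : Filter.Tendsto (fun m => ∫⁻ ω, ENNReal.ofReal (Real.exp (t * stepNoise Φ γ r m ω)) ∂P)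
      Filter.atTop (nhds (ENNReal.ofReal _)) :=
    (ENNReal.tendsto_ofReal (h.tendsto_integral_real_exp_stepNoise hd hγ hr t)).congr fun m =>
      ofReal_integral_eq_lintegral_ofReal (h.integrable_exp_stepNoise (intensity_nonneg hγ) m t)
        (Filter.Eventually.of_forall fun ω => (Real.exp_pos _).le)
  calc _ = ∫⁻ ω, Filter.liminf (fun m => ENNReal.ofReal (Real.exp (t * stepNoise Φ γ r m ω)))
        Filter.atTop ∂P := by
        refine lintegral_congr_ae ?_
        filter_upwards [h.ae_tendsto_stepNoise hd hγ hr] with ω hω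
        exact (ENNReal.tendsto_ofReal ((Real.continuous_exp.tendsto _).comp
          (hω.const_mul t))).liminf_eq.symm
    _ ≤ _ := lintegral_liminf_le hm
    _ = ENNReal.ofReal _ := h2.liminf_eq
    _ < ⊤ := ENNReal.ofReal_lt_top

/-- The moment generating function of the tail shot noise. -/
theorem IsHomogeneousPoisson.integral_exp_tailNoise (z : ℂ) :
    ∫ ω, Complex.exp (z * tailNoise Φ γ r ω) ∂P =
      Complex.exp (((rho d r ^ 2 : ℝ) : ℂ) * ∫ u, (Complex.exp (z * (r ^ (-γ) * u : ℝ)) - 1) /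
        ((u ^ 2 : ℝ) : ℂ) ∂(powerLaw (d / γ))) := by
  refine tendsto_nhds_unique ?_
    (h.tendsto_integral_exp_stepNoise hd hγ (intensity_nonneg hγ) hr z)
  refine tendsto_integral_of_dominated_convergence
    (fun ω => Real.exp (‖z‖ * tailNoise Φ γ r ω)) (fun m => ?_)
    (h.integrable_exp_tailNoise hd hγ hr ‖z‖) (fun m => ?_) ?_
  · exact (Complex.measurable_exp.comp ((Complex.measurable_ofReal.comp
      (h.measurable_stepNoise m)).const_mul z)).aestronglyMeasurable
  · filter_upwards [h.ae_finite, h.ae_summable_tailTerm hd hγ hr] with ω hfin hs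
    have h1 := stepNoise_le_tailNoise (m := m)
      (by linarith [(Nat.cast_nonneg d : (0 : ℝ) ≤ d)]) (by linarith) hfin hs
    have h2 : 0 ≤ stepNoise Φ γ r m ω := stepNoise_nonneg (by linarith)
    rw [Complex.norm_exp]
    gcongr
    calc _ ≤ ‖z * stepNoise Φ γ r m ω‖ := Complex.re_le_norm _
      _ = ‖z‖ * stepNoise Φ γ r m ω := by
        rw [norm_mul, Complex.norm_real, Real.norm_of_nonneg h2]
      _ ≤ _ := by gcongr
  · filter_upwards [h.ae_tendsto_stepNoise hd hγ hr] with ω hω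
    have h1 : Continuous fun x : ℝ => Complex.exp (z * x) := by fun_prop
    exact (h1.tendsto _).comp hω

end Poisson

/-! ### The Lévy exponent and the mean equation -/

section LevyExponent

variable {α : ℝ}

/-- The Lévy exponent `b ↦ ∫ (e ^ (b u) - 1) / u ^ 2` of the power law. -/
noncomputable def levyExponent (α b : ℝ) : ℝ :=
  ∫ u, (Real.exp (b * u) - 1) / u ^ 2 ∂(powerLaw α)

/-- The derivative of `levyExponent`. -/
noncomputable def levyMean (α b : ℝ) : ℝ :=
  ∫ u, u⁻¹ * Real.exp (b * u) ∂(powerLaw α)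

theorem hasDerivAt_integral_powerLaw {G : ℝ → ℝ → ℝ} {w : ℝ → ℝ}
    (hG : ∀ b, Integrable (G b) (powerLaw α)) (hw : Integrable w (powerLaw α))
    (hderiv : ∀ u ∈ Ioc (0 : ℝ) 1, ∀ b, HasDerivAt (fun b => G b u) (w u * Real.exp (b * u)) b)
    (b : ℝ) :
    HasDerivAt (fun b => ∫ u, G b u ∂(powerLaw α)) (∫ u, w u * Real.exp (b * u) ∂(powerLaw α)) b := by
  refine (hasDerivAt_integral_of_dominated_loc_of_deriv_le (Metric.ball_mem_nhds b one_pos)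
    (Filter.Eventually.of_forall fun x => (hG x).1) (hG b)
    (F' := fun b u => w u * Real.exp (b * u)) (hw.1.mul (Continuous.aestronglyMeasurable (by fun_prop)))
    (bound := fun u => ‖w u‖ * Real.exp (|b| + 1)) ?_ (hw.norm.mul_const _)
    (ae_powerLaw.mono fun u hu x _ => hderiv u hu x)).2
  refine ae_powerLaw.mono fun u hu x hx => ?_
  rw [norm_mul, Real.norm_of_nonneg (Real.exp_pos _).le]
  refine mul_le_mul_of_nonneg_left ((exp_mul_le hu).trans (Real.exp_le_exp.2 ?_)) (norm_nonneg _)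
  rw [Metric.mem_ball, Real.dist_eq] at hx
  have := abs_sub_abs_le_abs_sub x b
  linarith

theorem integrable_levyMean (hα1 : α < 1) (b : ℝ) :
    Integrable (fun u : ℝ => u⁻¹ * Real.exp (b * u)) (powerLaw α) := by
  refine ((integrable_inv_powerLaw hα1).norm.mul_const (Real.exp |b|)).mono'
    ((integrable_inv_powerLaw hα1).1.mul (Continuous.aestronglyMeasurable (by fun_prop)))
    (ae_powerLaw.mono fun u hu => ?_)
  rw [norm_mul, Real.norm_of_nonneg (Real.exp_pos _).le]
  exact mul_le_mul_of_nonneg_left (exp_mul_le hu) (norm_nonneg _)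

theorem integrable_complex_levyExponent (hα1 : α < 1) (z : ℂ) :
    Integrable (fun u : ℝ => (Complex.exp (z * u) - 1) / ((u ^ 2 : ℝ) : ℂ)) (powerLaw α) := by
  refine ((integrable_inv_powerLaw hα1).norm.const_mul (‖z‖ * Real.exp ‖z‖)).mono'
    (Measurable.aestronglyMeasurable (by fun_prop)) (ae_powerLaw.mono fun u hu => ?_)
  have hu0 := hu.1
  rw [norm_div, Complex.norm_real, Real.norm_of_nonneg (by positivity), norm_inv,
    Real.norm_of_nonneg hu0.le]
  calc _ ≤ ‖z‖ * Real.exp ‖z‖ * u / u ^ 2 := by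
        gcongr
        exact norm_exp_mul_sub_one_le z hu0.le le_rfl hu.2
    _ = _ := by field_simp

theorem ofReal_levyExponent (b : ℝ) : ((levyExponent α b : ℝ) : ℂ) =
    ∫ u, (Complex.exp (b * (u : ℝ)) - 1) / ((u ^ 2 : ℝ) : ℂ) ∂(powerLaw α) := by
  rw [levyExponent, ← integral_complex_ofReal]
  congr 1; ext u
  push_cast
  rfl

theorem integrable_levyExponent (hα1 : α < 1) (b : ℝ) :
    Integrable (fun u : ℝ => (Real.exp (b * u) - 1) / u ^ 2) (powerLaw α) := by
  refine (integrable_complex_levyExponent hα1 b).re.congr (Filter.Eventually.of_forall fun u => ?_)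
  simp only [RCLike.re_to_complex]
  norm_cast

theorem hasDerivAt_levyExponent (hα1 : α < 1) (b : ℝ) :
    HasDerivAt (levyExponent α) (levyMean α b) b := by
  refine hasDerivAt_integral_powerLaw (integrable_levyExponent hα1) (integrable_inv_powerLaw hα1)
    (fun u hu b => ?_) b
  have hu0 := hu.1.ne'
  have h := ((((hasDerivAt_id b).mul_const u).exp).sub_const 1).div_const (u ^ 2)
  refine h.congr_deriv ?_
  simp only [id]
  field_simp

theorem hasDerivAt_levyMean (hα1 : α < 1) (b : ℝ) :
    HasDerivAt (levyMean α) (powerMoment α 0 b) b := by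
  have := isProbabilityMeasure_powerLaw hα1
  have h := hasDerivAt_integral_powerLaw (α := α) (w := fun _ => 1) (integrable_levyMean hα1)
    (integrable_const 1) (fun u hu b => by
      have hu0 := hu.1.ne'
      have h := (((hasDerivAt_id b).mul_const u).exp).const_mul u⁻¹
      refine h.congr_deriv ?_
      simp only [id]
      field_simp) b
  exact h.congr_deriv (by simp [powerMoment])

theorem hasDerivAt_powerMoment (hα1 : α < 1) (n : ℕ) (b : ℝ) :
    HasDerivAt (powerMoment α n) (powerMoment α (n + 1) b) b := by
  refine hasDerivAt_integral_powerLaw (integrable_pow_mul_exp hα1 n) (w := fun u => u ^ (n + 1))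
    (by simpa using integrable_pow_mul_exp hα1 (n + 1) 0) (fun u hu b => ?_) b
  have h := (((hasDerivAt_id b).mul_const u).exp).const_mul (u ^ n)
  refine h.congr_deriv ?_
  simp only [id]
  ring

theorem strictMono_levyMean (hα1 : α < 1) : StrictMono (levyMean α) :=
  strictMono_of_deriv_pos fun b => by
    rw [(hasDerivAt_levyMean hα1 b).deriv]
    exact powerMoment_zero_pos hα1 b

theorem continuous_levyMean (hα1 : α < 1) : Continuous (levyMean α) :=
  continuous_iff_continuousAt.2 fun b => (hasDerivAt_levyMean hα1 b).continuousAt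

/-- Divide exp(b u) ≥ 1 + b u by u and integrate. It makes the tilted mean unbounded above. -/
theorem levyMean_zero_add_le (hα1 : α < 1) (b : ℝ) : levyMean α 0 + b ≤ levyMean α b := by
  have := isProbabilityMeasure_powerLaw hα1
  have h : levyMean α 0 + b = ∫ u, (u⁻¹ * Real.exp (0 * u) + b) ∂(powerLaw α) := by
    rw [integral_add (integrable_levyMean hα1 0) (integrable_const _)]
    simp [levyMean]
  rw [h]
  refine integral_mono_ae ((integrable_levyMean hα1 0).add (integrable_const _))
    (integrable_levyMean hα1 b) (ae_powerLaw.mono fun u hu => ?_)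
  have hu0 := hu.1
  have h1 := Real.add_one_le_exp (b * u)
  calc u⁻¹ * Real.exp (0 * u) + b = u⁻¹ * (b * u + 1) := by
        rw [zero_mul, Real.exp_zero]; field_simp; ring
    _ ≤ _ := mul_le_mul_of_nonneg_left h1 (by positivity)

theorem tendsto_levyMean_atBot (hα1 : α < 1) :
    Filter.Tendsto (levyMean α) Filter.atBot (nhds 0) := by
  have h := tendsto_integral_filter_of_dominated_convergence (μ := powerLaw α) (l := Filter.atBot)
    (F := fun (b u : ℝ) => u⁻¹ * Real.exp (b * u)) (f := fun _ => 0) (fun u => ‖u⁻¹‖)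
    (Filter.Eventually.of_forall fun b => (integrable_levyMean hα1 b).1) ?_
    (integrable_inv_powerLaw hα1).norm ?_
  · rw [integral_zero] at h
    exact h
  · filter_upwards [Filter.eventually_le_atBot 0] with b hb
    refine ae_powerLaw.mono fun u hu => ?_
    rw [norm_mul, Real.norm_of_nonneg (Real.exp_pos _).le]
    exact mul_le_of_le_one_right (norm_nonneg _)
      (Real.exp_le_one_iff.2 (mul_nonpos_of_nonpos_of_nonneg hb hu.1.le))
  · refine ae_powerLaw.mono fun u hu => ?_
    have h1 : Filter.Tendsto (fun b : ℝ => b * u) Filter.atBot Filter.atBot :=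
      Filter.tendsto_id.atBot_mul_const hu.1
    simpa using (Real.tendsto_exp_atBot.comp h1).const_mul u⁻¹

theorem levyMean_zero_pos (hα1 : α < 1) : 0 < levyMean α 0 := by
  refine lt_of_le_of_lt ?_ (strictMono_levyMean hα1 (show (-1 : ℝ) < 0 by norm_num))
  refine integral_nonneg_of_ae (ae_powerLaw.mono fun u hu => ?_)
  have := hu.1
  simp only [Pi.zero_apply]
  positivity

/-- Intermediate values between the limit 0 at -∞ and linear growth at +∞. All positive values being
attained, the mean equation is solvable for every y above -μ / σ. -/
theorem exists_levyMean_eq (hα1 : α < 1) {v : ℝ} (hv : 0 < v) : ∃ b, levyMean α b = v := by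
  refine mem_range_of_exists_le_of_exists_ge (continuous_levyMean hα1) ?_ ⟨v, ?_⟩
  · exact ((tendsto_levyMean_atBot hα1).eventually_le_const hv).exists
  · linarith [levyMean_zero_add_le hα1 v, levyMean_zero_pos hα1]

/-- The cumulant generating function of the normalised noise. -/
noncomputable def noiseCgf (α ρ x : ℝ) : ℝ :=
  ρ ^ 2 * levyExponent α (x / ρ) - x * (ρ * levyMean α 0)

theorem hasDerivAt_noiseCgf (hα1 : α < 1) {ρ : ℝ} (hρ : 0 < ρ) (x : ℝ) :
    HasDerivAt (noiseCgf α ρ) (ρ * (levyMean α (x / ρ) - levyMean α 0)) x := by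
  have h1 : HasDerivAt (fun x => x / ρ) (1 / ρ) x := (hasDerivAt_id x).div_const ρ
  have h2 := (((hasDerivAt_levyExponent hα1 (x / ρ)).comp x h1).const_mul (ρ ^ 2)).sub
    ((hasDerivAt_id x).mul_const (ρ * levyMean α 0))
  refine h2.congr_deriv ?_
  field_simp

theorem iteratedDeriv_noiseCgf (hα1 : α < 1) {ρ : ℝ} (hρ : 0 < ρ) (n : ℕ) :
    iteratedDeriv (n + 2) (noiseCgf α ρ) = fun x => powerMoment α n (x / ρ) / ρ ^ n := by
  have hx : ∀ x, HasDerivAt (fun x => x / ρ) (1 / ρ) x := fun x => (hasDerivAt_id x).div_const ρ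
  induction n with
  | zero =>
    have h1 : deriv (noiseCgf α ρ) = fun x => ρ * (levyMean α (x / ρ) - levyMean α 0) :=
      funext fun x => (hasDerivAt_noiseCgf hα1 hρ x).deriv
    rw [iteratedDeriv_succ, iteratedDeriv_one, h1]
    funext x
    have h2 := (((hasDerivAt_levyMean hα1 (x / ρ)).comp x (hx x)).sub_const (levyMean α 0)).const_mul ρ
    refine HasDerivAt.deriv (h2.congr_deriv ?_)
    field_simp
  | succ n ih =>
    rw [iteratedDeriv_succ, ih]
    funext x
    have h2 := ((hasDerivAt_powerMoment hα1 n (x / ρ)).comp x (hx x)).div_const (ρ ^ n)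
    refine HasDerivAt.deriv (h2.congr_deriv ?_)
    rw [pow_succ]
    field_simp

/-- The tangent line inequality, from exp x ≥ 1 + x under the integral. When the slope at ξ is y, it
makes ξ a global minimiser. -/
theorem noiseCgf_add_le (hα1 : α < 1) {ρ : ℝ} (hρ : 0 < ρ) (ξ x : ℝ) :
    noiseCgf α ρ ξ + (x - ξ) * (ρ * (levyMean α (ξ / ρ) - levyMean α 0)) ≤ noiseCgf α ρ x := by
  have h1 : levyExponent α (ξ / ρ) + (x - ξ) / ρ * levyMean α (ξ / ρ) ≤ levyExponent α (x / ρ) := by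
    rw [levyExponent, levyMean, ← integral_const_mul, ← integral_add (integrable_levyExponent hα1 _)
      ((integrable_levyMean hα1 _).const_mul _)]
    refine integral_mono_ae ((integrable_levyExponent hα1 _).add
      ((integrable_levyMean hα1 _).const_mul _)) (integrable_levyExponent hα1 _)
      (ae_powerLaw.mono fun u hu => ?_)
    have hu0 := hu.1
    have h2 := Real.add_one_le_exp ((x - ξ) / ρ * u)
    have h3 : Real.exp (x / ρ * u) = Real.exp (ξ / ρ * u) * Real.exp ((x - ξ) / ρ * u) := by
      rw [← Real.exp_add]; congr 1; ring
    calc (Real.exp (ξ / ρ * u) - 1) / u ^ 2 + (x - ξ) / ρ * (u⁻¹ * Real.exp (ξ / ρ * u))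
        = (Real.exp (ξ / ρ * u) * ((x - ξ) / ρ * u + 1) - 1) / u ^ 2 := by field_simp; ring
      _ ≤ (Real.exp (ξ / ρ * u) * Real.exp ((x - ξ) / ρ * u) - 1) / u ^ 2 := by gcongr
      _ = _ := by rw [← h3]
  calc _ = ρ ^ 2 * (levyExponent α (ξ / ρ) + (x - ξ) / ρ * levyMean α (ξ / ρ)) -
        x * (ρ * levyMean α 0) := by
        rw [noiseCgf]; field_simp; ring
    _ ≤ _ := by rw [noiseCgf]; gcongr

end LevyExponent

/-! ### Tilting and the saddle point formula -/

section Law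

/-- `Q` is a law on the line with the moment generating function of the normalised noise. -/
structure IsNoiseLaw (α ρ : ℝ) (Q : Measure ℝ) : Prop where
  isProbabilityMeasure : IsProbabilityMeasure Q
  integrable_exp : ∀ t : ℝ, Integrable (fun x => Real.exp (t * x)) Q
  integral_exp : ∀ z : ℂ, ∫ x, Complex.exp (z * (x : ℝ)) ∂Q =
    Complex.exp (((ρ ^ 2 : ℝ) : ℂ) * (∫ u, (Complex.exp (z / ρ * (u : ℝ)) - 1) /
      ((u ^ 2 : ℝ) : ℂ) ∂(powerLaw α)) - z * ((ρ * levyMean α 0 : ℝ) : ℂ))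

variable {α ρ : ℝ} {Q : Measure ℝ}

theorem IsNoiseLaw.mgf_eq (h : IsNoiseLaw α ρ Q) (t : ℝ) :
    ∫ x, Real.exp (t * x) ∂Q = Real.exp (noiseCgf α ρ t) := by
  have h1 := h.integral_exp t
  have h2 : ∫ x, Complex.exp ((t : ℂ) * (x : ℝ)) ∂Q = ((∫ x, Real.exp (t * x) ∂Q : ℝ) : ℂ) := by
    rw [← integral_complex_ofReal]
    push_cast
    rfl
  rw [h2] at h1
  have h3 := ofReal_levyExponent (α := α) (t / ρ)
  push_cast at h3
  rw [show (fun u : ℝ => (Complex.exp ((t : ℂ) / ρ * (u : ℝ)) - 1) / ((u ^ 2 : ℝ) : ℂ)) =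
    fun u : ℝ => (Complex.exp ((t : ℂ) / ρ * (u : ℝ)) - 1) / (u : ℂ) ^ 2 by
      funext u; push_cast; rfl, ← h3] at h1
  rw [noiseCgf]
  exact_mod_cast h1

theorem IsNoiseLaw.integrableExpSet_eq (h : IsNoiseLaw α ρ Q) : integrableExpSet id Q = univ :=
  eq_univ_of_forall fun t => h.integrable_exp t

theorem IsNoiseLaw.cgf_eq (h : IsNoiseLaw α ρ Q) : cgf id Q = noiseCgf α ρ := by
  funext t
  have : mgf id Q t = Real.exp (noiseCgf α ρ t) := h.mgf_eq t
  rw [cgf, this, Real.log_exp]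

theorem IsNoiseLaw.isProbabilityMeasure_tilted (h : IsNoiseLaw α ρ Q) (ξ : ℝ) :
    IsProbabilityMeasure (Q.tilted fun z => ξ * z) := by
  have := h.isProbabilityMeasure
  exact MeasureTheory.isProbabilityMeasure_tilted (h.integrable_exp ξ)

theorem IsNoiseLaw.cgf_tilted (h : IsNoiseLaw α ρ Q) (ξ : ℝ) :
    cgf id (Q.tilted fun z => ξ * z) = fun t => noiseCgf α ρ (ξ + t) - noiseCgf α ρ ξ := by
  funext t
  have h1 : mgf id (Q.tilted fun z => ξ * z) t =
      Real.exp (noiseCgf α ρ (ξ + t) - noiseCgf α ρ ξ) := by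
    have h2 := integral_exp_tilted (μ := Q) (fun z => ξ * z) (fun z => t * z)
    rw [mgf]
    refine h2.trans ?_
    simp only [Pi.add_apply, ← add_mul]
    rw [h.mgf_eq, h.mgf_eq, Real.exp_sub]
  rw [cgf, h1, Real.log_exp]

theorem IsNoiseLaw.integral_tilted (h : IsNoiseLaw α ρ Q) (hα1 : α < 1) (hρ : 0 < ρ) (ξ : ℝ) :
    ∫ z, z ∂(Q.tilted fun z => ξ * z) = ρ * (levyMean α (ξ / ρ) - levyMean α 0) := by
  have h1 := integral_tilted_mul_self (X := id) (μ := Q) (t := ξ)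
    (by rw [h.integrableExpSet_eq, interior_univ]; trivial)
  rw [h.cgf_eq, (hasDerivAt_noiseCgf hα1 hρ ξ).deriv] at h1
  exact h1

theorem IsNoiseLaw.variance_tilted (h : IsNoiseLaw α ρ Q) (hα1 : α < 1) (hρ : 0 < ρ) (ξ : ℝ) :
    variance id (Q.tilted fun z => ξ * z) = powerMoment α 0 (ξ / ρ) := by
  have h1 := variance_tilted_mul (X := id) (μ := Q) (t := ξ)
    (by rw [h.integrableExpSet_eq, interior_univ]; trivial)
  rw [h.cgf_eq, iteratedDeriv_noiseCgf hα1 hρ 0] at h1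
  simpa using h1

theorem IsNoiseLaw.iteratedDeriv_cgf_tilted (h : IsNoiseLaw α ρ Q) (hα1 : α < 1) (hρ : 0 < ρ)
    (ξ : ℝ) {n : ℕ} (hn : 2 ≤ n) :
    iteratedDeriv n (cgf id (Q.tilted fun z => ξ * z)) 0 =
      powerMoment α (n - 2) (ξ / ρ) / ρ ^ (n - 2) := by
  obtain ⟨m, rfl⟩ : ∃ m, n = m + 2 := ⟨n - 2, by omega⟩
  rw [h.cgf_tilted, Nat.add_sub_cancel]
  have h1 : deriv (fun t => noiseCgf α ρ (ξ + t) - noiseCgf α ρ ξ) =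
      deriv (fun t => noiseCgf α ρ (ξ + t)) := by
    funext t
    rw [deriv_sub_const]
  rw [iteratedDeriv_succ', h1, ← iteratedDeriv_succ', iteratedDeriv_comp_const_add,
    iteratedDeriv_noiseCgf hα1 hρ]
  simp

/-- Subtract the Lévy exponent at ξ / ρ from its value at (ξ + i t) / ρ. The part linear in t gives
the phase of the mean, and the rest is the centred exponent for the tilt ξ / ρ. -/
theorem IsNoiseLaw.charFun_tilted (h : IsNoiseLaw α ρ Q) (hα1 : α < 1) (hρ : 0 < ρ) (ξ t : ℝ) :
    charFun (Q.tilted fun z => ξ * z) t =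
      Complex.exp ((t * (ρ * (levyMean α (ξ / ρ) - levyMean α 0)) : ℝ) * Complex.I) *
        Complex.exp ((ρ ^ 2 : ℝ) * centredExponent α (ξ / ρ) (ρ⁻¹ * t)) := by
  have hρ' : (ρ : ℂ) ≠ 0 := by exact_mod_cast hρ.ne'
  rw [charFun_apply_real, MeasureTheory.integral_tilted, h.mgf_eq]
  have h1 : ∀ x : ℝ, (Real.exp (ξ * x) / Real.exp (noiseCgf α ρ ξ)) • Complex.exp (t * x * Complex.I) =
      Complex.exp (-(noiseCgf α ρ ξ : ℝ)) * Complex.exp ((ξ + t * Complex.I) * x) := fun x => by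
    rw [Complex.real_smul, ← Real.exp_sub, Complex.ofReal_exp, ← Complex.exp_add, ← Complex.exp_add]
    congr 1
    push_cast
    ring
  simp only [h1]
  rw [integral_const_mul, h.integral_exp, ← Complex.exp_add, ← Complex.exp_add]
  congr 1
  have hi1 := integrable_complex_levyExponent hα1 (((ξ : ℂ) + t * Complex.I) / ρ)
  have hi2 := integrable_complex_levyExponent hα1 ((ξ / ρ : ℝ) : ℂ)
  have hi12 : Integrable (fun u : ℝ => (Complex.exp (((ξ : ℂ) + t * Complex.I) / ρ * (u : ℝ)) - 1) /
      ((u ^ 2 : ℝ) : ℂ) - (Complex.exp (((ξ / ρ : ℝ) : ℂ) * (u : ℝ)) - 1) / ((u ^ 2 : ℝ) : ℂ))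
      (powerLaw α) := hi1.sub hi2
  have hi3 : Integrable (fun u : ℝ => ((t / ρ : ℝ) : ℂ) * Complex.I *
      ((u⁻¹ * Real.exp (ξ / ρ * u) : ℝ) : ℂ)) (powerLaw α) :=
    (integrable_levyMean hα1 (ξ / ρ)).ofReal.const_mul _
  have h2 : centredExponent α (ξ / ρ) (ρ⁻¹ * t) =
      (∫ u, (Complex.exp (((ξ : ℂ) + t * Complex.I) / ρ * (u : ℝ)) - 1) /
        ((u ^ 2 : ℝ) : ℂ) ∂(powerLaw α)) - (levyExponent α (ξ / ρ) : ℝ) -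
        (t / ρ : ℝ) * Complex.I * (levyMean α (ξ / ρ) : ℝ) := by
    rw [ofReal_levyExponent, levyMean, ← integral_complex_ofReal, ← integral_const_mul,
      ← integral_sub hi1 hi2, ← integral_sub hi12 hi3, centredExponent]
    refine integral_congr_ae (ae_powerLaw.mono fun u hu => ?_)
    have hu0 : (u : ℂ) ≠ 0 := by exact_mod_cast hu.1.ne'
    have h3 : Complex.exp (((ξ : ℂ) + t * Complex.I) / ρ * (u : ℝ)) =
        Complex.exp ((ξ : ℂ) / ρ * u) * Complex.exp (Complex.I * (((ρ : ℂ)⁻¹ * t) * u)) := by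
      rw [← Complex.exp_add]; congr 1; field_simp
    simp only [h3]
    push_cast
    field_simp
    ring
  rw [h2, noiseCgf]
  push_cast
  field_simp
  ring

/-- Evaluating the inversion integral at the tilted mean cancels the phase and leaves only the
centred exponent. -/
theorem IsNoiseLaw.exists_density_tilted (h : IsNoiseLaw α ρ Q) (hα0 : 0 < α) (hα1 : α < 1)
    (hρ : 0 < ρ) (ξ : ℝ) :
    ∃ f : ℝ → ℝ, Continuous f ∧ (∀ x, 0 ≤ f x) ∧
      (Q.tilted fun z => ξ * z) = volume.withDensity (fun x => ENNReal.ofReal (f x)) ∧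
      (f (ρ * (levyMean α (ξ / ρ) - levyMean α 0)) : ℂ) = ((ρ / (2 * Real.pi) : ℝ) : ℂ) *
        ∫ t : ℝ, Complex.exp ((ρ ^ 2 : ℝ) * centredExponent α (ξ / ρ) t) := by
  have := h.isProbabilityMeasure_tilted ξ
  have hmeas := measurable_centredExponent hα1 (ξ / ρ)
  have hint : Integrable (charFun (Q.tilted fun z => ξ * z)) := by
    have h1 := (integrable_exp_centredExponent hα0 hα1 hρ (ξ / ρ)).comp_mul_left' (inv_ne_zero hρ.ne')
    refine h1.mono (measurable_charFun.aestronglyMeasurable) (Filter.Eventually.of_forall fun t => ?_)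
    rw [h.charFun_tilted hα1 hρ, norm_mul, Complex.norm_exp_ofReal_mul_I, one_mul]
  obtain ⟨f, hf, hf0, hQ, hx⟩ := exists_continuous_density hint
  refine ⟨f, hf, hf0, hQ, ?_⟩
  rw [hx]
  set y := ρ * (levyMean α (ξ / ρ) - levyMean α 0) with hy
  have h2 : ∀ t : ℝ, charFun (Q.tilted fun z => ξ * z) t * Complex.exp (-(t * y * Complex.I)) =
      Complex.exp ((ρ ^ 2 : ℝ) * centredExponent α (ξ / ρ) (ρ⁻¹ * t)) := fun t => by
    rw [h.charFun_tilted hα1 hρ, ← hy, mul_right_comm, ← Complex.exp_add]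
    push_cast
    rw [add_neg_cancel, Complex.exp_zero, one_mul]
  simp only [h2]
  rw [Measure.integral_comp_mul_left
    (fun t => Complex.exp ((ρ ^ 2 : ℝ) * centredExponent α (ξ / ρ) t)) ρ⁻¹, inv_inv,
    abs_of_pos hρ, Complex.real_smul]
  push_cast
  ring

/-- The saddle point representation of the density. -/
theorem IsNoiseLaw.exists_density (h : IsNoiseLaw α ρ Q) (hα0 : 0 < α) (hα1 : α < 1)
    (hρ : 0 < ρ) :
    ∃ f : ℝ → ℝ, Continuous f ∧ (∀ x, 0 ≤ f x) ∧
      Q = volume.withDensity (fun x => ENNReal.ofReal (f x)) ∧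
      ∀ ξ y : ℝ, ρ * (levyMean α (ξ / ρ) - levyMean α 0) = y → ∃ g : ℝ,
        f y = Real.exp (-ξ * y) * Real.exp (noiseCgf α ρ ξ) * g ∧
        (g : ℂ) = ((ρ / (2 * Real.pi) : ℝ) : ℂ) *
          ∫ t : ℝ, Complex.exp ((ρ ^ 2 : ℝ) * centredExponent α (ξ / ρ) t) := by
  have := h.isProbabilityMeasure
  obtain ⟨f, hf, hf0, hQ, -⟩ := h.exists_density_tilted hα0 hα1 hρ 0
  have h0 : (Q.tilted fun z => (0 : ℝ) * z) = Q := by simp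
  rw [h0] at hQ
  refine ⟨f, hf, hf0, hQ, ?_⟩
  rintro ξ y rfl
  obtain ⟨g, hg, hg0, hQg, hgy⟩ := h.exists_density_tilted hα0 hα1 hρ ξ
  refine ⟨g (ρ * (levyMean α (ξ / ρ) - levyMean α 0)), ?_, hgy⟩
  have h1 : (Q.tilted fun z => ξ * z) = volume.withDensity (fun x =>
      ENNReal.ofReal (f x * Real.exp (ξ * x - noiseCgf α ρ ξ))) := by
    rw [Measure.tilted, h.mgf_eq]
    conv_lhs => rw [hQ]
    rw [← withDensity_mul _ (by fun_prop) (by fun_prop)]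
    congr 1; ext x
    rw [Pi.mul_apply, ← ENNReal.ofReal_mul (hf0 x), Real.exp_sub]
  have h2 : (fun x => ENNReal.ofReal (g x)) =ᵐ[volume]
      fun x => ENNReal.ofReal (f x * Real.exp (ξ * x - noiseCgf α ρ ξ)) := by
    rw [← withDensity_eq_iff_of_sigmaFinite (by fun_prop) (by fun_prop), ← hQg, h1]
  -- Densities of one measure agree almost everywhere; continuity upgrades this to every point, as
  -- evaluation at a single y requires.
  have h3 : g = fun x => f x * Real.exp (ξ * x - noiseCgf α ρ ξ) := by
    refine (Continuous.ae_eq_iff_eq volume hg (by fun_prop)).1 (h2.mono fun x hx => ?_)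
    have h4 := congrArg ENNReal.toReal hx
    rwa [ENNReal.toReal_ofReal (hg0 x), ENNReal.toReal_ofReal
      (mul_nonneg (hf0 x) (Real.exp_pos _).le)] at h4
  rw [h3]
  generalize ρ * (levyMean α (ξ / ρ) - levyMean α 0) = y
  have h5 : Real.exp (-ξ * y) * Real.exp (noiseCgf α ρ ξ) * Real.exp (ξ * y - noiseCgf α ρ ξ) = 1 := by
    rw [← Real.exp_add, ← Real.exp_add, ← Real.exp_zero]; congr 1; ring
  calc f y = f y * (Real.exp (-ξ * y) * Real.exp (noiseCgf α ρ ξ) *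
        Real.exp (ξ * y - noiseCgf α ρ ξ)) := by rw [h5, mul_one]
    _ = _ := by ring

end Law

/-! ### Mean, variance and law of the normalised noise -/

section NormalisedNoise

theorem one_le_rho (d : ℕ) {r : ℝ} (hr : 1 ≤ r) : 1 ≤ rho d r :=
  Real.one_le_rpow hr (by positivity)

theorem div_lt_one_of_lt {d : ℕ} {γ : ℝ} (hγ : (d : ℝ) < γ) : (d : ℝ) / γ < 1 := by
  rwa [div_lt_one (lt_of_le_of_lt (Nat.cast_nonneg _) hγ)]

theorem tkappa_eq_powerMoment {d : ℕ} {γ : ℝ} (hα1 : (d : ℝ) / γ < 1) (r ξ : ℝ) {n : ℕ}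
    (hn : 2 ≤ n) : tkappa d γ r ξ n = powerMoment (d / γ) (n - 2) (ξ / rho d r) := by
  obtain ⟨m, rfl⟩ : ∃ m, n = m + 2 := ⟨n - 2, by omega⟩
  rw [tkappa, dOne, powerMoment, integral_powerLaw hα1, intervalIntegral.integral_of_le zero_le_one,
    ← integral_const_mul, Nat.add_sub_cancel]
  refine setIntegral_congr_fun measurableSet_Ioc fun u hu => ?_
  simp only [smul_eq_mul]
  rw [show ((m + 2 : ℕ) : ℝ) - 1 - d / γ = (1 - d / γ) + (m : ℕ) by push_cast; ring,
    Real.rpow_add_natCast hu.1.ne', show ξ * u / rho d r = ξ / rho d r * u by ring]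
  ring

variable {Ω : Type*} [MeasurableSpace Ω] {P : Measure Ω} {d : ℕ}
  {Φ : Ω → Set (EuclideanSpace ℝ (Fin d))} {γ r : ℝ}
  (hd : 1 ≤ d) (hγ : (d : ℝ) < γ) (h : IsHomogeneousPoisson P Φ (intensity d γ)) (hr : 1 ≤ r)
include hd hγ h hr

theorem IsHomogeneousPoisson.cgf_tailNoise : cgf (tailNoise Φ γ r) P =
    fun t => rho d r ^ 2 * levyExponent (d / γ) (r ^ (-γ) * t) := by
  funext t
  have h1 := h.integral_exp_tailNoise hd hγ hr t
  have h2 : ∫ ω, Complex.exp ((t : ℂ) * tailNoise Φ γ r ω) ∂P =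
      ((mgf (tailNoise Φ γ r) P t : ℝ) : ℂ) := by
    rw [mgf, ← integral_complex_ofReal]
    push_cast
    rfl
  have h3 : ∫ u, (Complex.exp (t * (r ^ (-γ) * u : ℝ)) - 1) / ((u ^ 2 : ℝ) : ℂ)
      ∂(powerLaw (d / γ)) = (levyExponent (d / γ) (r ^ (-γ) * t) : ℝ) := by
    rw [ofReal_levyExponent]
    congr 1; ext u
    congr 3
    push_cast
    ring
  rw [h2, h3] at h1
  have h4 : mgf (tailNoise Φ γ r) P t =
      Real.exp (rho d r ^ 2 * levyExponent (d / γ) (r ^ (-γ) * t)) := by exact_mod_cast h1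
  rw [cgf, h4, Real.log_exp]

theorem IsHomogeneousPoisson.mem_interior_integrableExpSet (t : ℝ) :
    t ∈ interior (integrableExpSet (tailNoise Φ γ r) P) := by
  rw [eq_univ_of_forall (s := integrableExpSet (tailNoise Φ γ r) P)
    fun t => h.integrable_exp_tailNoise hd hγ hr t, interior_univ]
  trivial

theorem IsHomogeneousPoisson.aemeasurable_normNoise : AEMeasurable (normNoise P Φ γ r) P :=
  ((h.aemeasurable_tailNoise hd hγ hr).sub_const _).div_const _

theorem IsHomogeneousPoisson.integrable_exp_normNoise (t : ℝ) :
    Integrable (fun ω => Real.exp (t * normNoise P Φ γ r ω)) P := by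
  refine ((h.integrable_exp_tailNoise hd hγ hr (t / noiseStd P Φ γ r)).const_mul
    (Real.exp (-(t * noiseMean P Φ γ r / noiseStd P Φ γ r)))).congr
    (Filter.Eventually.of_forall fun ω => ?_)
  change _ * _ = _
  rw [← Real.exp_add]
  simp only [normNoise]
  congr 1
  ring

theorem IsHomogeneousPoisson.memLp_tailNoise : MemLp (tailNoise Φ γ r) 2 P :=
  memLp_of_mem_interior_integrableExpSet (h.mem_interior_integrableExpSet hd hγ hr 0) 2

theorem IsHomogeneousPoisson.deriv_cgf_tailNoise : deriv (cgf (tailNoise Φ γ r) P) =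
    fun t => rho d r ^ 2 * (levyMean (d / γ) (r ^ (-γ) * t) * r ^ (-γ)) := by
  rw [h.cgf_tailNoise hd hγ hr]
  funext t
  exact (((hasDerivAt_levyExponent (div_lt_one_of_lt hγ) _).comp t
    ((hasDerivAt_id t).const_mul (r ^ (-γ)))).const_mul _).deriv.trans (by simp)

variable [IsProbabilityMeasure P]

theorem IsHomogeneousPoisson.noiseMean_eq : noiseMean P Φ γ r =
    rho d r ^ 2 * (levyMean (d / γ) 0 * r ^ (-γ)) := by
  have h1 := deriv_cgf_zero (h.mem_interior_integrableExpSet hd hγ hr 0)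
  rw [h.deriv_cgf_tailNoise hd hγ hr, probReal_univ, div_one] at h1
  simp only [mul_zero] at h1
  exact h1.symm

/-- The variance is the second derivative of the cumulant generating function at 0, read off from
tilting by 0. No constant remains because the intensity makes the power law a probability measure.
-/
theorem IsHomogeneousPoisson.noiseStd_eq : noiseStd P Φ γ r = rho d r * r ^ (-γ) := by
  have h1 := variance_tilted_mul (h.mem_interior_integrableExpSet hd hγ hr 0)
  have h2 : (P.tilted fun ω => 0 * tailNoise Φ γ r ω) = P := by simp
  have h3 := ((((hasDerivAt_levyMean (div_lt_one_of_lt hγ) _).comp (0 : ℝ)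
    ((hasDerivAt_id (0 : ℝ)).const_mul (r ^ (-γ)))).mul_const (r ^ (-γ))).const_mul (rho d r ^ 2)).deriv
  rw [h2, iteratedDeriv_succ, iteratedDeriv_one, h.deriv_cgf_tailNoise hd hγ hr] at h1
  have h4 : 0 ≤ rho d r * r ^ (-γ) :=
    mul_nonneg (by linarith [one_le_rho d hr]) (Real.rpow_nonneg (by linarith) _)
  rw [noiseStd, h1, ← Real.sqrt_sq h4]
  congr 1
  refine h3.trans ?_
  rw [id, mul_zero, powerMoment_zero_zero (div_lt_one_of_lt hγ)]
  ring

theorem IsHomogeneousPoisson.noiseStd_pos : 0 < noiseStd P Φ γ r := by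
  rw [h.noiseStd_eq hd hγ hr]
  exact mul_pos (by linarith [one_le_rho d hr]) (Real.rpow_pos_of_pos (by linarith) _)

/-- Hence y > -μ / σ says exactly that y / ρ + `levyMean` at 0 is positive, the solvability
condition for the mean equation. -/
theorem IsHomogeneousPoisson.noiseMean_div_noiseStd :
    noiseMean P Φ γ r / noiseStd P Φ γ r = rho d r * levyMean (d / γ) 0 := by
  have h1 := h.noiseStd_pos hd hγ hr
  rw [div_eq_iff h1.ne', h.noiseStd_eq hd hγ hr, h.noiseMean_eq hd hγ hr]
  ring

theorem IsHomogeneousPoisson.isNoiseLaw :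
    IsNoiseLaw (d / γ) (rho d r) (P.map (normNoise P Φ γ r)) := by
  have hY := h.aemeasurable_normNoise hd hγ hr
  refine ⟨Measure.isProbabilityMeasure_map hY, fun t => ?_, fun z => ?_⟩
  · rw [integrable_map_measure (Continuous.aestronglyMeasurable (by fun_prop)) hY]
    exact h.integrable_exp_normNoise hd hγ hr t
  · rw [integral_map hY (Continuous.aestronglyMeasurable (by fun_prop))]
    have hρ : rho d r ≠ 0 := by linarith [one_le_rho d hr]
    have hρ' : ((rho d r : ℝ) : ℂ) ≠ 0 := by exact_mod_cast hρ
    have hc : r ^ (-γ) ≠ 0 := (Real.rpow_pos_of_pos (by linarith) _).ne'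
    have hc' : ((r ^ (-γ) : ℝ) : ℂ) ≠ 0 := by exact_mod_cast hc
    have h1 : ∀ ω, Complex.exp (z * (normNoise P Φ γ r ω : ℝ)) =
        Complex.exp (-(z * ((rho d r * levyMean (d / γ) 0 : ℝ) : ℂ))) *
          Complex.exp (z / (rho d r * r ^ (-γ) : ℝ) * (tailNoise Φ γ r ω : ℝ)) := fun ω => by
      rw [← Complex.exp_add, normNoise, sub_div, h.noiseMean_div_noiseStd hd hγ hr,
        h.noiseStd_eq hd hγ hr]
      congr 1
      push_cast
      ring
    simp only [h1]
    rw [integral_const_mul, h.integral_exp_tailNoise hd hγ hr, ← Complex.exp_add, neg_add_eq_sub]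
    congr 3
    refine integral_congr_ae (Filter.Eventually.of_forall fun u => ?_)
    simp only
    congr 3
    push_cast at hc' ⊢
    field_simp

theorem IsHomogeneousPoisson.laplace_normNoise (x : ℝ) :
    laplace P (normNoise P Φ γ r) (-x) = Real.exp (noiseCgf (d / γ) (rho d r) x) := by
  rw [← (h.isNoiseLaw hd hγ hr).mgf_eq, integral_map (h.aemeasurable_normNoise hd hγ hr)
    (Continuous.aestronglyMeasurable (by fun_prop)), laplace, neg_neg]

end NormalisedNoise

/-! ### Relative error and conclusion -/

/-- A bound on the relative error from the expansion of the saddle point integral. -/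
theorem exists_relative_error {κ : ℕ → ℝ} {ρ δ g : ℝ} {k : ℕ} {J : ℂ}
    (hκ : 0 < κ 2) (h1 : |Real.sqrt (κ 2) * Real.sqrt (2 * Real.pi) * edgeworthTerm κ ρ k - 1| ≤ 1 / 2)
    (h2 : ‖((1 / Real.sqrt (2 * Real.pi) : ℝ) : ℂ) * (((Real.sqrt (κ 2) * ρ : ℝ) : ℂ) * J) -
      ((Real.sqrt (κ 2) * Real.sqrt (2 * Real.pi) * edgeworthTerm κ ρ k : ℝ) : ℂ)‖ ≤ δ)
    (hg : (g : ℂ) = ((ρ / (2 * Real.pi) : ℝ) : ℂ) * J) :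
    ∃ ε : ℝ, g = edgeworthTerm κ ρ k * (1 + ε) ∧ |ε| ≤ 2 * δ := by
  set a := Real.sqrt (κ 2) * Real.sqrt (2 * Real.pi) with ha
  set E := edgeworthTerm κ ρ k
  have hpi : 0 < Real.sqrt (2 * Real.pi) := Real.sqrt_pos.2 (by positivity)
  have ha0 : 0 < a := mul_pos (Real.sqrt_pos.2 hκ) hpi
  have h3 : ((1 / Real.sqrt (2 * Real.pi) : ℝ) : ℂ) * (((Real.sqrt (κ 2) * ρ : ℝ) : ℂ) * J) =
      ((a * g : ℝ) : ℂ) := by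
    have h4 : 1 / Real.sqrt (2 * Real.pi) * (Real.sqrt (κ 2) * ρ) = a * (ρ / (2 * Real.pi)) := by
      rw [ha]
      nth_rewrite 3 [← Real.sq_sqrt (show 0 ≤ 2 * Real.pi by positivity)]
      field_simp
    rw [Complex.ofReal_mul a, hg, ← mul_assoc, ← mul_assoc, ← Complex.ofReal_mul,
      ← Complex.ofReal_mul, h4]
  rw [h3, ← Complex.ofReal_sub, Complex.norm_real, Real.norm_eq_abs] at h2
  -- The normalised Edgeworth term is at least 1/2, so dividing by it at most doubles the error.
  have h5 : 1 / 2 ≤ a * E := by linarith [(abs_le.1 h1).1]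
  have hE : E ≠ 0 := by
    intro h0
    rw [h0, mul_zero] at h5
    linarith
  refine ⟨g / E - 1, by field_simp; ring, ?_⟩
  have h6 : g / E - 1 = (a * g - a * E) / (a * E) := by field_simp
  rw [h6, abs_div, abs_of_pos (by linarith : 0 < a * E), div_le_iff₀ (by linarith)]
  have h7 : 0 ≤ δ := (abs_nonneg _).trans h2
  nlinarith

end ShotNoise

theorem theorem1 (d : ℕ) (hd : 1 ≤ d) (γ : ℝ) (hγ : (d : ℝ) < γ) :
    ∃ C₂ C₃ C₄ : ℝ, 0 < C₂ ∧ 0 < C₃ ∧ 0 < C₄ ∧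
      ∀ (Ω : Type*) [MeasurableSpace Ω] (P : Measure Ω) [IsProbabilityMeasure P]
        (Φ : Ω → Set (EuclideanSpace ℝ (Fin d))),
        ShotNoise.IsHomogeneousPoisson P Φ (ShotNoise.intensity d γ) →
      ∀ r : ℝ, 1 ≤ r →
        -- the objects of the statement are well defined
        (∀ᵐ ω ∂P, Summable (fun k : ℕ => ShotNoise.tailTerm Φ γ r (k + 1) ω)) ∧
        MemLp (ShotNoise.tailNoise Φ γ r) 2 P ∧
        0 < ShotNoise.noiseStd P Φ γ r ∧
        (∀ t : ℝ, Integrable (fun ω => Real.exp (-t * ShotNoise.normNoise P Φ γ r ω)) P) ∧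
        -- the (unique) continuous density of the normalised tail shot noise
        ∃ f : ℝ → ℝ, Continuous f ∧ (∀ z, 0 ≤ f z) ∧
          P.map (ShotNoise.normNoise P Φ γ r) =
            (volume : Measure ℝ).withDensity (fun z => ENNReal.ofReal (f z)) ∧
          ∀ y : ℝ, -(ShotNoise.noiseMean P Φ γ r / ShotNoise.noiseStd P Φ γ r) < y →
            -- the tilting parameter is the unique minimiser
            ∃ ξ : ℝ, (∀ ξ' : ℝ, IsMinOn (fun x : ℝ => Real.exp (-x * y) *
                ShotNoise.laplace P (ShotNoise.normNoise P Φ γ r) (-x)) univ ξ' ↔ ξ' = ξ) ∧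
              -- mean, variance and cumulants of the tilted law
              (∫ z, z ∂(ShotNoise.tiltedLaw P (ShotNoise.normNoise P Φ γ r) ξ) = y) ∧
              variance id (ShotNoise.tiltedLaw P (ShotNoise.normNoise P Φ γ r) ξ) =
                ShotNoise.tkappa d γ r ξ 2 ∧
              (∀ n : ℕ, 2 ≤ n →
                iteratedDeriv n
                    (cgf id (ShotNoise.tiltedLaw P (ShotNoise.normNoise P Φ γ r) ξ)) 0 =
                  ShotNoise.tkappa d γ r ξ n / ShotNoise.rho d r ^ (n - 2)) ∧
              -- the upper tail
              (∀ k : ℕ, 0 ≤ y → C₄ * Real.sqrt k ≤ ShotNoise.rho d r →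
                ∃ ε : ℝ,
                  f y = ShotNoise.edgeworthTerm (ShotNoise.tkappa d γ r ξ)
                      (ShotNoise.rho d r) k * Real.exp (-ξ * y) *
                    ShotNoise.laplace P (ShotNoise.normNoise P Φ γ r) (-ξ) * (1 + ε) ∧
                  |ε| ≤ C₂ * C₃ ^ k * (k : ℝ) ^ ((k : ℝ) / 2) /
                    (Real.sqrt (ShotNoise.tkappa d γ r ξ 2) * ShotNoise.rho d r) ^ (k + 1) ∧
                  C₂ * C₃ ^ k * (k : ℝ) ^ ((k : ℝ) / 2) /
                      (Real.sqrt (ShotNoise.tkappa d γ r ξ 2) * ShotNoise.rho d r) ^ (k + 1) ≤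
                    C₂ * C₃ ^ k * (k : ℝ) ^ ((k : ℝ) / 2) / ShotNoise.rho d r ^ (k + 1)) ∧
              -- the lower tail
              (∀ k : ℕ, y ≤ 0 → max (C₄ * Real.sqrt k) (k : ℝ) ≤ ShotNoise.rho d r →
                ∃ ε : ℝ,
                  f y = ShotNoise.edgeworthTerm (ShotNoise.tkappa d γ r ξ)
                      (ShotNoise.rho d r) k * Real.exp (-ξ * y) *
                    ShotNoise.laplace P (ShotNoise.normNoise P Φ γ r) (-ξ) * (1 + ε) ∧
                  |ε| ≤ C₂ * C₃ ^ k * (k : ℝ) ^ ((k : ℝ) / 2) *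
                    (ShotNoise.tkappa d γ r ξ 2 ^ (1 / ShotNoise.dOne d γ - 1 / 2) /
                      ShotNoise.rho d r) ^ (k + 1) ∧
                  C₂ * C₃ ^ k * (k : ℝ) ^ ((k : ℝ) / 2) *
                      (ShotNoise.tkappa d γ r ξ 2 ^ (1 / ShotNoise.dOne d γ - 1 / 2) /
                        ShotNoise.rho d r) ^ (k + 1) ≤
                    C₂ * C₃ ^ k * (k : ℝ) ^ ((k : ℝ) / 2) / ShotNoise.rho d r ^ (k + 1)) := by
  have hd0 : (0 : ℝ) < d := by exact_mod_cast hd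
  have hγ0 : 0 < γ := hd0.trans hγ
  have hα0 : (0 : ℝ) < d / γ := div_pos hd0 hγ0
  have hα1 : (d : ℝ) / γ < 1 := ShotNoise.div_lt_one_of_lt hγ
  obtain ⟨A₂, A₃, A₄, hA₂, hA₃, hA₄, hright⟩ := ShotNoise.exists_right_expansion hα0 hα1
  obtain ⟨B₂, B₃, B₄, hB₂, hB₃, hB₄, hleft⟩ := ShotNoise.exists_left_expansion hα0 hα1
  have hconst : ∀ k : ℕ, 2 * (A₂ * A₃ ^ k) ≤ 2 * (A₂ + B₂) * (A₃ + B₃) ^ k ∧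
      2 * (B₂ * B₃ ^ k) ≤ 2 * (A₂ + B₂) * (A₃ + B₃) ^ k := fun k => by
    have h1 : A₂ * A₃ ^ k ≤ (A₂ + B₂) * (A₃ + B₃) ^ k := by
      gcongr <;> linarith
    have h2 : B₂ * B₃ ^ k ≤ (A₂ + B₂) * (A₃ + B₃) ^ k := by
      gcongr <;> linarith
    constructor <;> linarith
  -- Sums dominate the constants of both tails; the 2 comes from the passage to relative errors.
  refine ⟨2 * (A₂ + B₂), A₃ + B₃, A₄ + B₄, by positivity, by positivity, by positivity, ?_⟩
  intro Ω _ P _ Φ h r hr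
  have hρ1 := ShotNoise.one_le_rho d hr
  have hρ0 : 0 < ShotNoise.rho d r := by linarith
  have hlaw := h.isNoiseLaw hd hγ hr
  refine ⟨h.ae_summable_tailTerm hd hγ hr, h.memLp_tailNoise hd hγ hr, h.noiseStd_pos hd hγ hr,
    fun t => h.integrable_exp_normNoise hd hγ hr (-t), ?_⟩
  obtain ⟨f, hf, hf0, hQ, hfy⟩ := hlaw.exists_density hα0 hα1 hρ0
  refine ⟨f, hf, hf0, hQ, fun y hy => ?_⟩
  rw [h.noiseMean_div_noiseStd hd hγ hr] at hy
  -- Here b = ξ / ρ is found by matching the tilted mean with y.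
  obtain ⟨b, hb⟩ := ShotNoise.exists_levyMean_eq hα1
    (v := y / ShotNoise.rho d r + ShotNoise.levyMean (d / γ) 0) (by
      rw [← neg_lt_iff_pos_add, lt_div_iff₀ hρ0]
      linarith)
  have hξ : ShotNoise.rho d r * b / ShotNoise.rho d r = b := by field_simp
  have hy' : ShotNoise.rho d r *
      (ShotNoise.levyMean (d / γ) (ShotNoise.rho d r * b / ShotNoise.rho d r) -
        ShotNoise.levyMean (d / γ) 0) = y := by
    rw [hξ, hb]; field_simp; ring
  set ξ := ShotNoise.rho d r * b with hξdef
  have hκ : ∀ n, 2 ≤ n → ShotNoise.tkappa d γ r ξ n =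
      ShotNoise.powerMoment (d / γ) (n - 2) (ξ / ShotNoise.rho d r) := fun n hn =>
    ShotNoise.tkappa_eq_powerMoment hα1 r ξ hn
  have hκ2 : ShotNoise.tkappa d γ r ξ 2 =
    ShotNoise.powerMoment (d / γ) 0 (ξ / ShotNoise.rho d r) := hκ 2 le_rfl
  have hκ0 : 0 < ShotNoise.tkappa d γ r ξ 2 := hκ2 ▸ ShotNoise.powerMoment_zero_pos hα1 _
  have hyb : y = ShotNoise.rho d r * (ShotNoise.levyMean (d / γ) (ξ / ShotNoise.rho d r) -
    ShotNoise.levyMean (d / γ) 0) := hy'.symm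
  obtain ⟨g, hfg, hg⟩ := hfy ξ y hy'
  have hfun : (fun x : ℝ => Real.exp (-x * y) *
      ShotNoise.laplace P (ShotNoise.normNoise P Φ γ r) (-x)) =
      fun x => Real.exp (ShotNoise.noiseCgf (d / γ) (ShotNoise.rho d r) x - x * y) := by
    funext x
    rw [h.laplace_normNoise hd hγ hr, ← Real.exp_add]
    congr 1; ring
  refine ⟨ξ, fun ξ' => ?_, ?_, ?_, ?_, ?_, ?_⟩
  · rw [hfun]
    constructor
    · intro hmin
      have hmin' : IsMinOn (fun x => ShotNoise.noiseCgf (d / γ) (ShotNoise.rho d r) x - x * y)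
          univ ξ' := fun x hx => Real.exp_le_exp.1 (hmin hx)
      have h1 := (hmin'.isLocalMin Filter.univ_mem).hasDerivAt_eq_zero
        ((ShotNoise.hasDerivAt_noiseCgf hα1 hρ0 ξ').sub ((hasDerivAt_id ξ').mul_const y))
      have h2 : ShotNoise.levyMean (d / γ) (ξ' / ShotNoise.rho d r) =
          ShotNoise.levyMean (d / γ) (ξ / ShotNoise.rho d r) := by
        have h3 : ShotNoise.rho d r * ShotNoise.levyMean (d / γ) (ξ' / ShotNoise.rho d r) =
            ShotNoise.rho d r * ShotNoise.levyMean (d / γ) (ξ / ShotNoise.rho d r) := by linarith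
        exact mul_left_cancel₀ hρ0.ne' h3
      have h4 := (ShotNoise.strictMono_levyMean hα1).injective h2
      exact (div_left_inj' hρ0.ne').1 h4
    · rintro rfl x -
      refine Real.exp_le_exp.2 ?_
      have h1 := ShotNoise.noiseCgf_add_le hα1 hρ0 ξ x
      rw [hy'] at h1
      linarith
  · exact (hlaw.integral_tilted hα1 hρ0 ξ).trans hy'
  · exact (hlaw.variance_tilted hα1 hρ0 ξ).trans hκ2.symm
  · intro n hn
    rw [hκ n hn]
    exact hlaw.iteratedDeriv_cgf_tilted hα1 hρ0 ξ hn
  · intro k hy0 hk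
    -- Strict monotonicity of the mean lets the sign of y fix the direction of the tilt; tilting to
    -- the right then gives κ₂ ≥ 1 and the second inequality.
    have hb0 : 0 ≤ ξ / ShotNoise.rho d r := by
      refine (ShotNoise.strictMono_levyMean hα1).le_iff_le.1 ?_
      rw [hyb] at hy0
      linarith [nonneg_of_mul_nonneg_right hy0 hρ0]
    have hk' : A₄ * Real.sqrt k ≤ ShotNoise.rho d r := le_trans (by gcongr; linarith) hk
    obtain ⟨h1, h2⟩ := hright _ _ _ hρ1 hb0 hκ k hk'
    obtain ⟨ε, hε, hε'⟩ := ShotNoise.exists_relative_error hκ0 h1 h2 hg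
    have hκ1 : 1 ≤ Real.sqrt (ShotNoise.tkappa d γ r ξ 2) := by
      rw [Real.one_le_sqrt, hκ2, ← ShotNoise.powerMoment_zero_zero hα1]
      exact ShotNoise.powerMoment_zero_mono hα1 hb0
    refine ⟨ε, ?_, hε'.trans ?_, ?_⟩
    · rw [hfg, hε, h.laplace_normNoise hd hγ hr]; ring
    · rw [mul_div_assoc']
      refine div_le_div_of_nonneg_right ?_ (by positivity)
      calc _ = 2 * (A₂ * A₃ ^ k) * (k : ℝ) ^ ((k : ℝ) / 2) := by ring
        _ ≤ _ := mul_le_mul_of_nonneg_right (hconst k).1 (by positivity)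
    · refine div_le_div_of_nonneg_left (by positivity) (by positivity) ?_
      gcongr
      exact le_mul_of_one_le_left hρ0.le hκ1
  · intro k hy0 hk
    have hb0 : ξ / ShotNoise.rho d r ≤ 0 := by
      refine (ShotNoise.strictMono_levyMean hα1).le_iff_le.1 ?_
      rw [hyb] at hy0
      linarith [nonpos_of_mul_nonpos_right hy0 hρ0]
    have hk' : B₄ * Real.sqrt k ≤ ShotNoise.rho d r :=
      le_trans (by gcongr; linarith) ((le_max_left _ _).trans hk)
    obtain ⟨h1, h2⟩ := hleft _ _ _ hρ1 hb0 hκ k hk'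
    obtain ⟨ε, hε, hε'⟩ := ShotNoise.exists_relative_error hκ0 h1 h2 hg
    have hκ1 : ShotNoise.tkappa d γ r ξ 2 ≤ 1 := by
      rw [hκ2, ← ShotNoise.powerMoment_zero_zero hα1]
      exact ShotNoise.powerMoment_zero_mono hα1 hb0
    have hp : 0 < ShotNoise.dOne d γ := by rw [ShotNoise.dOne]; linarith
    -- For left tilting κ₂ ≤ 1, and the exponent is nonnegative because d₁ < 2.
    have hpow : ShotNoise.tkappa d γ r ξ 2 ^ (1 / ShotNoise.dOne d γ - 1 / 2) ≤ 1 := by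
      refine Real.rpow_le_one hκ0.le hκ1 (sub_nonneg.2 ?_)
      exact one_div_le_one_div_of_le hp (by rw [ShotNoise.dOne]; linarith)
    refine ⟨ε, ?_, hε'.trans ?_, ?_⟩
    · rw [hfg, hε, h.laplace_normNoise hd hγ hr]; ring
    · rw [← mul_assoc]
      refine mul_le_mul_of_nonneg_right ?_ (by positivity)
      calc _ = 2 * (B₂ * B₃ ^ k) * (k : ℝ) ^ ((k : ℝ) / 2) := by ring
        _ ≤ _ := mul_le_mul_of_nonneg_right (hconst k).2 (by positivity)
    · rw [div_eq_mul_one_div _ (ShotNoise.rho d r ^ (k + 1)), ← one_div_pow]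
      gcongr
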